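/- **Notation.** For $x$ in $\mathbb R$ or $\mathbb R^3$, $\langle x\rangle=\sqrt{1+|x|^2}$; $\hat v=v/\langle v\rangle$ for $v\in\mathbb R^3$; $\nabla_v\hat v$ is the Jacobian matrix of $v\mapsto\hat v$ and $\nabla_{\hat v}v=(\nabla_v\hat v)^{-1}$ that of the inverse map $w\mapsto w/\sqrt{1-|w|^2}$. Let $\lambda_\pm(k)=\pm i\langle k\rangle$, $a_\pm(k)=\pm\frac{1}{2i\langle k\rangle}$, let $G^{osc}_\pm(t,\cdot)$ have Fourier symbol $e^{\lambda_\pm(k)t}a_\pm(k)$, and let $\phi_{\pm,j}(\cdot,v)$ have Fourier symbol $(\lambda_\pm(k)+ik\cdot\hat v)^{-j}$, $j\ge1$. **The field.** Fix an integer $\alpha_0\ge 8$; put $\delta_\alpha=|\alpha|/(\alpha_0-1)$ and $\delta_1=1/(\alpha_0-1)$. On a time interval $[0,T]$ let $$E=\sum_\pm E^{osc}_\pm+E^r,\qquad E^{osc}_\pm(t)=G^{osc}_\pm(t)\star_xF_0+G^{osc}_\pm\star_{t,x}F,\qquad F_0=\nabla_xS_0,\quad F=\nabla_xS,$$ with $S_0\in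 L^2(\mathbb R^3)$, $S$ and $E^r$ continuous on $[0,T]\times\mathbb R^3$, and $E^r$ real. (The densities $S_0,S$ may depend on the sign $\pm$; then the ones for $-$ are the complex conjugates of the ones for $+$.) Assume that for all $t\in[0,T]$, with weak derivatives in $x$, $$\|S(t)\|_{L^p},\ \|\partial_xS(t)\|_{L^p},\ \|E^r(t)\|_{L^p}\le\epsilon\langle t\rangle^{-3(1-1/p)}\ (1\le p\le\infty),\qquad \|E^{osc}_\pm(t)\|_{L^p}\le\epsilon\langle t\rangle^{-3(1/2-1/p)}\ (2\le p\le\infty);$$ $$\|\partial_x^\alpha S(t)\|_{L^p},\ \|\partial_x^\alpha E^r(t)\|_{L^p}\le\epsilon\langle t\rangle^{-3(1-1/p)+\delta_\alpha}\ (1\le p\le\infty),\qquad \|\partial_x\partial_x^{\alpha}E^r(t)\|_{L^2}\le\epsilon\langle t\rangle^{-3/2+\delta_\alpha}$$ for $1\le|\alpha|\le\alpha_0-1$; and $$\|E^{osc}_\pm(t)\|_{H^{\alpha_0}}\le\epsilon,\qquad \|E^{osc}_\pm(t)\|_{H^{\alpha_0+1}},\ \|E^r(t)\|_{H^{\alpha_0+1}},\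 \|S(t)\|_{H^{\alpha_0}}\le\epsilon\langle t\rangle^{\delta_1}.$$ **Characteristics.** For $0\le s\le t\le T$ let $X_{s,t}(x,v),V_{s,t}(x,v)$ solve $\frac{d}{ds}X_{s,t}=\widehat V_{s,t}$, $\frac{d}{ds}V_{s,t}=E(s,X_{s,t})$, $X_{t,t}=x$, $V_{t,t}=v$. For $s<t$ put $$\widehat\Psi_{s,t}=\frac1{t-s}\int_s^t\widehat V_{\tau,t}\,d\tau,\qquad \Psi_{s,t}=\frac{\widehat\Psi_{s,t}}{\sqrt{1-|\widehat\Psi_{s,t}|^2}},\qquad E^{osc,j}_\pm(t,x,v)=[E^{osc}_\pm\star_x\phi_{\pm,j}](t,x,v),$$ $$V^{osc}_{s,t}=\sum_\pm E^{osc,1}_\pm(s,X_{s,t},V_{s,t}),\qquad \Psi^{osc}_{s,t}=\frac1{t-s}\sum_\pm\Big(E^{osc,2}_\pm(t,x,v)-E^{osc,2}_\pm(s,X_{s,t},V_{s,t})\Big),$$ $$\Psi^{tr}_{s,t}=-\frac1{t-s}\int_s^t[(\tau-s)Q^{tr}+Q^{tr,1}](\tau,X_{\tau,t},V_{\tau,t})\,d\tau,$$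 $$Q^{tr}=-\sum_\pm a_\pm(i\partial_x)\phi_{\pm,1}\star_xF+\sum_\pm(\nabla_v\hat v\,E)\cdot\nabla_xE^{osc,2}_\pm+E^r,\qquad Q^{tr,1}=\sum_\pm a_\pm(i\partial_x)\phi_{\pm,2}\star_xF-2\sum_\pm(\nabla_v\hat v\,E)\cdot\nabla_xE^{osc,3}_\pm,$$ $$V^Q_{s,t}=\widehat V_{s,t}-\hat v-\nabla_v\hat v\,(V_{s,t}-v),\qquad \Psi^Q_{s,t}=\frac1{t-s}\int_s^tV^Q_{\tau,t}\,d\tau,$$ and $\widehat V^{osc}_{t,t}=\nabla_v\hat v\,V^{osc}_{t,t}$, $\widehat\Psi^{a}_{s,t}=\nabla_v\hat v\,\Psi^a_{s,t}$ for $a\in\{osc,tr\}$ (with $\nabla_v\hat v$ taken at $v$). **Proposition 3.4.** There are $\epsilon_0>0$ and $C_0$ depending only on $\alpha_0$, and for every compact $K\subset\mathbb R^3$ a constant $C_K$ depending only on $\alpha_0$ and $K$, such that if $0<\epsilon\le\epsilon_0$, then for all $T$, all fields as above, all $0\le s<t\le T$ and all $x,v\in\mathbb R^3$: the integrals above converge,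 $X_{s,t}=x-(t-s)\widehat\Psi_{s,t}$, $|\widehat\Psi_{s,t}|<1$, and $$\Psi_{s,t}=v-V^{osc}_{t,t}+\Psi^{osc}_{s,t}+\Psi^{tr}_{s,t}+\Psi^R_{s,t},\qquad \widehat\Psi_{s,t}=\hat v-\widehat V^{osc}_{t,t}+\widehat\Psi^{osc}_{s,t}+\widehat\Psi^{tr}_{s,t}+\Psi^Q_{s,t},$$ where $|V^Q_{s,t}|\le C_0\langle v\rangle^{-2}|V_{s,t}-v|^2$ and $|\Psi^R_{s,t}-(\nabla_v\hat v)^{-1}\Psi^Q_{s,t}|\le C_0\langle v\rangle^5|\widehat\Psi_{s,t}-\hat v|^2$. Moreover, for all $x\in\mathbb R^3$ and $v\in K$, $$|\Psi^{osc}_{s,t}|\le C_K\,\epsilon\langle s\rangle^{-3/2}(t-s)^{-1},\qquad |\Psi^{tr}_{s,t}|\le C_K\,\epsilon\langle s\rangle^{-1}\langle t\rangle^{-1},$$ $$|\Psi^{Q}_{s,t}|\le C_K\,\epsilon^2\langle s\rangle^{-2}\langle t\rangle^{-1},\qquad \langle v\rangle^{-3}|\Psi^{R}_{s,t}|\le C_K\,\epsilon^2\langle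 s\rangle^{-2}\langle t\rangle^{-1},$$ $$|\widehat\Psi_{s,t}-\hat v+\widehat V^{osc}_{t,t}|\le C_K\,\epsilon\langle s\rangle^{-1}(t-s)^{-1},\qquad |X_{s,t}-x+(t-s)(\hat v-\widehat V^{osc}_{t,t})|\le C_K\,\epsilon\langle s\rangle^{-1}.$$ -/

import Mathlib

open MeasureTheory Set
open scoped FourierTransform ENNReal RealInnerProductSpace ContDiff

noncomputable section

namespace VKG

/-- Physical space `ℝ³` (positions, velocities, wave vectors). -/
abbrev R3 := EuclideanSpace ℝ (Fin 3)

/-- Complex vectors `ℂ³`. -/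
abbrev C3 := EuclideanSpace ℂ (Fin 3)

/-- Japanese bracket `⟨x⟩ = √(1 + |x|²)`, for vectors and for real numbers. -/
def jap {F : Type*} [Norm F] (x : F) : ℝ := √(1 + ‖x‖ ^ 2)

/-- Relativistic velocity `v̂ = v / ⟨v⟩`. -/
def hat (v : R3) : R3 := (jap v)⁻¹ • v

/-- The inverse `w ↦ w / √(1 - |w|²)` of `v ↦ v̂` on the open unit ball. -/
def unhat (w : R3) : R3 := (√(1 - ‖w‖ ^ 2))⁻¹ • w

/-- The matrix `∇_v v̂` at `v`. -/
def gradHat (v : R3) : R3 →L[ℝ] R3 := fderiv ℝ hat v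

/-- The matrix `∇_{v̂} v = (∇_v v̂)⁻¹` at the velocity `v`. -/
def gradUnhat (v : R3) : R3 →L[ℝ] R3 := fderiv ℝ unhat (hat v)

/-- A real vector as a complex vector. -/
def cvec (w : R3) : C3 := WithLp.toLp 2 fun i => (w i : ℂ)

/-- Real part of a complex vector; only used for sums over `±` of two complex conjugate vectors. -/
def reVec (z : C3) : R3 := WithLp.toLp 2 fun i => (z i).re

/-! ### Symbols

The sign `±` is a `σ : ℤˣ`. A symbol in the wave vector `k` is evaluated at `k = 2πξ`, where `ξ` is
the frequency variable of Mathlib's Fourier transform `∫ e^{-2πi x·ξ} f(x) dx`. -/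

/-- The wave vector `k = 2πξ`. -/
def wave (ξ : R3) : R3 := (2 * Real.pi) • ξ

/-- `λ_±(k) = ± i ⟨k⟩`. -/
def lam (σ : ℤˣ) (k : R3) : ℂ := ((σ : ℤ) : ℂ) * Complex.I * (jap k : ℂ)

/-- `a_±(k) = ± 1 / (2 i ⟨k⟩) = ∓ (i/2) ⟨k⟩⁻¹`. -/
def amp (σ : ℤˣ) (k : R3) : ℂ := ((σ : ℤ) : ℂ) / (2 * Complex.I * (jap k : ℂ))

/-- `λ_±(k) + i k · v̂`. -/
def omegaSym (σ : ℤˣ) (v k : R3) : ℂ := lam σ k + Complex.I * ((⟪k, hat v⟫ : ℝ) : ℂ)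

/-! ### The electric field -/

/-- The data of the electric field: `S₀` and `S(t,x)`, whose gradients are `F₀` and `F`
(for each sign `±`), and the remainder `E^r(t,x)`. -/
structure FieldData where
  /-- the initial density `S₀ ∈ L²` -/
  S0 : ℤˣ → Lp ℂ 2 (volume : Measure R3)
  /-- the source density `S(t,x)` -/
  S : ℤˣ → ℝ → R3 → ℂ
  /-- the remainder field `E^r(t,x)` -/
  Er : ℝ → R3 → R3

namespace FieldData

variable (D : FieldData)

/-- The Fourier transform `i k Ŝ₀` of `F₀ = ∇S₀` (with the `L²` Fourier transform of `S₀`). -/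
def F0hat (σ : ℤˣ) (ξ : R3) : C3 :=
  (𝓕 (D.S0 σ) : Lp ℂ 2 (volume : Measure R3)) ξ • (Complex.I • cvec (wave ξ))

/-- The Fourier transform `i k Ŝ(t)` of `F(t) = ∇S(t)`. -/
def Fhat (σ : ℤˣ) (t : ℝ) (ξ : R3) : C3 :=
  𝓕 (D.S σ t) ξ • (Complex.I • cvec (wave ξ))

/-- `B̂_±(t,k) = a_±(k) F̂₀(k) + ∫₀ᵗ e^{-λ_±(k) s} a_±(k) F̂(s,k) ds`. -/
def Bhat (σ : ℤˣ) (t : ℝ) (ξ : R3) : C3 :=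
  amp σ (wave ξ) • D.F0hat σ ξ +
    ∫ s in (0 : ℝ)..t, (Complex.exp (-(lam σ (wave ξ)) * (s : ℂ)) * amp σ (wave ξ)) • D.Fhat σ s ξ

/-- The Fourier transform `e^{λ_± t} B̂_±(t)` of
`E^osc_±(t) = G^osc_±(t) ⋆_x F₀ + G^osc_± ⋆_{t,x} F`, where `Ĝ^osc_±(t,k) = e^{λ_±(k) t} a_±(k)`. -/
def EoscHat (σ : ℤˣ) (t : ℝ) (ξ : R3) : C3 :=
  Complex.exp (lam σ (wave ξ) * (t : ℂ)) • D.Bhat σ t ξ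

/-- The oscillatory field `E^osc_±(t,x)`. -/
def Eosc (σ : ℤˣ) (t : ℝ) (x : R3) : C3 := 𝓕⁻ (D.EoscHat σ t) x

/-- The electric field `E = ∑_± E^osc_± + E^r`. -/
def E (t : ℝ) (x : R3) : R3 := reVec (∑ σ : ℤˣ, D.Eosc σ t x) + D.Er t x

/-- `E^{osc,j}_±(t,x,v) = [E^osc_± ⋆_x φ_{±,j}](t,x,v)`, where `φ_{±,j}(·,v)` is the kernel with
Fourier symbol `(λ_±(k) + i k · v̂)^{-j}`. -/
def EoscJ (σ : ℤˣ) (j : ℕ) (t : ℝ) (x v : R3) : C3 :=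
  𝓕⁻ (fun ξ => ((omegaSym σ v (wave ξ)) ^ j)⁻¹ • D.EoscHat σ t ξ) x

/-- `[a_±(i∂_x) φ_{±,j} ⋆_x F](t,x,v)`. -/
def aPhiF (σ : ℤˣ) (j : ℕ) (t : ℝ) (x v : R3) : C3 :=
  𝓕⁻ (fun ξ => (amp σ (wave ξ) * ((omegaSym σ v (wave ξ)) ^ j)⁻¹) • D.Fhat σ t ξ) x

/-- `[(∇_v v̂ E) · ∇_x E^{osc,j}_±](t,x,v)`. -/
def advect (σ : ℤˣ) (j : ℕ) (t : ℝ) (x v : R3) : C3 :=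
  fderiv ℝ (fun y => D.EoscJ σ j t y v) x (gradHat v (D.E t x))

/-- `Q^tr = - ∑_± a_±(i∂_x) φ_{±,1} ⋆_x F + ∑_± (∇_v v̂ E) · ∇_x E^{osc,2}_± + E^r`. -/
def Qtr (t : ℝ) (x v : R3) : R3 :=
  reVec (∑ σ : ℤˣ, (- D.aPhiF σ 1 t x v + D.advect σ 2 t x v)) + D.Er t x

/-- `Q^{tr,1} = ∑_± a_±(i∂_x) φ_{±,2} ⋆_x F - 2 ∑_± (∇_v v̂ E) · ∇_x E^{osc,3}_±`. -/
def Qtr1 (t : ℝ) (x v : R3) : R3 :=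
  reVec (∑ σ : ℤˣ, (D.aPhiF σ 2 t x v - (2 : ℝ) • D.advect σ 3 t x v))

end FieldData

/-! ### Weak derivatives, Sobolev norms and the bootstrap assumptions -/

/-- `g` is the weak derivative `∂_{w 0} ⋯ ∂_{w (n-1)} f` on `ℝ³`. -/
structure HasWeakDeriv {F : Type*} [NormedAddCommGroup F] [NormedSpace ℝ F] {n : ℕ}
    (w : Fin n → Fin 3) (f g : R3 → F) : Prop where
  locallyIntegrable_left : LocallyIntegrable f volume
  locallyIntegrable_right : LocallyIntegrable g volume
  integral_eq : ∀ φ : R3 → ℝ, ContDiff ℝ ∞ φ → HasCompactSupport φ →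
    ∫ x, (iteratedFDeriv ℝ n φ x fun j => EuclideanSpace.single (w j) (1 : ℝ)) • f x =
      (-1 : ℝ) ^ n • ∫ x, φ x • g x

/-- All weak partial derivatives of `f` of order exactly `n` have `L^p` norm at most `b`. -/
def DerivBound {F : Type*} [NormedAddCommGroup F] [NormedSpace ℝ F]
    (n : ℕ) (p : ℝ≥0∞) (f : R3 → F) (b : ℝ) : Prop :=
  ∀ w : Fin n → Fin 3, ∃ g : R3 → F,
    HasWeakDeriv w f g ∧ eLpNorm g p volume ≤ ENNReal.ofReal b

/-- The `H^m` norm `‖⟨k⟩^m f̂‖_{L²}` of the function with Fourier transform `fhat`. -/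
def sobolevNorm {F : Type*} [NormedAddCommGroup F] [NormedSpace ℝ F]
    (m : ℕ) (fhat : R3 → F) : ℝ≥0∞ :=
  eLpNorm (fun ξ => (jap (wave ξ)) ^ m • fhat ξ) 2 volume

/-- `δ_α = |α| / (α₀ - 1)`, for `|α| = n`. -/
def delta (α₀ n : ℕ) : ℝ := (n : ℝ) / ((α₀ : ℝ) - 1)

/-- The bootstrap assumptions with parameters `α₀`, `ε` on the time interval `[0,T]`. -/
structure Bootstrap (α₀ : ℕ) (ε T : ℝ) (D : FieldData) : Prop where
  /-- `S₀` and `S` for the sign `-` are the complex conjugates of those for `+`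
  (in particular they may be real and independent of the sign). -/
  S0_conj : ∀ᵐ x, D.S0 (-1) x = (starRingEnd ℂ) (D.S0 1 x)
  S_conj : ∀ t x, D.S (-1) t x = (starRingEnd ℂ) (D.S 1 t x)
  S_cont : ∀ σ, ContinuousOn (fun q : ℝ × R3 => D.S σ q.1 q.2) (Icc 0 T ×ˢ univ)
  Er_cont : ContinuousOn (fun q : ℝ × R3 => D.Er q.1 q.2) (Icc 0 T ×ˢ univ)
  -- decay assumptions
  S_decay : ∀ σ, ∀ t ∈ Icc 0 T, ∀ p : ℝ≥0∞, 1 ≤ p → ∀ n ≤ 1,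
    DerivBound n p (D.S σ t) (ε * jap t ^ (-3 * (1 - p⁻¹.toReal)))
  Er_decay : ∀ t ∈ Icc 0 T, ∀ p : ℝ≥0∞, 1 ≤ p →
    eLpNorm (D.Er t) p volume ≤ ENNReal.ofReal (ε * jap t ^ (-3 * (1 - p⁻¹.toReal)))
  Eosc_decay : ∀ σ, ∀ t ∈ Icc 0 T, ∀ p : ℝ≥0∞, 2 ≤ p →
    eLpNorm (D.Eosc σ t) p volume ≤ ENNReal.ofReal (ε * jap t ^ (-3 * (1 / 2 - p⁻¹.toReal)))
  -- decay assumptions for higher derivatives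
  S_high : ∀ σ, ∀ t ∈ Icc 0 T, ∀ p : ℝ≥0∞, 1 ≤ p → ∀ n, 1 ≤ n → n ≤ α₀ - 1 →
    DerivBound n p (D.S σ t) (ε * jap t ^ (-3 * (1 - p⁻¹.toReal) + delta α₀ n))
  Er_high : ∀ t ∈ Icc 0 T, ∀ p : ℝ≥0∞, 1 ≤ p → ∀ n, 1 ≤ n → n ≤ α₀ - 1 →
    DerivBound n p (D.Er t) (ε * jap t ^ (-3 * (1 - p⁻¹.toReal) + delta α₀ n))
  Er_high_succ : ∀ t ∈ Icc 0 T, ∀ n, 1 ≤ n → n ≤ α₀ - 1 →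
    DerivBound (n + 1) 2 (D.Er t) (ε * jap t ^ (-(3 / 2 : ℝ) + delta α₀ n))
  -- boundedness assumptions
  Eosc_sobolev : ∀ σ, ∀ t ∈ Icc 0 T, sobolevNorm α₀ (D.EoscHat σ t) ≤ ENNReal.ofReal ε
  Eosc_sobolev_succ : ∀ σ, ∀ t ∈ Icc 0 T,
    sobolevNorm (α₀ + 1) (D.EoscHat σ t) ≤ ENNReal.ofReal (ε * jap t ^ delta α₀ 1)
  Er_sobolev : ∀ t ∈ Icc 0 T,
    sobolevNorm (α₀ + 1) (𝓕 fun x => cvec (D.Er t x)) ≤ ENNReal.ofReal (ε * jap t ^ delta α₀ 1)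
  S_sobolev : ∀ σ, ∀ t ∈ Icc 0 T,
    sobolevNorm α₀ (𝓕 (D.S σ t)) ≤ ENNReal.ofReal (ε * jap t ^ delta α₀ 1)

/-! ### Characteristics -/

/-- `(X_{s,t}(x,v), V_{s,t}(x,v))`, written `X s t x v` and `V s t x v`, are the characteristics of
the field `E` for `0 ≤ s ≤ t ≤ T`. -/
structure IsCharacteristic (T : ℝ) (E : ℝ → R3 → R3) (X V : ℝ → ℝ → R3 → R3 → R3) : Prop where
  X_end : ∀ t ∈ Icc 0 T, ∀ x v, X t t x v = x
  V_end : ∀ t ∈ Icc 0 T, ∀ x v, V t t x v = v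
  X_deriv : ∀ t ∈ Icc 0 T, ∀ s ∈ Icc 0 t, ∀ x v,
    HasDerivWithinAt (fun τ => X τ t x v) (hat (V s t x v)) (Icc 0 t) s
  V_deriv : ∀ t ∈ Icc 0 T, ∀ s ∈ Icc 0 t, ∀ x v,
    HasDerivWithinAt (fun τ => V τ t x v) (E s (X s t x v)) (Icc 0 t) s

/-- `Ψ̂_{s,t} = (t-s)⁻¹ ∫_s^t V̂_{τ,t} dτ`. -/
def PsiHat (V : ℝ → ℝ → R3 → R3 → R3) (s t : ℝ) (x v : R3) : R3 :=
  (t - s)⁻¹ • ∫ τ in s..t, hat (V τ t x v)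

/-- `Ψ_{s,t} = Ψ̂_{s,t} / √(1 - |Ψ̂_{s,t}|²)`. -/
def Psi (V : ℝ → ℝ → R3 → R3 → R3) (s t : ℝ) (x v : R3) : R3 := unhat (PsiHat V s t x v)

/-- `V^osc_{s,t} = ∑_± E^{osc,1}_±(s, X_{s,t}, V_{s,t})`. -/
def Vosc (D : FieldData) (X V : ℝ → ℝ → R3 → R3 → R3) (s t : ℝ) (x v : R3) : R3 :=
  reVec (∑ σ : ℤˣ, D.EoscJ σ 1 s (X s t x v) (V s t x v))

/-- `Ψ^osc_{s,t} = (t-s)⁻¹ ∑_± (E^{osc,2}_±(t,x,v) - E^{osc,2}_±(s, X_{s,t}, V_{s,t}))`. -/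
def PsiOsc (D : FieldData) (X V : ℝ → ℝ → R3 → R3 → R3) (s t : ℝ) (x v : R3) : R3 :=
  (t - s)⁻¹ • reVec (∑ σ : ℤˣ, (D.EoscJ σ 2 t x v - D.EoscJ σ 2 s (X s t x v) (V s t x v)))

/-- The integrand `[(τ-s) Q^tr + Q^{tr,1}](τ, X_{τ,t}, V_{τ,t})` of `Ψ^tr_{s,t}`. -/
def trIntegrand (D : FieldData) (X V : ℝ → ℝ → R3 → R3 → R3) (s t : ℝ) (x v : R3) (τ : ℝ) : R3 :=
  (τ - s) • D.Qtr τ (X τ t x v) (V τ t x v) + D.Qtr1 τ (X τ t x v) (V τ t x v)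

/-- `Ψ^tr_{s,t} = - (t-s)⁻¹ ∫_s^t [(τ-s) Q^tr + Q^{tr,1}](τ, X_{τ,t}, V_{τ,t}) dτ`. -/
def PsiTr (D : FieldData) (X V : ℝ → ℝ → R3 → R3 → R3) (s t : ℝ) (x v : R3) : R3 :=
  -((t - s)⁻¹ • ∫ τ in s..t, trIntegrand D X V s t x v τ)

/-- The quadratic remainder `V^Q_{s,t} = V̂_{s,t} - v̂ - ∇_v v̂ (V_{s,t} - v)`. -/
def VQ (V : ℝ → ℝ → R3 → R3 → R3) (s t : ℝ) (x v : R3) : R3 :=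
  hat (V s t x v) - hat v - gradHat v (V s t x v - v)

/-- `Ψ^Q_{s,t} = (t-s)⁻¹ ∫_s^t V^Q_{τ,t} dτ`. -/
def PsiQ (V : ℝ → ℝ → R3 → R3 → R3) (s t : ℝ) (x v : R3) : R3 :=
  (t - s)⁻¹ • ∫ τ in s..t, VQ V τ t x v

end VKG

end

/-!
The field `E` decays in time only like `⟨τ⟩^{-3/2}`, which is too slow to be integrated twice, but
its slow part oscillates. On the Fourier side `E^osc_±` is `e^{λ_± τ} B̂_±(τ)`, where the profile
`B̂_±` varies slowly, and along a characteristic the exponent of `e^{λ_± τ + i k · X_τ}` has the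
derivative `ω = λ_±(k) + i k · V̂_τ` in `τ`. Massive particles are slower than the Klein-Gordon
waves, so `|ω| ≳ ⟨k⟩ / ⟨v⟩²` (`norm_omegaSym_ge`) and the phase is never stationary. Dividing by
`ω^{j+1}` and integrating in time gives the transport identity (`integral_phase_sub_eq`,
`Bootstrap.EoscJ_sub_eq_integral`)
`d/dτ E^{osc,j+1} = E^{osc,j} - (j+1) (∇_v v̂ E) · ∇_x E^{osc,j+2} + a φ_{j+1} ⋆ F`
along characteristics. For `j = 0` it says that the velocity is `V^osc` up to the time integral of
`Q^tr` (`Bootstrap.vel_sub_eq`), for `j = 1` that the time integral of `V^osc` is a boundary term up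
to the time integral of `Q^{tr,1}` (`Bootstrap.integral_Vosc_eq`). Averaging over `[s,t]`, with
Fubini on a triangle (`integral_integral_tail`), gives the linear part of `Ψ`; the Taylor expansions
of `v ↦ v̂` and of its inverse (`norm_hat_taylor_le`, `norm_unhat_taylor_le`) give the quadratic
remainders.

Since `S` is only continuous in space and time, with integrable Fourier transforms at each time,
`B̂_±` is absolutely continuous in `τ` but need not be `C¹`. The transport identity is therefore
proved at each frequency by the product rule for absolutely continuous functions
(`smul_sub_smul_eq_integral`) and then integrated in the frequency; the Sobolev bounds provide a
dominating function with one moment to spare (`IsProfile`, `Bootstrap.isProfile`).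

Both `Q^tr` and `Q^{tr,1}` are `O(ε ⟨τ⟩^{-3})` (`Bootstrap.exists_decay_bounds`): the quadratic
terms are products of two factors `⟨τ⟩^{-3/2}`, and the source `F` has the faster decay. This needs
the operators with the symbols `ω^{-1}` and `k ω^{-2}` to be bounded on `L^∞` (not only on `L^2`),
uniformly for bounded `v`. Their symbols have order `-1`, and the kernel of such a symbol is
integrable on `ℝ³`, by Plancherel and the integrability of `(|x|² + |x|⁴)⁻¹`
(`exists_integral_norm_fourierInv_le`, `exists_multiplier_bound`). The remaining estimates are
elementary time integrals such as `(t-s)⁻¹ ∫_s^t (1+τ)^{-2} dτ = ((1+s)(1+t))⁻¹`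
(`Bootstrap.exists_decay_PsiHat`).
-/

namespace VKG

/-! ### The Japanese bracket -/

section Bracket

variable {F : Type*} [NormedAddCommGroup F]

lemma jap_sq (x : F) : jap x ^ 2 = 1 + ‖x‖ ^ 2 := Real.sq_sqrt (by positivity)

lemma jap_pos (x : F) : 0 < jap x := Real.sqrt_pos.2 (by positivity)

lemma one_le_jap (x : F) : 1 ≤ jap x := by
  have := jap_sq x
  nlinarith [jap_pos x, sq_nonneg ‖x‖]

lemma norm_le_jap (x : F) : ‖x‖ ≤ jap x := by
  apply Real.le_sqrt_of_sq_le; linarith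

lemma norm_lt_jap (x : F) : ‖x‖ < jap x := by
  apply Real.lt_sqrt_of_sq_lt; linarith

lemma jap_mono {x y : F} (h : ‖x‖ ≤ ‖y‖) : jap x ≤ jap y := by
  apply Real.sqrt_le_sqrt; gcongr

lemma jap_le_one_add (x : F) : jap x ≤ 1 + ‖x‖ := by
  have := jap_sq x
  nlinarith [jap_pos x, norm_nonneg x]

lemma one_add_le_two_mul_jap (x : F) : 1 + ‖x‖ ≤ 2 * jap x := by
  linarith [one_le_jap x, norm_le_jap x]

lemma jap_zero : jap (0 : F) = 1 := by simp [jap]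

lemma contDiff_jap {G : Type*} [NormedAddCommGroup G] [InnerProductSpace ℝ G] :
    ContDiff ℝ ∞ (jap : G → ℝ) := by
  have h : ContDiff ℝ ∞ (fun x : G => 1 + ‖x‖ ^ 2) := contDiff_const.add (contDiff_norm_sq ℝ)
  exact h.sqrt fun x => by positivity

lemma continuous_jap : Continuous (jap : F → ℝ) := by
  unfold jap; fun_prop

end Bracket

lemma norm_hat_eq (v : R3) : ‖hat v‖ = ‖v‖ / jap v := by
  rw [hat, norm_smul, norm_inv, Real.norm_of_nonneg (jap_pos v).le, div_eq_inv_mul]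

lemma norm_hat_lt_one (v : R3) : ‖hat v‖ < 1 := by
  rw [norm_hat_eq, div_lt_one (jap_pos v)]; exact norm_lt_jap v

/-! ### Symbols of order `n` -/

/-- The partial derivative in the `i`-th coordinate of the frequency. -/
noncomputable def pd (i : Fin 3) (m : R3 → ℂ) (ξ : R3) : ℂ :=
  fderiv ℝ m ξ (EuclideanSpace.single i 1)

lemma contDiff_pd {m : R3 → ℂ} (hm : ContDiff ℝ ∞ m) (i : Fin 3) : ContDiff ℝ ∞ (pd i m) :=
  (hm.fderiv_right (by simp)).clm_apply contDiff_const

lemma pd_mul {f g : R3 → ℂ} (hf : ContDiff ℝ ∞ f) (hg : ContDiff ℝ ∞ g) (i : Fin 3) :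
    pd i (fun ξ => f ξ * g ξ) = fun ξ => f ξ * pd i g ξ + pd i f ξ * g ξ := by
  ext ξ
  have hf' : DifferentiableAt ℝ f ξ := hf.differentiable (by simp) ξ
  have hg' : DifferentiableAt ℝ g ξ := hg.differentiable (by simp) ξ
  simp [pd, fderiv_fun_mul hf' hg', mul_comm (g ξ)]

lemma pd_add {f g : R3 → ℂ} (hf : ContDiff ℝ ∞ f) (hg : ContDiff ℝ ∞ g) (i : Fin 3) :
    pd i (fun ξ => f ξ + g ξ) = fun ξ => pd i f ξ + pd i g ξ := by
  ext ξ
  have hf' : DifferentiableAt ℝ f ξ := hf.differentiable (by simp) ξ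
  have hg' : DifferentiableAt ℝ g ξ := hg.differentiable (by simp) ξ
  simp [pd, fderiv_fun_add hf' hg']

lemma pd_const_mul {f : R3 → ℂ} (hf : ContDiff ℝ ∞ f) (c : ℂ) (i : Fin 3) :
    pd i (fun ξ => c * f ξ) = fun ξ => c * pd i f ξ := by
  ext ξ
  have hf' : DifferentiableAt ℝ f ξ := hf.differentiable (by simp) ξ
  simp [pd, fderiv_const_mul hf']

lemma pd_const (c : ℂ) (i : Fin 3) : pd i (fun _ => c) = fun _ => 0 := by
  ext ξ; simp [pd]

lemma pd_inv {f : R3 → ℂ} (hf : ContDiff ℝ ∞ f) (h0 : ∀ ξ, f ξ ≠ 0) (i : Fin 3) :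
    pd i (fun ξ => (f ξ)⁻¹) = fun ξ => -(pd i f ξ * ((f ξ)⁻¹ * (f ξ)⁻¹)) := by
  ext ξ
  have hf' : HasFDerivAt f (fderiv ℝ f ξ) ξ := (hf.differentiable (by simp) ξ).hasFDerivAt
  have hi := ((hasFDerivAt_inv (𝕜 := ℂ) (h0 ξ)).restrictScalars ℝ).comp ξ hf'
  have hi' : HasFDerivAt (fun ξ => (f ξ)⁻¹) _ ξ := hi
  rw [pd, hi'.fderiv]
  simp [pd, sq]

/-- `m` is a smooth symbol of order `n` in the wave vector: `∂_i^j m = O(⟨k⟩^{n-j})` for `j ≤ 2`,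
with constant `C`. Only the pure second derivatives in the coordinate directions are recorded. -/
structure IsSymbol (n : ℤ) (C : ℝ) (m : R3 → ℂ) : Prop where
  smooth : ContDiff ℝ ∞ m
  bound : ∀ ξ, ‖m ξ‖ ≤ C * jap (wave ξ) ^ n
  bound_pd : ∀ i ξ, ‖pd i m ξ‖ ≤ C * jap (wave ξ) ^ (n - 1)
  bound_pd_pd : ∀ i ξ, ‖pd i (pd i m) ξ‖ ≤ C * jap (wave ξ) ^ (n - 2)

namespace IsSymbol

lemma nonneg {n : ℤ} {C : ℝ} {m : R3 → ℂ} (h : IsSymbol n C m) : 0 ≤ C := by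
  have h1 := (norm_nonneg _).trans (h.bound 0)
  have h2 : 0 < jap (wave 0) ^ n := zpow_pos (jap_pos _) _
  exact nonneg_of_mul_nonneg_left h1 h2

lemma mono {n : ℤ} {C C' : ℝ} {m : R3 → ℂ} (h : IsSymbol n C m) (hC : C ≤ C') :
    IsSymbol n C' m := by
  have hp : ∀ ξ (n : ℤ), 0 < jap (wave ξ) ^ n := fun ξ n => zpow_pos (jap_pos _) _
  exact ⟨h.smooth, fun ξ => (h.bound ξ).trans (by gcongr; exact (hp _ _).le),
    fun i ξ => (h.bound_pd i ξ).trans (by gcongr; exact (hp _ _).le),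
    fun i ξ => (h.bound_pd_pd i ξ).trans (by gcongr; exact (hp _ _).le)⟩

lemma mul {n₁ n₂ : ℤ} {C₁ C₂ : ℝ} {f g : R3 → ℂ} (hf : IsSymbol n₁ C₁ f)
    (hg : IsSymbol n₂ C₂ g) : IsSymbol (n₁ + n₂) (4 * C₁ * C₂) (fun ξ => f ξ * g ξ) := by
  have h1 := hf.nonneg
  have h2 := hg.nonneg
  have hp : ∀ ξ, jap (wave ξ) ≠ 0 := fun ξ => (jap_pos _).ne'
  have hpos : ∀ ξ (n : ℤ), 0 < jap (wave ξ) ^ n := fun ξ n => zpow_pos (jap_pos _) _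
  have key : ∀ (ξ : R3) (a b c : ℤ) (z w : ℂ), a + b = c →
      ‖z‖ ≤ C₁ * jap (wave ξ) ^ a → ‖w‖ ≤ C₂ * jap (wave ξ) ^ b →
      ‖z * w‖ ≤ C₁ * C₂ * jap (wave ξ) ^ c := by
    intro ξ a b c z w habc hz hw
    rw [norm_mul, ← habc, zpow_add₀ (hp ξ)]
    calc ‖z‖ * ‖w‖ ≤ (C₁ * jap (wave ξ) ^ a) * (C₂ * jap (wave ξ) ^ b) := by
          gcongr; exact mul_nonneg h1 (hpos _ _).le
      _ = _ := by ring
  refine ⟨hf.smooth.mul hg.smooth, fun ξ => ?_, fun i ξ => ?_, fun i ξ => ?_⟩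
  · have := key ξ n₁ n₂ (n₁ + n₂) _ _ rfl (hf.bound ξ) (hg.bound ξ)
    nlinarith [mul_nonneg (mul_nonneg h1 h2) (hpos ξ (n₁ + n₂)).le]
  · rw [pd_mul hf.smooth hg.smooth]
    have a1 := key ξ n₁ (n₂ - 1) (n₁ + n₂ - 1) _ _ (by ring) (hf.bound ξ) (hg.bound_pd i ξ)
    have a2 := key ξ (n₁ - 1) n₂ (n₁ + n₂ - 1) _ _ (by ring) (hf.bound_pd i ξ) (hg.bound ξ)
    refine (norm_add_le _ _).trans ?_
    nlinarith [mul_nonneg (mul_nonneg h1 h2) (hpos ξ (n₁ + n₂ - 1)).le]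
  · rw [pd_mul hf.smooth hg.smooth, pd_add (hf.smooth.mul (contDiff_pd hg.smooth i))
      ((contDiff_pd hf.smooth i).mul hg.smooth), pd_mul hf.smooth (contDiff_pd hg.smooth i),
      pd_mul (contDiff_pd hf.smooth i) hg.smooth]
    have a1 := key ξ n₁ (n₂ - 2) (n₁ + n₂ - 2) _ _ (by ring) (hf.bound ξ) (hg.bound_pd_pd i ξ)
    have a2 := key ξ (n₁ - 1) (n₂ - 1) (n₁ + n₂ - 2) _ _ (by ring) (hf.bound_pd i ξ)
      (hg.bound_pd i ξ)
    have a3 := key ξ (n₁ - 2) n₂ (n₁ + n₂ - 2) _ _ (by ring) (hf.bound_pd_pd i ξ) (hg.bound ξ)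
    refine (norm_add_le _ _).trans ?_
    have b1 := norm_add_le (f ξ * pd i (pd i g) ξ) (pd i f ξ * pd i g ξ)
    have b2 := norm_add_le (pd i f ξ * pd i g ξ) (pd i (pd i f) ξ * g ξ)
    linarith

lemma add {n : ℤ} {C₁ C₂ : ℝ} {f g : R3 → ℂ} (hf : IsSymbol n C₁ f)
    (hg : IsSymbol n C₂ g) : IsSymbol n (C₁ + C₂) (fun ξ => f ξ + g ξ) := by
  refine ⟨hf.smooth.add hg.smooth, fun ξ => ?_, fun i ξ => ?_, fun i ξ => ?_⟩
  · rw [add_mul]; exact norm_add_le_of_le (hf.bound ξ) (hg.bound ξ)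
  · rw [pd_add hf.smooth hg.smooth, add_mul]
    exact norm_add_le_of_le (hf.bound_pd i ξ) (hg.bound_pd i ξ)
  · rw [pd_add hf.smooth hg.smooth, pd_add (contDiff_pd hf.smooth i) (contDiff_pd hg.smooth i),
      add_mul]
    exact norm_add_le_of_le (hf.bound_pd_pd i ξ) (hg.bound_pd_pd i ξ)

lemma const_mul {n : ℤ} {C : ℝ} {f : R3 → ℂ} (hf : IsSymbol n C f) (c : ℂ) :
    IsSymbol n (‖c‖ * C) (fun ξ => c * f ξ) := by
  refine ⟨contDiff_const.mul hf.smooth, fun ξ => ?_, fun i ξ => ?_, fun i ξ => ?_⟩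
  · rw [norm_mul, mul_assoc]; gcongr; exact hf.bound ξ
  · rw [pd_const_mul hf.smooth, norm_mul, mul_assoc]; gcongr; exact hf.bound_pd i ξ
  · rw [pd_const_mul hf.smooth, pd_const_mul (contDiff_pd hf.smooth i), norm_mul, mul_assoc]
    gcongr; exact hf.bound_pd_pd i ξ

/-- The inverse of an elliptic symbol of order `n` is a symbol of order `-n`. -/
lemma inv {n : ℤ} {C c : ℝ} {f : R3 → ℂ} (hf : IsSymbol n C f) (hc : 0 < c)
    (hlow : ∀ ξ, c * jap (wave ξ) ^ n ≤ ‖f ξ‖) :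
    IsSymbol (-n) (c⁻¹ + C * c⁻¹ ^ 2 + 2 * C ^ 2 * c⁻¹ ^ 3) (fun ξ => (f ξ)⁻¹) := by
  have hC := hf.nonneg
  have hp : ∀ ξ, jap (wave ξ) ≠ 0 := fun ξ => (jap_pos _).ne'
  have hpos : ∀ ξ (n : ℤ), 0 < jap (wave ξ) ^ n := fun ξ n => zpow_pos (jap_pos _) _
  have h0 : ∀ ξ, f ξ ≠ 0 := fun ξ => norm_pos_iff.1 ((mul_pos hc (hpos ξ n)).trans_le (hlow ξ))
  have hs : ContDiff ℝ ∞ (fun ξ => (f ξ)⁻¹) := hf.smooth.inv h0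
  have hi : ∀ ξ, ‖(f ξ)⁻¹‖ ≤ c⁻¹ * jap (wave ξ) ^ (-n) := by
    intro ξ
    rw [norm_inv, zpow_neg, ← mul_inv]
    exact inv_anti₀ (mul_pos hc (hpos ξ n)) (hlow ξ)
  have hci : 0 < c⁻¹ := inv_pos.2 hc
  have key : ∀ (ξ : R3) (a b d : ℤ) (A B : ℝ) (z w : ℂ), a + b = d → 0 ≤ A →
      ‖z‖ ≤ A * jap (wave ξ) ^ a → ‖w‖ ≤ B * jap (wave ξ) ^ b →
      ‖z * w‖ ≤ A * B * jap (wave ξ) ^ d := by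
    intro ξ a b d A B z w habd hA hz hw
    rw [norm_mul, ← habd, zpow_add₀ (hp ξ)]
    calc ‖z‖ * ‖w‖ ≤ (A * jap (wave ξ) ^ a) * (B * jap (wave ξ) ^ b) := by
          gcongr; exact mul_nonneg hA (hpos _ _).le
      _ = _ := by ring
  have hi2 : ∀ ξ, ‖(f ξ)⁻¹ * (f ξ)⁻¹‖ ≤ c⁻¹ * c⁻¹ * jap (wave ξ) ^ (-n - n) := fun ξ =>
    key ξ _ _ _ _ _ _ _ (by ring) hci.le (hi ξ) (hi ξ)
  have hd : ∀ i ξ, ‖pd i f ξ * ((f ξ)⁻¹ * (f ξ)⁻¹)‖ ≤ C * (c⁻¹ * c⁻¹) * jap (wave ξ) ^ (-n - 1) :=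
    fun i ξ => key ξ _ _ _ _ _ _ _ (by ring) hC (hf.bound_pd i ξ) (hi2 ξ)
  have t1 : 0 ≤ C * c⁻¹ ^ 2 := by positivity
  have t2 : 0 ≤ 2 * C ^ 2 * c⁻¹ ^ 3 := by positivity
  have hneg : ∀ i, pd i (fun ξ => (f ξ)⁻¹) =
      fun ξ => (-1 : ℂ) * (pd i f ξ * ((f ξ)⁻¹ * (f ξ)⁻¹)) := by
    intro i; rw [pd_inv hf.smooth h0]; ext; ring
  refine ⟨hs, fun ξ => (hi ξ).trans ?_, fun i ξ => ?_, fun i ξ => ?_⟩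
  · gcongr
    · exact (hpos _ _).le
    · linarith
  · rw [pd_inv hf.smooth h0, norm_neg]
    refine (hd i ξ).trans ?_
    gcongr
    · exact (hpos _ _).le
    · nlinarith
  · rw [hneg, pd_const_mul ((contDiff_pd hf.smooth i).mul (hs.mul hs)),
      pd_mul (contDiff_pd hf.smooth i) (hs.mul hs), pd_mul hs hs, hneg]
    have a1 := key ξ (n - 2) (-n - n) (-n - 2) _ _ _ _ (by ring) hC (hf.bound_pd_pd i ξ) (hi2 ξ)
    have a2 := key ξ (-n - 1) (-n) (-n - n - 1) _ _ _ _ (by ring) (by positivity) (hd i ξ) (hi ξ)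
    have a3 := key ξ (n - 1) (-n - n - 1) (-n - 2) _ _ _ _ (by ring) hC (hf.bound_pd i ξ) a2
    have e : (-1 : ℂ) * (pd i f ξ * ((f ξ)⁻¹ * ((-1 : ℂ) * (pd i f ξ * ((f ξ)⁻¹ * (f ξ)⁻¹)))
        + ((-1 : ℂ) * (pd i f ξ * ((f ξ)⁻¹ * (f ξ)⁻¹))) * (f ξ)⁻¹)
        + pd i (pd i f) ξ * ((f ξ)⁻¹ * (f ξ)⁻¹)) =
        (pd i f ξ * (pd i f ξ * ((f ξ)⁻¹ * (f ξ)⁻¹) * (f ξ)⁻¹)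
          + pd i f ξ * (pd i f ξ * ((f ξ)⁻¹ * (f ξ)⁻¹) * (f ξ)⁻¹))
        + -(pd i (pd i f) ξ * ((f ξ)⁻¹ * (f ξ)⁻¹)) := by ring
    beta_reduce
    rw [e]
    refine (norm_add_le _ _).trans ?_
    rw [norm_neg]
    have b := norm_add_le (pd i f ξ * (pd i f ξ * ((f ξ)⁻¹ * (f ξ)⁻¹) * (f ξ)⁻¹))
      (pd i f ξ * (pd i f ξ * ((f ξ)⁻¹ * (f ξ)⁻¹) * (f ξ)⁻¹))
    have hj := (hpos ξ (-n - 2)).le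
    have : (c⁻¹ + C * c⁻¹ ^ 2 + 2 * C ^ 2 * c⁻¹ ^ 3) * jap (wave ξ) ^ (-n - 2) =
      c⁻¹ * jap (wave ξ) ^ (-n - 2) + C * (c⁻¹ * c⁻¹) * jap (wave ξ) ^ (-n - 2)
      + 2 * (C * (C * (c⁻¹ * c⁻¹) * c⁻¹) * jap (wave ξ) ^ (-n - 2)) := by ring
    rw [this]
    nlinarith [mul_nonneg hci.le hj]

end IsSymbol

/-! ### The symbols of the Klein-Gordon waves -/

lemma jap_wave_sq (ξ : R3) : jap (wave ξ) ^ 2 = 1 + (2 * Real.pi) ^ 2 * ∑ i, ξ i ^ 2 := by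
  rw [jap_sq, wave, norm_smul, mul_pow, EuclideanSpace.norm_sq_eq]
  simp [abs_of_pos Real.pi_pos]

lemma contDiff_wave : ContDiff ℝ ∞ wave := contDiff_const_smul _

lemma contDiff_jap_wave : ContDiff ℝ ∞ (fun ξ => ((jap (wave ξ) : ℝ) : ℂ)) :=
  Complex.ofRealCLM.contDiff.comp (contDiff_jap.comp contDiff_wave)

lemma contDiff_coord (i : Fin 3) : ContDiff ℝ ∞ (fun ξ : R3 => ((ξ i : ℝ) : ℂ)) :=
  Complex.ofRealCLM.contDiff.comp (EuclideanSpace.proj (𝕜 := ℝ) i).contDiff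

lemma pd_coord (i j : Fin 3) :
    pd i (fun ξ : R3 => ((ξ j : ℝ) : ℂ)) = fun _ => if j = i then 1 else 0 := by
  ext ξ
  have h : HasFDerivAt (fun ξ : R3 => ((ξ j : ℝ) : ℂ))
      (Complex.ofRealCLM ∘L (EuclideanSpace.proj (𝕜 := ℝ) j)) ξ :=
    (Complex.ofRealCLM ∘L (EuclideanSpace.proj (𝕜 := ℝ) j : R3 →L[ℝ] ℝ)).hasFDerivAt
  rw [pd, h.fderiv]
  by_cases hij : j = i <;> simp [hij]

lemma pd_jap_wave (i : Fin 3) : pd i (fun ξ => ((jap (wave ξ) : ℝ) : ℂ)) =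
    fun ξ => ((2 * Real.pi) ^ 2 : ℂ) * (((ξ i : ℝ) : ℂ) * ((jap (wave ξ) : ℝ) : ℂ)⁻¹) := by
  -- differentiate the identity `⟨k⟩ * ⟨k⟩ = 1 + |k|²`
  have h1 := pd_mul contDiff_jap_wave contDiff_jap_wave i
  have h2 : (fun ξ => ((jap (wave ξ) : ℝ) : ℂ) * ((jap (wave ξ) : ℝ) : ℂ)) =
      fun ξ : R3 => (1 : ℂ) + ((2 * Real.pi) ^ 2 : ℂ) *
        (((ξ 0 : ℝ) : ℂ) * ((ξ 0 : ℝ) : ℂ) + (((ξ 1 : ℝ) : ℂ) * ((ξ 1 : ℝ) : ℂ)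
          + ((ξ 2 : ℝ) : ℂ) * ((ξ 2 : ℝ) : ℂ))) := by
    ext ξ
    have := jap_wave_sq ξ
    rw [Fin.sum_univ_three] at this
    rw [← Complex.ofReal_mul, ← sq, this]
    push_cast; ring
  have c := contDiff_coord
  rw [h2, pd_add contDiff_const (contDiff_const.mul (((c 0).mul (c 0)).add (((c 1).mul (c 1)).add
    ((c 2).mul (c 2))))), pd_const_mul (((c 0).mul (c 0)).add (((c 1).mul (c 1)).add
    ((c 2).mul (c 2)))), pd_add ((c 0).mul (c 0)) (((c 1).mul (c 1)).add ((c 2).mul (c 2))),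
    pd_add ((c 1).mul (c 1)) ((c 2).mul (c 2)), pd_mul (c 0) (c 0), pd_mul (c 1) (c 1),
    pd_mul (c 2) (c 2), pd_const, pd_coord, pd_coord, pd_coord] at h1
  ext ξ
  have h3 := congrFun h1 ξ
  have hj : ((jap (wave ξ) : ℝ) : ℂ) ≠ 0 := by exact_mod_cast (jap_pos _).ne'
  rw [← mul_assoc, eq_mul_inv_iff_mul_eq₀ hj]
  fin_cases i <;> simp at h3 ⊢ <;> linear_combination (-1/2 : ℂ) * h3

lemma abs_coord_le (ξ : R3) (i : Fin 3) : 2 * Real.pi * |ξ i| ≤ jap (wave ξ) := by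
  have h := PiLp.norm_apply_le ξ i
  have h2 := norm_le_jap (wave ξ)
  rw [wave, norm_smul, Real.norm_of_nonneg (by positivity)] at h2
  rw [Real.norm_eq_abs] at h
  refine le_trans ?_ h2
  gcongr

lemma isSymbol_jap : IsSymbol 1 (3 * (2 * Real.pi) ^ 2) (fun ξ => ((jap (wave ξ) : ℝ) : ℂ)) := by
  have hpi : (1 : ℝ) ≤ 2 * Real.pi := by linarith [Real.pi_gt_three]
  have hpi2 : (1 : ℝ) ≤ (2 * Real.pi) ^ 2 := one_le_pow₀ hpi
  have hj0 : ∀ ξ, ((jap (wave ξ) : ℝ) : ℂ) ≠ 0 := fun ξ => by exact_mod_cast (jap_pos _).ne'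
  have hinv : ContDiff ℝ ∞ fun ξ => ((jap (wave ξ) : ℝ) : ℂ)⁻¹ := contDiff_jap_wave.inv hj0
  have hn : ∀ ξ, ‖((jap (wave ξ) : ℝ) : ℂ)‖ = jap (wave ξ) := fun ξ => by
    rw [Complex.norm_real, Real.norm_of_nonneg (jap_pos _).le]
  have hpn : ‖((2 * Real.pi) ^ 2 : ℂ)‖ = (2 * Real.pi) ^ 2 := by
    rw [norm_pow, norm_mul, Complex.norm_real]; simp [abs_of_pos Real.pi_pos]
  have hr : ∀ (ξ : R3) i, |ξ i| * (jap (wave ξ))⁻¹ ≤ 1 := by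
    intro ξ i
    rw [← div_eq_mul_inv, div_le_one (jap_pos _)]
    have := abs_coord_le ξ i
    nlinarith [abs_nonneg (ξ i)]
  have hr2 : ∀ (ξ : R3) i, (2 * Real.pi) * (|ξ i| * (jap (wave ξ))⁻¹) ≤ 1 := by
    intro ξ i
    rw [← mul_assoc, ← div_eq_mul_inv, div_le_one (jap_pos _)]
    exact abs_coord_le ξ i
  refine ⟨contDiff_jap_wave, fun ξ => ?_, fun i ξ => ?_, fun i ξ => ?_⟩
  · rw [hn, zpow_one]; nlinarith [jap_pos (wave ξ)]
  · rw [pd_jap_wave, norm_mul, hpn, norm_mul, norm_inv, hn, Complex.norm_real, Real.norm_eq_abs]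
    simp only [sub_self, zpow_zero]
    nlinarith [hr ξ i]
  · rw [pd_jap_wave, pd_const_mul ((contDiff_coord i).mul hinv), pd_mul (contDiff_coord i) hinv,
      pd_coord, pd_inv contDiff_jap_wave hj0, pd_jap_wave]
    simp only [if_true]
    rw [norm_mul, hpn]
    have hz : jap (wave ξ) ^ (1 - 2 : ℤ) = (jap (wave ξ))⁻¹ := by norm_num
    rw [hz]
    have h1 : ‖((ξ i : ℝ) : ℂ) * -(((2 * Real.pi) ^ 2 : ℂ) * (((ξ i : ℝ) : ℂ) *
        ((jap (wave ξ) : ℝ) : ℂ)⁻¹) * (((jap (wave ξ) : ℝ) : ℂ)⁻¹ * ((jap (wave ξ) : ℝ) : ℂ)⁻¹))‖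
        ≤ (jap (wave ξ))⁻¹ := by
      simp only [norm_mul, norm_neg, hpn, norm_inv, hn, Complex.norm_real, Real.norm_eq_abs]
      have : |ξ i| * ((2 * Real.pi) ^ 2 * (|ξ i| * (jap (wave ξ))⁻¹) *
          ((jap (wave ξ))⁻¹ * (jap (wave ξ))⁻¹)) =
        ((2 * Real.pi) * (|ξ i| * (jap (wave ξ))⁻¹)) ^ 2 * (jap (wave ξ))⁻¹ := by ring
      rw [this]
      have h0 : 0 ≤ (2 * Real.pi) * (|ξ i| * (jap (wave ξ))⁻¹) := by
        have := jap_pos (wave ξ); positivity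
      have := pow_le_one₀ (n := 2) h0 (hr2 ξ i)
      have h3 : 0 < (jap (wave ξ))⁻¹ := inv_pos.2 (jap_pos _)
      nlinarith
    have h2 : ‖(1 : ℂ) * ((jap (wave ξ) : ℝ) : ℂ)⁻¹‖ = (jap (wave ξ))⁻¹ := by
      rw [one_mul, norm_inv, hn]
    have h3 := norm_add_le_of_le h1 h2.le
    have h4 : 0 < (jap (wave ξ))⁻¹ := inv_pos.2 (jap_pos _)
    calc (2 * Real.pi) ^ 2 * _ ≤ (2 * Real.pi) ^ 2 * ((jap (wave ξ))⁻¹ + (jap (wave ξ))⁻¹) := by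
          gcongr
      _ ≤ _ := by nlinarith

lemma isSymbol_coord (i : Fin 3) : IsSymbol 1 1 (fun ξ => ((ξ i : ℝ) : ℂ)) := by
  refine ⟨contDiff_coord i, fun ξ => ?_, fun j ξ => ?_, fun j ξ => ?_⟩
  · rw [Complex.norm_real, Real.norm_eq_abs, zpow_one, one_mul]
    have := abs_coord_le ξ i
    nlinarith [abs_nonneg (ξ i), Real.pi_gt_three]
  · rw [pd_coord]; split_ifs <;> simp
  · rw [pd_coord, pd_const]; simp; exact (jap_pos _).le

lemma inner_wave_eq (u ξ : R3) : ((⟪wave ξ, u⟫ : ℝ) : ℂ) =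
    (2 * Real.pi * u 0 : ℂ) * ((ξ 0 : ℝ) : ℂ) + ((2 * Real.pi * u 1 : ℂ) * ((ξ 1 : ℝ) : ℂ)
      + (2 * Real.pi * u 2 : ℂ) * ((ξ 2 : ℝ) : ℂ)) := by
  rw [wave, inner_smul_left]
  simp [PiLp.inner_apply, Fin.sum_univ_three]
  ring

lemma isSymbol_inner (u : R3) : IsSymbol 1 (6 * Real.pi * ‖u‖)
    (fun ξ => ((⟪wave ξ, u⟫ : ℝ) : ℂ)) := by
  have h : ∀ i, ‖(2 * Real.pi * u i : ℂ)‖ * 1 ≤ 2 * Real.pi * ‖u‖ := by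
    intro i
    have := PiLp.norm_apply_le u i
    rw [mul_one, norm_mul, norm_mul, Complex.norm_real, Complex.norm_real]
    rw [Complex.norm_ofNat, Real.norm_of_nonneg Real.pi_pos.le]
    gcongr
  have e : (fun ξ => ((⟪wave ξ, u⟫ : ℝ) : ℂ)) = _ := funext (inner_wave_eq u)
  rw [e]
  refine (((isSymbol_coord 0).const_mul _).mono (h 0)).add
    ((((isSymbol_coord 1).const_mul _).mono (h 1)).add
    (((isSymbol_coord 2).const_mul _).mono (h 2))) |>.mono ?_
  linarith

lemma isSymbol_omegaSym (σ : ℤˣ) (v : R3) :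
    IsSymbol 1 (3 * (2 * Real.pi) ^ 2 + 6 * Real.pi) (fun ξ => omegaSym σ v (wave ξ)) := by
  have h1 : ‖((σ : ℤ) : ℂ) * Complex.I‖ * (3 * (2 * Real.pi) ^ 2) ≤ 3 * (2 * Real.pi) ^ 2 := by
    rcases Int.units_eq_one_or σ with rfl | rfl <;> simp
  have h2 : ‖Complex.I‖ * (6 * Real.pi * ‖hat v‖) ≤ 6 * Real.pi := by
    have := (norm_hat_lt_one v).le
    rw [Complex.norm_I, one_mul]
    nlinarith [Real.pi_pos]
  exact ((isSymbol_jap.const_mul _).mono h1).add (((isSymbol_inner (hat v)).const_mul _).mono h2)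

lemma omegaSym_eq (σ : ℤˣ) (v k : R3) :
    omegaSym σ v k = Complex.I * (((σ : ℤ) * jap k + ⟪k, hat v⟫ : ℝ) : ℂ) := by
  rw [omegaSym, lam]; push_cast; ring

/-- The phase `λ_± + i k · v̂` does not vanish: massive particles are slower than the waves. -/
lemma norm_omegaSym_ge (σ : ℤˣ) (v k : R3) :
    (2 * jap v ^ 2)⁻¹ * jap k ≤ ‖omegaSym σ v k‖ := by
  have h1 : |⟪k, hat v⟫| ≤ jap k * ‖hat v‖ :=
    (abs_real_inner_le_norm k (hat v)).trans (by gcongr; exact norm_le_jap k)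
  have h2 : jap k - jap k * ‖hat v‖ ≤ ‖omegaSym σ v k‖ := by
    rw [omegaSym_eq, norm_mul, Complex.norm_I, one_mul, Complex.norm_real, Real.norm_eq_abs]
    have h3 := abs_le.1 h1
    rcases Int.units_eq_one_or σ with rfl | rfl
    · refine le_trans ?_ (le_abs_self _); push_cast; linarith
    · refine le_trans ?_ (neg_le_abs _); push_cast; linarith
  refine le_trans ?_ h2
  have hj := jap_pos v
  have h4 : ‖hat v‖ ≤ 1 - (2 * jap v ^ 2)⁻¹ := by
    rw [norm_hat_eq, div_le_iff₀ hj, sub_mul, one_mul]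
    have : (2 * jap v ^ 2)⁻¹ * jap v = (2 * jap v)⁻¹ := by field_simp
    rw [this, le_sub_iff_add_le, ← le_sub_iff_add_le', inv_le_iff_one_le_mul₀ (by positivity)]
    nlinarith [jap_sq v, sq_nonneg (jap v - ‖v‖)]
  nlinarith [jap_pos k]

lemma omegaSym_ne_zero (σ : ℤˣ) (v k : R3) : omegaSym σ v k ≠ 0 := by
  have := norm_omegaSym_ge σ v k
  have hk := jap_pos k
  have hj := jap_pos v
  exact norm_pos_iff.1 (lt_of_lt_of_le (by positivity) this)

/-- The inverse phase is a symbol of order `-1`, uniformly for bounded velocities. -/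
lemma exists_isSymbol_inv_omegaSym (R : ℝ) : ∃ C, ∀ (σ : ℤˣ) (v : R3), ‖v‖ ≤ R →
    IsSymbol (-1) C (fun ξ => (omegaSym σ v (wave ξ))⁻¹) := by
  have hc : 0 < (2 * (1 + R ^ 2))⁻¹ := by positivity
  refine ⟨_, fun σ v hv => (isSymbol_omegaSym σ v).inv hc fun ξ => ?_⟩
  rw [zpow_one]
  refine le_trans ?_ (norm_omegaSym_ge σ v (wave ξ))
  have := jap_pos (wave ξ)
  have hj := jap_pos v
  gcongr
  rw [jap_sq]; gcongr

/-- `(k · u) (λ_± + i k · v̂)^{-2}` is a symbol of order `-1`, uniformly for bounded velocities. -/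
lemma exists_isSymbol_inner_mul_inv_omegaSym (R : ℝ) : ∃ C, ∀ (σ : ℤˣ) (v u : R3), ‖v‖ ≤ R →
    ‖u‖ ≤ R → IsSymbol (-1) C
      (fun ξ => ((⟪wave ξ, u⟫ : ℝ) : ℂ) *
        ((omegaSym σ v (wave ξ))⁻¹ * (omegaSym σ v (wave ξ))⁻¹)) := by
  obtain ⟨C, hC⟩ := exists_isSymbol_inv_omegaSym R
  refine ⟨4 * (6 * Real.pi * R) * (4 * C * C), fun σ v u hv hu => ?_⟩
  have hR : 6 * Real.pi * ‖u‖ ≤ 6 * Real.pi * R := by gcongr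
  exact ((isSymbol_inner u).mono hR).mul ((hC σ v hv).mul (hC σ v hv))

/-! ### Symbols of order `-1` act boundedly on `L^∞` -/

lemma integrable_inv_weight :
    Integrable (fun x : R3 => (‖x‖ ^ 2 + ‖x‖ ^ 4)⁻¹) := by
  rw [integrable_fun_norm_addHaar volume (f := fun r : ℝ => (r ^ 2 + r ^ 4)⁻¹)]
  refine (integrable_inv_one_add_sq.integrableOn (s := Ioi 0)).congr_fun (fun y hy => ?_)
    measurableSet_Ioi
  have hy' : y ≠ 0 := (ne_of_gt hy)
  simp only [finrank_euclideanSpace, Fintype.card_fin, smul_eq_mul]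
  field_simp

lemma integrable_jap_wave_zpow : Integrable (fun ξ : R3 => jap (wave ξ) ^ (-4 : ℤ)) := by
  have h := integrable_rpow_neg_one_add_norm_sq (E := R3) (μ := volume) (r := 4)
    (by simp; norm_num)
  refine h.mono' ?_ (Filter.Eventually.of_forall fun ξ => ?_)
  · have : Continuous fun ξ : R3 => jap (wave ξ) :=
      continuous_jap.comp contDiff_wave.continuous
    exact (this.zpow₀ _ fun ξ => Or.inl (jap_pos _).ne').aestronglyMeasurable
  · rw [Real.norm_of_nonneg (zpow_pos (jap_pos _) _).le]
    have h1 : (1 + ‖ξ‖ ^ 2) ^ (-4 / 2 : ℝ) = ((1 + ‖ξ‖ ^ 2) ^ 2)⁻¹ := by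
      rw [show (-4 / 2 : ℝ) = -((2 : ℕ) : ℝ) by norm_num, Real.rpow_neg (by positivity),
        Real.rpow_natCast]
    have h2 : jap (wave ξ) ^ (-4 : ℤ) = ((jap (wave ξ) ^ 2) ^ 2)⁻¹ := by
      rw [← pow_mul, zpow_neg]; norm_cast
    rw [h1, h2]
    have h3 : 1 + ‖ξ‖ ^ 2 ≤ jap (wave ξ) ^ 2 := by
      rw [jap_sq, wave, norm_smul, Real.norm_of_nonneg (by positivity)]
      have : ‖ξ‖ ≤ 2 * Real.pi * ‖ξ‖ := by
        nlinarith [norm_nonneg ξ, Real.pi_gt_three]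
      gcongr
    gcongr

open LineDeriv SchwartzMap in
/-- Multiplication of the kernel by `x_i` corresponds to differentiation of the symbol. -/
lemma norm_fourierInv_lineDeriv (f : 𝓢(R3, ℂ)) (i : Fin 3) (x : R3) :
    ‖(𝓕⁻ (∂_{(EuclideanSpace.single i (1 : ℝ) : R3)} f) : 𝓢(R3, ℂ)) x‖ =
      2 * Real.pi * |x i| * ‖(𝓕⁻ f : 𝓢(R3, ℂ)) x‖ := by
  have ht : (fun y : R3 => ⟪y, (EuclideanSpace.single i (1 : ℝ) : R3)⟫).HasTemperateGrowth := by
    fun_prop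
  rw [fourierInv_lineDerivOp_eq, smul_apply, smulLeftCLM_apply_apply ht, norm_smul, norm_smul]
  rw [norm_neg, norm_mul, norm_mul, Complex.norm_I, Complex.norm_real]
  rw [Real.norm_of_nonneg Real.pi_pos.le]
  simp [EuclideanSpace.inner_single_right, mul_assoc]

open SchwartzMap in
lemma integral_norm_sq_fourierInv (f : 𝓢(R3, ℂ)) :
    ∫ x, ‖(𝓕⁻ f : 𝓢(R3, ℂ)) x‖ ^ 2 = ∫ ξ, ‖f ξ‖ ^ 2 := by
  have := integral_norm_sq_fourier (𝓕⁻ f : 𝓢(R3, ℂ))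
  rw [FourierTransform.fourier_fourierInv_eq] at this
  exact this.symm

open SchwartzMap in
lemma integrable_norm_sq (f : 𝓢(R3, ℂ)) : Integrable (fun x => ‖f x‖ ^ 2) := by
  have := (f.memLp 2 volume).integrable_norm_pow (by norm_num)
  simpa using this

open SchwartzMap LineDeriv in
/-- The `L^1` norm of the kernel of a symbol of order `-1` is bounded in terms of the symbol
constant: by Plancherel `∫ (|x|² + |x|⁴) |K|²` is bounded, and `(|x|² + |x|⁴)⁻¹` is integrable
on `ℝ³`. -/
lemma exists_integral_norm_fourierInv_le (C : ℝ) : ∃ M, 0 ≤ M ∧ ∀ f : 𝓢(R3, ℂ),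
    IsSymbol (-1) C f → ∫ x, ‖(𝓕⁻ f : 𝓢(R3, ℂ)) x‖ ≤ M := by
  set W := ∫ x : R3, (‖x‖ ^ 2 + ‖x‖ ^ 4)⁻¹
  set J := ∫ ξ : R3, jap (wave ξ) ^ (-4 : ℤ)
  have hW : 0 ≤ W := integral_nonneg fun x => by positivity
  have hJ : 0 ≤ J := integral_nonneg fun x => (zpow_pos (jap_pos _) _).le
  refine ⟨2⁻¹ * (W + ∑ i : Fin 3, (C ^ 2 * J + 3 * (C ^ 2 * J))), by positivity,
    fun f hf => ?_⟩
  set K : 𝓢(R3, ℂ) := 𝓕⁻ f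
  have hC := hf.nonneg
  let e : Fin 3 → R3 := fun i => EuclideanSpace.single i (1 : ℝ)
  have hpd : ∀ i, ((∂_{e i} f : 𝓢(R3, ℂ)) : R3 → ℂ) = pd i f := by
    intro i; ext ξ; rw [lineDerivOp_apply_eq_fderiv]; rfl
  have hpd2 : ∀ i, ((∂_{e i} (∂_{e i} f) : 𝓢(R3, ℂ)) : R3 → ℂ) = pd i (pd i f) := by
    intro i; ext ξ; rw [lineDerivOp_apply_eq_fderiv, hpd]; rfl
  have hi1 : ∀ i, Integrable fun x => ‖(𝓕⁻ (∂_{e i} f) : 𝓢(R3, ℂ)) x‖ ^ 2 :=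
    fun i => integrable_norm_sq _
  have hi2 : ∀ i, Integrable fun x => ‖(𝓕⁻ (∂_{e i} (∂_{e i} f)) : 𝓢(R3, ℂ)) x‖ ^ 2 :=
    fun i => integrable_norm_sq _
  have hz : ∀ ξ : R3, jap (wave ξ) ^ (-4 : ℤ) = (jap (wave ξ) ^ (-2 : ℤ)) ^ 2 := by
    intro ξ; rw [← zpow_natCast, ← zpow_mul]; norm_num
  have hb1 : ∀ i, ∫ x, ‖(𝓕⁻ (∂_{e i} f) : 𝓢(R3, ℂ)) x‖ ^ 2 ≤ C ^ 2 * J := by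
    intro i
    rw [integral_norm_sq_fourierInv, ← integral_const_mul]
    refine integral_mono (integrable_norm_sq _) (integrable_jap_wave_zpow.const_mul _)
      fun ξ => ?_
    have := hf.bound_pd i ξ
    simp only [hpd, hz, ← mul_pow]
    gcongr
    simpa using this
  have hb2 : ∀ i, ∫ x, ‖(𝓕⁻ (∂_{e i} (∂_{e i} f)) : 𝓢(R3, ℂ)) x‖ ^ 2 ≤ C ^ 2 * J := by
    intro i
    rw [integral_norm_sq_fourierInv, ← integral_const_mul]
    refine integral_mono (integrable_norm_sq _) (integrable_jap_wave_zpow.const_mul _)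
      fun ξ => ?_
    have := hf.bound_pd_pd i ξ
    simp only [hpd2, hz, ← mul_pow]
    gcongr
    refine this.trans ?_
    gcongr
    · exact one_le_jap _
    · norm_num
  have hint : Integrable (fun x : R3 => 2⁻¹ * ((‖x‖ ^ 2 + ‖x‖ ^ 4)⁻¹ + ∑ i : Fin 3,
      (‖(𝓕⁻ (∂_{e i} f) : 𝓢(R3, ℂ)) x‖ ^ 2 +
        3 * ‖(𝓕⁻ (∂_{e i} (∂_{e i} f)) : 𝓢(R3, ℂ)) x‖ ^ 2))) :=
    ((integrable_inv_weight.add (integrable_finsetSum _ fun i _ =>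
      (hi1 i).add ((hi2 i).const_mul 3)))).const_mul _
  calc ∫ x, ‖K x‖ ≤ ∫ x : R3, 2⁻¹ * ((‖x‖ ^ 2 + ‖x‖ ^ 4)⁻¹ + ∑ i : Fin 3,
      (‖(𝓕⁻ (∂_{e i} f) : 𝓢(R3, ℂ)) x‖ ^ 2 +
        3 * ‖(𝓕⁻ (∂_{e i} (∂_{e i} f)) : 𝓢(R3, ℂ)) x‖ ^ 2)) := by
        refine integral_mono_ae K.integrable.norm hint ?_
        have hne : ∀ᵐ x : R3, x ≠ 0 := by
          simp [ae_iff, measure_singleton]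
        filter_upwards [hne] with x hx
        have hx2 : 0 < ‖x‖ := norm_pos_iff.2 hx
        have hw : 0 < ‖x‖ ^ 2 + ‖x‖ ^ 4 := by positivity
        -- the inequality of arithmetic and geometric means
        have h1 : ‖K x‖ ≤ 2⁻¹ * ((‖x‖ ^ 2 + ‖x‖ ^ 4)⁻¹ + (‖x‖ ^ 2 + ‖x‖ ^ 4) * ‖K x‖ ^ 2) := by
          have hsq : 0 ≤ (‖x‖ ^ 2 + ‖x‖ ^ 4)⁻¹ * (1 - (‖x‖ ^ 2 + ‖x‖ ^ 4) * ‖K x‖) ^ 2 := by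
            positivity
          have he : (‖x‖ ^ 2 + ‖x‖ ^ 4)⁻¹ * (1 - (‖x‖ ^ 2 + ‖x‖ ^ 4) * ‖K x‖) ^ 2 =
              (‖x‖ ^ 2 + ‖x‖ ^ 4)⁻¹ - 2 * ‖K x‖ + (‖x‖ ^ 2 + ‖x‖ ^ 4) * ‖K x‖ ^ 2 := by
            field_simp; ring
          linarith
        refine h1.trans ?_
        gcongr
        have h2 : ‖x‖ ^ 2 = ∑ i, |x i| ^ 2 := by
          rw [EuclideanSpace.norm_sq_eq]; simp
        have h4 : ‖x‖ ^ 4 ≤ 3 * ∑ i, (|x i| ^ 2) ^ 2 := by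
          have : ‖x‖ ^ 4 = (‖x‖ ^ 2) ^ 2 := by ring
          rw [this, h2, Fin.sum_univ_three, Fin.sum_univ_three]
          nlinarith [sq_nonneg (|x 0| ^ 2 - |x 1| ^ 2), sq_nonneg (|x 0| ^ 2 - |x 2| ^ 2),
            sq_nonneg (|x 1| ^ 2 - |x 2| ^ 2)]
        calc (‖x‖ ^ 2 + ‖x‖ ^ 4) * ‖K x‖ ^ 2
            ≤ (∑ i, |x i| ^ 2 + 3 * ∑ i, (|x i| ^ 2) ^ 2) * ‖K x‖ ^ 2 := by
              rw [← h2]; gcongr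
          _ = ∑ i, (|x i| ^ 2 + 3 * (|x i| ^ 2) ^ 2) * ‖K x‖ ^ 2 := by
              rw [Finset.mul_sum, ← Finset.sum_add_distrib, Finset.sum_mul]
          _ ≤ _ := by
              refine Finset.sum_le_sum fun i _ => ?_
              rw [norm_fourierInv_lineDeriv, norm_fourierInv_lineDeriv,
                norm_fourierInv_lineDeriv]
              have hp : 1 ≤ (2 * Real.pi) ^ 2 := one_le_pow₀ (by linarith [Real.pi_gt_three])
              have hp4 : 1 ≤ (2 * Real.pi) ^ 4 := one_le_pow₀ (by linarith [Real.pi_gt_three])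
              have a1 : 0 ≤ |x i| ^ 2 * ‖K x‖ ^ 2 := by positivity
              have a2 : 0 ≤ |x i| ^ 4 * ‖K x‖ ^ 2 := by positivity
              have e1 : (2 * Real.pi * |x i| * ‖K x‖) ^ 2 =
                (2 * Real.pi) ^ 2 * (|x i| ^ 2 * ‖K x‖ ^ 2) := by ring
              have e2 : (2 * Real.pi * |x i| * (2 * Real.pi * |x i| * ‖K x‖)) ^ 2 =
                (2 * Real.pi) ^ 4 * (|x i| ^ 4 * ‖K x‖ ^ 2) := by ring
              rw [e1, e2]
              nlinarith
    _ = 2⁻¹ * (W + ∑ i : Fin 3, ((∫ x, ‖(𝓕⁻ (∂_{e i} f) : 𝓢(R3, ℂ)) x‖ ^ 2) +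
        3 * ∫ x, ‖(𝓕⁻ (∂_{e i} (∂_{e i} f)) : 𝓢(R3, ℂ)) x‖ ^ 2)) := by
        have hs : ∀ i : Fin 3, Integrable fun x => ‖(𝓕⁻ (∂_{e i} f) : 𝓢(R3, ℂ)) x‖ ^ 2 +
            3 * ‖(𝓕⁻ (∂_{e i} (∂_{e i} f)) : 𝓢(R3, ℂ)) x‖ ^ 2 :=
          fun i => (hi1 i).add ((hi2 i).const_mul 3)
        rw [integral_const_mul, integral_add integrable_inv_weight
          (integrable_finsetSum _ fun i _ => hs i), integral_finsetSum _ fun i _ => hs i]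
        congr 3
        ext i
        rw [integral_add (hi1 i) ((hi2 i).const_mul 3), integral_const_mul]
    _ ≤ _ := by
        gcongr with i
        · exact hb1 i
        · exact hb2 i

/-- The dilated cutoffs `χ(η ξ)`, `0 < η ≤ 1`, are symbols of order `0` with a common constant. -/
lemma exists_isSymbol_cutoff (χ : ContDiffBump (0 : R3)) : ∃ C, ∀ η : ℝ, 0 < η → η ≤ 1 →
    IsSymbol 0 C (fun ξ => ((χ (η • ξ) : ℝ) : ℂ)) := by
  set g : R3 → ℂ := fun ξ => ((χ ξ : ℝ) : ℂ)
  have hg : ContDiff ℝ ∞ g := Complex.ofRealCLM.contDiff.comp χ.contDiff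
  have hgc : HasCompactSupport g := χ.hasCompactSupport.comp_left Complex.ofReal_zero
  have hpdc : ∀ (f : R3 → ℂ), HasCompactSupport f → ∀ i, HasCompactSupport (pd i f) :=
    fun f hf i => hf.fderiv_apply ℝ _
  have hbd : ∀ (f : R3 → ℂ), Continuous f → HasCompactSupport f → ∀ n : ℕ, ∃ A, 0 ≤ A ∧
      ∀ y, (1 + ‖y‖) ^ n * ‖f y‖ ≤ A := by
    intro f hf hfc n
    have h1 : Continuous fun y => (((1 + ‖y‖) ^ n : ℝ) : ℂ) * f y := by fun_prop
    obtain ⟨A, hA⟩ := h1.bounded_above_of_compact_support hfc.mul_left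
    refine ⟨A, (norm_nonneg _).trans (hA 0), fun y => ?_⟩
    have := hA y
    rwa [norm_mul, Complex.norm_real, Real.norm_of_nonneg (by positivity)] at this
  choose A1 hA1 hA1' using fun i : Fin 3 => hbd (pd i g) (contDiff_pd hg i).continuous
    (hpdc g hgc i) 1
  choose A2 hA2 hA2' using fun i : Fin 3 => hbd (pd i (pd i g))
    (contDiff_pd (contDiff_pd hg i) i).continuous (hpdc _ (hpdc g hgc i) i) 2
  have hpi : 1 ≤ 2 * Real.pi := by linarith [Real.pi_gt_three]
  have hscale : ∀ η : ℝ, 0 < η → η ≤ 1 → ∀ ξ : R3,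
      η * jap (wave ξ) ≤ 2 * Real.pi * (1 + ‖η • ξ‖) := by
    intro η h0 h1 ξ
    have := jap_le_one_add (wave ξ)
    rw [wave, norm_smul, Real.norm_of_nonneg (by positivity)] at this
    rw [norm_smul, Real.norm_of_nonneg h0.le]
    have h2 : η * jap (wave ξ) ≤ η * (1 + 2 * Real.pi * ‖ξ‖) := by
      unfold wave; gcongr
    nlinarith [norm_nonneg ξ]
  have hcomp : ∀ (f : R3 → ℂ) (η : ℝ) (i : Fin 3),
      pd i (fun ξ => f (η • ξ)) = fun ξ => (η : ℂ) * pd i f (η • ξ) := by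
    intro f η i
    ext ξ
    rw [pd, fderiv_comp_smul]
    simp [pd]
  refine ⟨1 + ∑ i, 2 * Real.pi * A1 i + ∑ i, (2 * Real.pi) ^ 2 * A2 i, fun η h0 h1 => ?_⟩
  have s1 : ∀ i, 2 * Real.pi * A1 i ≤ ∑ i, 2 * Real.pi * A1 i := fun i =>
    Finset.single_le_sum (f := fun i => 2 * Real.pi * A1 i)
      (fun j _ => mul_nonneg (by positivity) (hA1 j)) (Finset.mem_univ i)
  have s2 : ∀ i, (2 * Real.pi) ^ 2 * A2 i ≤ ∑ i, (2 * Real.pi) ^ 2 * A2 i := fun i =>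
    Finset.single_le_sum (f := fun i => (2 * Real.pi) ^ 2 * A2 i)
      (fun j _ => mul_nonneg (by positivity) (hA2 j)) (Finset.mem_univ i)
  have p1 : 0 ≤ ∑ i, 2 * Real.pi * A1 i :=
    Finset.sum_nonneg fun j _ => mul_nonneg (by positivity) (hA1 j)
  have p2 : 0 ≤ ∑ i, (2 * Real.pi) ^ 2 * A2 i :=
    Finset.sum_nonneg fun j _ => mul_nonneg (by positivity) (hA2 j)
  have hgη : ContDiff ℝ ∞ (fun ξ : R3 => g (η • ξ)) := hg.comp (contDiff_const_smul η)
  refine ⟨hgη, fun ξ => ?_, fun i ξ => ?_, fun i ξ => ?_⟩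
  · rw [zpow_zero, mul_one, Complex.norm_real, Real.norm_of_nonneg χ.nonneg]
    linarith [χ.le_one (x := η • ξ)]
  · rw [show (fun ξ => ((χ (η • ξ) : ℝ) : ℂ)) = fun ξ => g (η • ξ) from rfl, hcomp, norm_mul,
      Complex.norm_real, Real.norm_of_nonneg h0.le]
    rw [show (0 - 1 : ℤ) = -1 by norm_num, zpow_neg_one, ← div_eq_mul_inv, le_div_iff₀ (jap_pos _)]
    calc η * ‖pd i g (η • ξ)‖ * jap (wave ξ) = η * jap (wave ξ) * ‖pd i g (η • ξ)‖ := by ring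
      _ ≤ 2 * Real.pi * (1 + ‖η • ξ‖) * ‖pd i g (η • ξ)‖ := by
          exact mul_le_mul_of_nonneg_right (hscale η h0 h1 ξ) (norm_nonneg _)
      _ = 2 * Real.pi * ((1 + ‖η • ξ‖) ^ 1 * ‖pd i g (η • ξ)‖) := by ring
      _ ≤ 2 * Real.pi * A1 i := by gcongr; exact hA1' i _
      _ ≤ _ := by linarith [s1 i]
  · rw [show (fun ξ => ((χ (η • ξ) : ℝ) : ℂ)) = fun ξ => g (η • ξ) from rfl, hcomp, pd_const_mul
      (f := fun ξ => pd i g (η • ξ)) ((contDiff_pd hg i).comp (contDiff_const_smul η)), hcomp,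
      norm_mul, norm_mul, Complex.norm_real, Real.norm_of_nonneg h0.le]
    rw [show (0 - 2 : ℤ) = -(2 : ℕ) by norm_num, zpow_neg, zpow_natCast, ← div_eq_mul_inv,
      le_div_iff₀ (pow_pos (jap_pos _) 2)]
    have hj := jap_pos (wave ξ)
    calc η * (η * ‖pd i (pd i g) (η • ξ)‖) * jap (wave ξ) ^ 2
        = (η * jap (wave ξ)) ^ 2 * ‖pd i (pd i g) (η • ξ)‖ := by ring
      _ ≤ (2 * Real.pi * (1 + ‖η • ξ‖)) ^ 2 * ‖pd i (pd i g) (η • ξ)‖ := by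
          exact mul_le_mul_of_nonneg_right (pow_le_pow_left₀ (by positivity) (hscale η h0 h1 ξ) 2)
            (norm_nonneg _)
      _ = (2 * Real.pi) ^ 2 * ((1 + ‖η • ξ‖) ^ 2 * ‖pd i (pd i g) (η • ξ)‖) := by ring
      _ ≤ (2 * Real.pi) ^ 2 * A2 i := by gcongr; exact hA2' i _
      _ ≤ _ := by linarith [s2 i]

open SchwartzMap in
/-- A Fourier multiplier with Schwartz symbol is a convolution with its kernel. -/
lemma norm_fourierInv_schwartz_smul_le (f : 𝓢(R3, ℂ)) {g : R3 → C3} (hg : Integrable g) {b : ℝ}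
    (hb : ∀ x, ‖𝓕⁻ g x‖ ≤ b) (x : R3) :
    ‖𝓕⁻ (fun ξ => f ξ • g ξ) x‖ ≤ (∫ y, ‖(𝓕⁻ f : 𝓢(R3, ℂ)) y‖) * b := by
  set K : 𝓢(R3, ℂ) := 𝓕⁻ f
  have hf : ∀ ξ, f ξ = 𝓕 (K : R3 → ℂ) ξ := by
    intro ξ
    rw [← fourier_coe, FourierTransform.fourier_fourierInv_eq]
  set g2 : R3 → C3 := fun ξ => Real.fourierChar ⟪ξ, x⟫ • g ξ
  have hg2 : Integrable g2 := by
    have := (Real.fourierIntegral_convergent_iff (-x)).2 hg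
    simpa [g2, inner_neg_right] using this
  have h1 : 𝓕⁻ (fun ξ => f ξ • g ξ) x = ∫ ξ, 𝓕 (K : R3 → ℂ) ξ • g2 ξ := by
    rw [Real.fourierInv_eq]
    congr 1
    ext1 ξ
    rw [← hf, smul_comm]
  have h2 : ∫ ξ, 𝓕 (K : R3 → ℂ) ξ • g2 ξ = ∫ y, K y • 𝓕 g2 y :=
    VectorFourier.integral_fourierIntegral_smul_eq_flip (L := innerₗ R3)
      Real.continuous_fourierChar continuous_inner K.integrable hg2 |>.trans (by
        simp only [flip_innerₗ]; rfl)
  have h3 : ∀ y, 𝓕 g2 y = 𝓕⁻ g (x - y) := by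
    intro y
    rw [Real.fourier_eq, Real.fourierInv_eq]
    congr 1
    ext1 ξ
    rw [smul_smul, ← AddChar.map_add_eq_mul, inner_sub_right]
    congr 2; ring
  rw [h1, h2, ← integral_mul_const]
  refine norm_integral_le_of_norm_le (K.integrable.norm.mul_const b)
    (Filter.Eventually.of_forall fun y => ?_)
  rw [norm_smul, h3]
  gcongr
  exact hb _

lemma IsSymbol.norm_le {C : ℝ} {m : R3 → ℂ} (hm : IsSymbol (-1) C m) (ξ : R3) : ‖m ξ‖ ≤ C := by
  refine (hm.bound ξ).trans ?_
  have : jap (wave ξ) ^ (-1 : ℤ) ≤ 1 := by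
    rw [zpow_neg_one]; exact inv_le_one_of_one_le₀ (one_le_jap _)
  nlinarith [hm.nonneg]

lemma integrable_smul_of_bound {m : R3 → ℂ} (hm : Continuous m) {C : ℝ} (hC : ∀ ξ, ‖m ξ‖ ≤ C)
    {g : R3 → C3} (hg : Integrable g) : Integrable (fun ξ => m ξ • g ξ) :=
  hg.bdd_smul C hm.aestronglyMeasurable (Filter.Eventually.of_forall hC)

open SchwartzMap in
/-- A Fourier multiplier whose symbol has order `-1` is bounded on `L^∞`, with a norm that depends
only on the symbol constant. -/
theorem exists_multiplier_bound (C : ℝ) : ∃ M, 0 ≤ M ∧ ∀ m : R3 → ℂ, IsSymbol (-1) C m →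
    ∀ g : R3 → C3, Integrable g → ∀ b, (∀ x, ‖𝓕⁻ g x‖ ≤ b) →
      ∀ x, ‖𝓕⁻ (fun ξ => m ξ • g ξ) x‖ ≤ M * b := by
  let χ : ContDiffBump (0 : R3) := ⟨1, 2, by norm_num, by norm_num⟩
  obtain ⟨A, hA⟩ := exists_isSymbol_cutoff χ
  obtain ⟨M, hM0, hM⟩ := exists_integral_norm_fourierInv_le (4 * A * C)
  refine ⟨M, hM0, fun m hm g hg b hb x => ?_⟩
  have hb0 : 0 ≤ b := (norm_nonneg _).trans (hb 0)
  -- cut the symbol off at frequency `1/η`, with symbol constants independent of `η`, so that the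
  -- kernel is a Schwartz function
  let η : ℕ → ℝ := fun n => 1 / ((n : ℝ) + 1)
  have hη0 : ∀ n, 0 < η n := fun n => by positivity
  have hη1 : ∀ n, η n ≤ 1 := fun n => by
    rw [div_le_one (by positivity)]; linarith [(Nat.cast_nonneg n : (0 : ℝ) ≤ n)]
  have hηt : Filter.Tendsto η Filter.atTop (nhds 0) := tendsto_one_div_add_atTop_nhds_zero_nat
  let f : ℕ → R3 → ℂ := fun n ξ => ((χ (η n • ξ) : ℝ) : ℂ) * m ξ
  have hf : ∀ n, IsSymbol (-1) (4 * A * C) (f n) := fun n => by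
    have := (hA _ (hη0 n) (hη1 n)).mul hm
    rwa [zero_add] at this
  have hfc : ∀ n, HasCompactSupport (f n) := by
    intro n
    have h1 : HasCompactSupport fun ξ : R3 => ((χ (η n • ξ) : ℝ) : ℂ) :=
      (χ.hasCompactSupport.comp_left Complex.ofReal_zero).comp_homeomorph
        (Homeomorph.smulOfNeZero (η n) (hη0 n).ne')
    exact h1.mul_right
  have hle : ∀ n, ‖𝓕⁻ (fun ξ => f n ξ • g ξ) x‖ ≤ M * b := by
    intro n
    have := norm_fourierInv_schwartz_smul_le ((hfc n).toSchwartzMap (hf n).smooth) hg hb x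
    refine this.trans ?_
    gcongr
    exact hM _ (hf n)
  have hlim : Filter.Tendsto (fun n => 𝓕⁻ (fun ξ => f n ξ • g ξ) x) Filter.atTop
      (nhds (𝓕⁻ (fun ξ => m ξ • g ξ) x)) := by
    simp only [Real.fourierInv_eq]
    refine tendsto_integral_of_dominated_convergence (fun ξ => C * ‖g ξ‖) (fun n => ?_)
      (hg.norm.const_mul C) (fun n => Filter.Eventually.of_forall fun ξ => ?_)
      (Filter.Eventually.of_forall fun ξ => ?_)
    · have h1 := integrable_smul_of_bound (hf n).smooth.continuous (hf n).norm_le hg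
      have := (Real.fourierIntegral_convergent_iff (-x)).2 h1
      simp only [inner_neg_right, neg_neg] at this
      exact this.aestronglyMeasurable
    · rw [Circle.norm_smul, norm_smul]
      gcongr
      rw [norm_mul, Complex.norm_real, Real.norm_of_nonneg χ.nonneg]
      have := hm.norm_le ξ
      nlinarith [χ.le_one (x := η n • ξ), χ.nonneg (x := η n • ξ), norm_nonneg (m ξ)]
    · refine Filter.Tendsto.const_smul ?_ _
      refine Filter.Tendsto.smul_const ?_ _
      have h1 : Filter.Tendsto (fun n => χ (η n • ξ)) Filter.atTop (nhds (χ ((0 : ℝ) • ξ))) :=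
        (χ.continuous.tendsto _).comp (hηt.smul_const ξ)
      have h2 : χ ((0 : ℝ) • ξ) = 1 := by
        rw [zero_smul]; exact χ.one_of_mem_closedBall (by simp [χ])
      rw [h2] at h1
      have h3 := ((Complex.continuous_ofReal.tendsto _).comp h1).mul_const (m ξ)
      simpa [f] using h3
  exact le_of_tendsto hlim.norm (Filter.Eventually.of_forall hle)

/-! ### Fourier integrals -/

section Fourier

variable {F : Type*} [NormedAddCommGroup F] [NormedSpace ℂ F]

lemma continuous_fourierInv {g : R3 → F} (hg : Integrable g) : Continuous (𝓕⁻ g) := by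
  rw [Real.fourierInv_eq_fourier_comp_neg]
  exact VectorFourier.fourierIntegral_continuous Real.continuous_fourierChar continuous_inner
    hg.comp_neg

lemma integrable_fourierChar_smul {g : R3 → F} (hg : Integrable g) (x : R3) :
    Integrable fun ξ => Real.fourierChar ⟪ξ, x⟫ • g ξ := by
  have := (Real.fourierIntegral_convergent_iff (-x)).2 hg
  simpa [inner_neg_right] using this

lemma fourierInv_const_smul (g : R3 → F) (c : ℂ) (x : R3) :
    𝓕⁻ (fun ξ => c • g ξ) x = c • 𝓕⁻ g x := by
  simp only [Real.fourierInv_eq]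
  rw [← integral_smul]
  congr 1; ext ξ; rw [smul_comm]

lemma norm_wave (ξ : R3) : ‖wave ξ‖ = 2 * Real.pi * ‖ξ‖ := by
  rw [wave, norm_smul, Real.norm_of_nonneg (by positivity)]

/-- Differentiating an inverse Fourier integral multiplies the transform by `i k · w`. -/
lemma hasFDerivAt_fourierInv {g : R3 → F} (hg : Integrable g)
    (hg' : Integrable fun ξ => jap (wave ξ) • g ξ) (x : R3) :
    ∃ L : R3 →L[ℝ] F, HasFDerivAt (𝓕⁻ g) L x ∧
      ∀ w, L w = 𝓕⁻ (fun ξ => (Complex.I * ((⟪wave ξ, w⟫ : ℝ) : ℂ)) • g ξ) x := by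
  have hn : Integrable fun ξ => ‖ξ‖ * ‖g ξ‖ := by
    refine hg'.norm.mono' (by have := hg.1; fun_prop) (Filter.Eventually.of_forall fun ξ => ?_)
    rw [norm_smul, Real.norm_of_nonneg (jap_pos _).le, Real.norm_of_nonneg (by positivity)]
    gcongr
    refine le_trans ?_ (norm_le_jap _)
    rw [norm_wave]
    nlinarith [norm_nonneg ξ, Real.pi_gt_three]
  have h1 := Real.hasFDerivAt_fourier hg hn (-x)
  have h2 := h1.comp x (hasFDerivAt_id x).neg
  have e : (𝓕 g) ∘ (fun y : R3 => -y) = 𝓕⁻ g := by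
    ext y; rw [Function.comp, Real.fourierInv_eq_fourier_neg]
  rw [show 𝓕 g ∘ Neg.neg = 𝓕⁻ g from e] at h2
  refine ⟨_, h2, fun w => ?_⟩
  · have hi : Integrable (VectorFourier.fourierSMulRight (innerSL ℝ) g) := by
      refine (hn.const_mul (2 * Real.pi * ‖innerSL (E := R3) ℝ‖)).mono'
        hg.1.fourierSMulRight (Filter.Eventually.of_forall fun ξ => ?_)
      have := VectorFourier.norm_fourierSMulRight_le (innerSL (E := R3) ℝ) g ξ
      linarith
    simp only [ContinuousLinearMap.comp_apply, neg_apply, map_neg,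
      ContinuousLinearMap.id_apply]
    rw [Real.fourier_continuousLinearMap_apply hi, Real.fourierInv_eq_fourier_neg,
      Real.fourier_eq, Real.fourier_eq, ← integral_neg]
    congr 1; ext ξ
    rw [← smul_neg, VectorFourier.fourierSMulRight_apply]
    congr 1
    rw [wave, inner_smul_left, neg_smul, neg_neg, innerSL_apply_apply, ← Complex.coe_smul,
      smul_smul]
    congr 1
    simp; ring

end Fourier

/-! ### Pointwise bounds from essential and weak bounds -/

section Weak

lemma norm_le_of_ae_le {F : Type*} [NormedAddCommGroup F] {f : R3 → F} (hf : Continuous f) {b : ℝ}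
    (h : ∀ᵐ x, ‖f x‖ ≤ b) (x : R3) : ‖f x‖ ≤ b := by
  by_contra hx
  have ho : IsOpen {y | b < ‖f y‖} := isOpen_lt continuous_const hf.norm
  have hz : volume {y | b < ‖f y‖} = 0 := by
    rw [ae_iff] at h
    simpa using h
  have := ho.eq_empty_of_measure_zero hz
  exact (this ▸ (show x ∈ {y | b < ‖f y‖} from not_le.1 hx) : x ∈ (∅ : Set R3))

lemma ae_norm_le_of_eLpNorm_top_le {F : Type*} [NormedAddCommGroup F] {f : R3 → F} {b : ℝ}
    (hb : 0 ≤ b) (h : eLpNorm f ∞ volume ≤ ENNReal.ofReal b) : ∀ᵐ x, ‖f x‖ ≤ b := by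
  rw [eLpNorm_exponent_top] at h
  filter_upwards [ae_le_eLpNormEssSup (f := f)] with x hx
  have := hx.trans h
  rwa [← ofReal_norm, ENNReal.ofReal_le_ofReal_iff hb] at this

lemma norm_le_of_eLpNorm_top_le {F : Type*} [NormedAddCommGroup F] {f : R3 → F}
    (hf : Continuous f) {b : ℝ} (hb : 0 ≤ b) (h : eLpNorm f ∞ volume ≤ ENNReal.ofReal b) (x : R3) :
    ‖f x‖ ≤ b :=
  norm_le_of_ae_le hf (ae_norm_le_of_eLpNorm_top_le hb h) x

variable {F : Type*} [NormedAddCommGroup F] [NormedSpace ℝ F] [CompleteSpace F]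

lemma DerivBound.memLp_zero {p : ℝ≥0∞} {f : R3 → F} {b : ℝ} (h : DerivBound 0 p f b) :
    AEStronglyMeasurable f volume ∧ eLpNorm f p volume ≤ ENNReal.ofReal b := by
  obtain ⟨g, hg, hb⟩ := h Fin.elim0
  have he : ∀ᵐ x, f x = g x := by
    refine ae_eq_of_integral_contDiff_smul_eq hg.locallyIntegrable_left
      hg.locallyIntegrable_right fun φ h1 h2 => ?_
    simpa using hg.integral_eq φ h1 h2
  exact ⟨hg.locallyIntegrable_left.aestronglyMeasurable, (eLpNorm_congr_ae he).trans_le hb⟩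

/-- For a continuous function with integrable Fourier transform and first moment, an `L^∞` bound of
the weak derivative is a pointwise bound of the classical one. -/
lemma norm_fourierInv_deriv_le {f : R3 → ℂ} (hf : Continuous f) (hfi : Integrable f)
    (h0 : Integrable (𝓕 f)) (h1 : Integrable fun ξ => jap (wave ξ) • 𝓕 f ξ) {b : ℝ} (hb : 0 ≤ b)
    (h : DerivBound 1 ∞ f b) (i : Fin 3) (x : R3) :
    ‖𝓕⁻ (fun ξ => (Complex.I * ((⟪wave ξ, EuclideanSpace.single i (1 : ℝ)⟫ : ℝ) : ℂ)) • 𝓕 f ξ) x‖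
      ≤ b := by
  set e : R3 := EuclideanSpace.single i (1 : ℝ)
  set D : R3 → ℂ := 𝓕⁻ (fun ξ => (Complex.I * ((⟪wave ξ, e⟫ : ℝ) : ℂ)) • 𝓕 f ξ)
  have hinv : 𝓕⁻ (𝓕 f) = f := hf.fourierInv_fourier_eq hfi h0
  have hder : ∀ y, DifferentiableAt ℝ f y ∧ fderiv ℝ f y e = D y := by
    intro y
    obtain ⟨L, hL, hLw⟩ := hasFDerivAt_fourierInv h0 h1 y
    rw [hinv] at hL
    exact ⟨hL.differentiableAt, by rw [hL.fderiv, hLw]⟩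
  have hDi : Integrable (fun ξ => (Complex.I * ((⟪wave ξ, e⟫ : ℝ) : ℂ)) • 𝓕 f ξ) := by
    refine h1.norm.mono' ?_ (Filter.Eventually.of_forall fun ξ => ?_)
    · have : Continuous fun ξ : R3 => Complex.I * ((⟪wave ξ, e⟫ : ℝ) : ℂ) := by
        unfold wave; fun_prop
      exact this.aestronglyMeasurable.smul h0.1
    · rw [norm_smul, norm_smul, Real.norm_of_nonneg (jap_pos _).le, norm_mul, Complex.norm_I,
        one_mul, Complex.norm_real, Real.norm_eq_abs]
      gcongr
      refine (abs_real_inner_le_norm _ _).trans ?_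
      simpa [e] using norm_le_jap (wave ξ)
  have hDc : Continuous D := continuous_fourierInv hDi
  obtain ⟨g, hg, hgb⟩ := h fun _ => i
  have he : ∀ᵐ y, D y = g y := by
    refine ae_eq_of_integral_contDiff_smul_eq hDc.locallyIntegrable
      hg.locallyIntegrable_right fun φ hφ hφc => ?_
    have hw := hg.integral_eq φ hφ hφc
    simp only [iteratedFDeriv_one_apply, pow_one, neg_smul, one_smul] at hw
    have hφ' : Continuous fun y => fderiv ℝ φ y e :=
      (hφ.continuous_fderiv (by simp)).clm_apply continuous_const
    have hφ'c : HasCompactSupport fun y => fderiv ℝ φ y e := hφc.fderiv_apply ℝ _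
    have hDe : (fun y => fderiv ℝ f y e) = D := funext fun y => (hder y).2
    have hip := integral_bilinear_fderiv_right_eq_neg_left_of_integrable (μ := volume)
      (B := ContinuousLinearMap.lsmul ℝ ℝ) (f := φ) (g := f) (v := e)
      ((hφ'.smul hf).integrable_of_hasCompactSupport hφ'c.smul_right)
      (by
        have : Integrable fun y => φ y • D y :=
          (hφ.continuous.smul hDc).integrable_of_hasCompactSupport hφc.smul_right
        rw [← hDe] at this
        exact this)
      ((hφ.continuous.smul hf).integrable_of_hasCompactSupport hφc.smul_right)
      (fun y _ => hφ.differentiable (by simp) y) (fun y _ => (hder y).1)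
    simp only [ContinuousLinearMap.lsmul_apply] at hip
    have h3 : ∀ y, fderiv ℝ f y e = D y := fun y => (hder y).2
    simp only [h3] at hip
    rw [hip]
    exact neg_eq_iff_eq_neg.2 hw
  have hbd : ∀ᵐ y, ‖D y‖ ≤ b := by
    filter_upwards [he, ae_norm_le_of_eLpNorm_top_le hb hgb] with y h1 h2
    rw [h1]; exact h2
  exact norm_le_of_ae_le hDc hbd x

end Weak

/-! ### `L^∞` bounds for the operators of the oscillatory field -/

lemma amp_eq (σ : ℤˣ) (k : R3) : amp σ k = 2⁻¹ * (omegaSym σ 0 k)⁻¹ := by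
  have hj : ((jap k : ℝ) : ℂ) ≠ 0 := by exact_mod_cast (jap_pos _).ne'
  have h0 : hat (0 : R3) = 0 := by simp [hat]
  rw [amp, omegaSym, lam, h0, inner_zero_right]
  rcases Int.units_eq_one_or σ with rfl | rfl <;> push_cast <;>
    simp only [mul_zero, add_zero] <;> field_simp

/-- `g` is an integrable transform whose inverse transform is bounded by `b`. -/
structure HatBound (g : R3 → C3) (b : ℝ) : Prop where
  integrable : Integrable g
  bound : ∀ x, ‖𝓕⁻ g x‖ ≤ b

lemma HatBound.const_smul {g : R3 → C3} {b : ℝ} (h : HatBound g b) (c : ℂ) :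
    HatBound (fun ξ => c • g ξ) (‖c‖ * b) := by
  refine ⟨h.integrable.smul c, fun x => ?_⟩
  rw [fourierInv_const_smul, norm_smul]
  gcongr
  exact h.bound x

lemma HatBound.mono {g : R3 → C3} {b c : ℝ} (h : HatBound g b) (hbc : b ≤ c) : HatBound g c :=
  ⟨h.integrable, fun x => (h.bound x).trans hbc⟩

/-- The multipliers `ω^{-1}` and `(k · u) ω^{-2}` with `ω = λ_± + i k · v̂` are bounded on `L^∞`,
uniformly for bounded `v`. -/
lemma exists_hatBound_omegaSym (R : ℝ) : ∃ M, 0 ≤ M ∧ ∀ (σ : ℤˣ) (v : R3), ‖v‖ ≤ R →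
    ∀ (g : R3 → C3) (b : ℝ), HatBound g b →
      HatBound (fun ξ => (omegaSym σ v (wave ξ))⁻¹ • g ξ) (M * b) ∧
      ∀ u : R3, HatBound (fun ξ => (((⟪wave ξ, u⟫ : ℝ) : ℂ) *
        ((omegaSym σ v (wave ξ))⁻¹ * (omegaSym σ v (wave ξ))⁻¹)) • g ξ) (M * ‖u‖ * b) := by
  obtain ⟨C1, hC1⟩ := exists_isSymbol_inv_omegaSym (max R 1)
  obtain ⟨C2, hC2⟩ := exists_isSymbol_inner_mul_inv_omegaSym (max R 1)
  obtain ⟨M1, hM1, hM1'⟩ := exists_multiplier_bound C1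
  obtain ⟨M2, hM2, hM2'⟩ := exists_multiplier_bound C2
  have hbd : ∀ (m : R3 → ℂ) C, IsSymbol (-1) C m → ∀ g : R3 → C3, Integrable g →
      Integrable fun ξ => m ξ • g ξ := fun m C hm g hg =>
    integrable_smul_of_bound hm.smooth.continuous hm.norm_le hg
  refine ⟨max M1 M2, le_max_of_le_left hM1, fun σ v hv g b hg => ⟨⟨?_, fun x => ?_⟩,
    fun u => ?_⟩⟩
  · exact hbd _ _ (hC1 σ v (hv.trans (le_max_left _ _))) g hg.integrable
  · have hb : 0 ≤ b := (norm_nonneg _).trans (hg.bound 0)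
    refine (hM1' _ (hC1 σ v (hv.trans (le_max_left _ _))) g hg.integrable b hg.bound x).trans ?_
    gcongr; exact le_max_left _ _
  · have hb : 0 ≤ b := (norm_nonneg _).trans (hg.bound 0)
    -- normalise the direction `u`
    obtain ⟨u', hu', hu⟩ : ∃ u' : R3, ‖u'‖ ≤ 1 ∧ u = ‖u‖ • u' := by
      by_cases h0 : u = 0
      · exact ⟨0, by simp, by simp [h0]⟩
      · have hn : ‖u‖ ≠ 0 := norm_ne_zero_iff.2 h0
        refine ⟨‖u‖⁻¹ • u, ?_, ?_⟩
        · rw [norm_smul, norm_inv, norm_norm, inv_mul_cancel₀ hn]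
        · rw [smul_smul, mul_inv_cancel₀ hn, one_smul]
    have hs := hC2 σ v u' (hv.trans (le_max_left _ _)) (hu'.trans (le_max_right _ _))
    have e : (fun ξ => (((⟪wave ξ, u⟫ : ℝ) : ℂ) *
        ((omegaSym σ v (wave ξ))⁻¹ * (omegaSym σ v (wave ξ))⁻¹)) • g ξ) =
        fun ξ => ((‖u‖ : ℝ) : ℂ) • ((((⟪wave ξ, u'⟫ : ℝ) : ℂ) *
        ((omegaSym σ v (wave ξ))⁻¹ * (omegaSym σ v (wave ξ))⁻¹)) • g ξ) := by
      ext1 ξ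
      conv_lhs => rw [hu, inner_smul_right]
      rw [smul_smul]
      congr 1
      push_cast; ring
    rw [e]
    have hu2 : HatBound _ (M2 * b) :=
      ⟨hbd _ _ hs g hg.integrable, hM2' _ hs g hg.integrable b hg.bound⟩
    refine (hu2.const_smul ((‖u‖ : ℝ) : ℂ)).mono ?_
    rw [Complex.norm_real, norm_norm]
    calc ‖u‖ * (M2 * b) ≤ ‖u‖ * (max M1 M2 * b) := by gcongr; exact le_max_right _ _
      _ = _ := by ring

/-- Bounds in `L^∞` for the multipliers that define `E^{osc,j}`, its gradient, and
`a(i∂_x) φ_j ⋆ F`, `j = 1, 2`, uniformly for bounded velocities. -/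
lemma exists_hatBound_multipliers (R : ℝ) : ∃ M, 0 ≤ M ∧ ∀ (σ : ℤˣ) (v : R3), ‖v‖ ≤ R →
    ∀ (g : R3 → C3) (b : ℝ), HatBound g b →
      (∀ j, 1 ≤ j → j ≤ 2 →
        HatBound (fun ξ => (omegaSym σ v (wave ξ) ^ j)⁻¹ • g ξ) (M * b) ∧
        HatBound (fun ξ => (amp σ (wave ξ) * (omegaSym σ v (wave ξ) ^ j)⁻¹) • g ξ) (M * b) ∧
        ∀ u : R3, HatBound (fun ξ => (Complex.I * ((⟪wave ξ, u⟫ : ℝ) : ℂ)) •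
          ((omegaSym σ v (wave ξ) ^ (j + 1))⁻¹ • g ξ)) (M * ‖u‖ * b)) := by
  obtain ⟨M, hM, hMb⟩ := exists_hatBound_omegaSym (max R 0)
  have key : ∀ m, 1 ≤ m → m ≤ 3 → M ^ m ≤ (1 + M) ^ 3 := by
    intro m h1 h2
    exact (pow_le_pow_left₀ hM (by linarith) m).trans (pow_le_pow_right₀ (by linarith) h2)
  refine ⟨(1 + M) ^ 3, by positivity, fun σ v hv g b hg j hj1 hj2 => ?_⟩
  have hv' : ‖v‖ ≤ max R 0 := hv.trans (le_max_left _ _)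
  have hb : 0 ≤ b := (norm_nonneg _).trans (hg.bound 0)
  -- powers of `ω^{-1}`
  have hpow : ∀ (v : R3), ‖v‖ ≤ max R 0 → ∀ (g : R3 → C3) (b : ℝ), HatBound g b → ∀ j : ℕ,
      HatBound (fun ξ => (omegaSym σ v (wave ξ) ^ j)⁻¹ • g ξ) (M ^ j * b) := by
    intro v hv g b hg j
    induction j with
    | zero => simpa using hg
    | succ j ih =>
      have := (hMb σ v hv _ _ ih).1
      rw [← mul_assoc, ← pow_succ'] at this
      convert! this using 2
      rw [smul_smul, pow_succ, mul_inv, mul_comm]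
  refine ⟨(hpow v hv' g b hg j).mono ?_, ?_, fun u => ?_⟩
  · gcongr; exact key j hj1 (by omega)
  · have h1 := hpow v hv' g b hg j
    have h2 := (hMb σ 0 (by simp) _ _ h1).1
    have h3 : HatBound (fun ξ => (2⁻¹ : ℂ) • ((omegaSym σ 0 (wave ξ))⁻¹ •
        ((omegaSym σ v (wave ξ) ^ j)⁻¹ • g ξ))) (M * (M ^ j * b)) := by
      refine (h2.const_smul 2⁻¹).mono ?_
      have h2' : ‖(2⁻¹ : ℂ)‖ ≤ 1 := by norm_num
      exact mul_le_of_le_one_left (by positivity) h2'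
    have e : (fun ξ => (2⁻¹ : ℂ) • ((omegaSym σ 0 (wave ξ))⁻¹ •
        ((omegaSym σ v (wave ξ) ^ j)⁻¹ • g ξ))) =
        fun ξ => (amp σ (wave ξ) * (omegaSym σ v (wave ξ) ^ j)⁻¹) • g ξ := by
      ext1 ξ; rw [smul_smul, smul_smul, amp_eq]
    rw [e] at h3
    refine h3.mono ?_
    rw [← mul_assoc, ← pow_succ']
    gcongr; exact key (j + 1) (by omega) (by omega)
  · have h1 := hpow v hv' g b hg (j - 1)
    have h2 := (hMb σ v hv' _ _ h1).2 u
    have h3 : HatBound (fun ξ => Complex.I • ((((⟪wave ξ, u⟫ : ℝ) : ℂ) *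
        ((omegaSym σ v (wave ξ))⁻¹ * (omegaSym σ v (wave ξ))⁻¹)) •
          ((omegaSym σ v (wave ξ) ^ (j - 1))⁻¹ • g ξ))) (M * ‖u‖ * (M ^ (j - 1) * b)) := by
      refine (h2.const_smul Complex.I).mono ?_
      rw [Complex.norm_I, one_mul]
    have e : (fun ξ => Complex.I • ((((⟪wave ξ, u⟫ : ℝ) : ℂ) *
        ((omegaSym σ v (wave ξ))⁻¹ * (omegaSym σ v (wave ξ))⁻¹)) •
          ((omegaSym σ v (wave ξ) ^ (j - 1))⁻¹ • g ξ))) =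
        fun ξ => (Complex.I * ((⟪wave ξ, u⟫ : ℝ) : ℂ)) •
          ((omegaSym σ v (wave ξ) ^ (j + 1))⁻¹ • g ξ) := by
      ext1 ξ
      obtain ⟨l, rfl⟩ : ∃ l, j = l + 1 := ⟨j - 1, by omega⟩
      simp only [smul_smul, Nat.add_sub_cancel]
      congr 1
      rw [pow_succ, pow_succ, mul_inv, mul_inv]
      ring
    rw [e] at h3
    refine h3.mono ?_
    have h5 : M * ‖u‖ * (M ^ (j - 1) * b) = M ^ j * (‖u‖ * b) := by
      obtain ⟨l, rfl⟩ : ∃ l, j = l + 1 := ⟨j - 1, by omega⟩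
      rw [Nat.add_sub_cancel]; ring
    rw [h5, mul_assoc]
    gcongr; exact key j hj1 (by omega)

/-! ### Products with absolutely continuous functions -/

section AbsolutelyContinuous

variable {F : Type*} [NormedAddCommGroup F] [NormedSpace ℝ F]

lemma absolutelyContinuousOnInterval_primitive {f : ℝ → F} {a c K : ℝ}
    (hac : a ≤ c) (hf : IntervalIntegrable f volume a c) (hK : ∀ τ ∈ Icc a c, ‖f τ‖ ≤ K) :
    AbsolutelyContinuousOnInterval (fun τ => ∫ r in a..τ, f r) a c := by
  have hK0 : 0 ≤ K := (norm_nonneg _).trans (hK a (left_mem_Icc.2 hac))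
  have hsub : ∀ x ∈ Icc a c, IntervalIntegrable f volume a x := fun x hx =>
    hf.mono_set (by rw [uIcc_of_le hac, uIcc_of_le hx.1]; exact Icc_subset_Icc_right hx.2)
  have : LipschitzOnWith ⟨K, hK0⟩ (fun τ => ∫ r in a..τ, f r) (uIcc a c) := by
    rw [uIcc_of_le hac]
    refine LipschitzOnWith.of_dist_le_mul fun x hx y hy => ?_
    rw [dist_eq_norm, intervalIntegral.integral_interval_sub_left (hsub x hx) (hsub y hy)]
    refine (intervalIntegral.norm_integral_le_of_norm_le_const (C := K) fun r hr => hK r ?_).trans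
      (le_of_eq (by rw [Real.dist_eq]; rfl))
    have hr' := uIoc_subset_uIcc hr
    exact (uIcc_subset_Icc hy hx) hr'
  exact this.absolutelyContinuousOnInterval

/-- The fundamental theorem of calculus for the product of a `C¹` function with a primitive of a
bounded measurable function. -/
lemma smul_sub_smul_eq_integral {𝕜 : Type*} [RCLike 𝕜] [NormedSpace 𝕜 F] [IsScalarTower ℝ 𝕜 F]
    [CompleteSpace F] {P P' : ℝ → 𝕜} {β b : ℝ → F} {a c K : ℝ} (hac : a ≤ c)
    (hP : ∀ τ ∈ Icc a c, HasDerivWithinAt P (P' τ) (Icc a c) τ) (hP' : ContinuousOn P' (Icc a c))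
    (hb : IntervalIntegrable b volume a c) (hK : ∀ τ ∈ Icc a c, ‖b τ‖ ≤ K)
    (hβ : ∀ τ ∈ Icc a c, β τ = β a + ∫ r in a..τ, b r) :
    P c • β c - P a • β a = ∫ τ in a..c, (P' τ • β τ + P τ • b τ) := by
  have hPc : ContinuousOn P (Icc a c) := fun τ hτ => (hP τ hτ).continuousWithinAt
  obtain ⟨L, hL⟩ := isCompact_Icc.exists_bound_of_continuousOn hP'
  obtain ⟨M, hM⟩ := isCompact_Icc.exists_bound_of_continuousOn hPc
  have hPac : AbsolutelyContinuousOnInterval P a c := by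
    have hL0 : 0 ≤ L := (norm_nonneg _).trans (hL a (left_mem_Icc.2 hac))
    have : LipschitzOnWith ⟨L, hL0⟩ P (uIcc a c) := by
      rw [uIcc_of_le hac]
      exact (convex_Icc a c).lipschitzOnWith_of_nnnorm_hasDerivWithin_le hP fun τ hτ => hL τ hτ
    exact this.absolutelyContinuousOnInterval
  have hprim := absolutelyContinuousOnInterval_primitive hac hb hK
  have hβac : AbsolutelyContinuousOnInterval (fun τ => β a + ∫ r in a..τ, b r) a c := by
    have hc : AbsolutelyContinuousOnInterval (fun _ : ℝ => β a) a c :=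
      (LipschitzWith.const (β a)).lipschitzOnWith.absolutelyContinuousOnInterval
    exact hc.add hprim
  set β' : ℝ → F := fun τ => β a + ∫ r in a..τ, b r
  have hβc : ContinuousOn β' (Icc a c) := by
    have := hβac.continuousOn; rwa [uIcc_of_le hac] at this
  obtain ⟨N, hN⟩ := isCompact_Icc.exists_bound_of_continuousOn hβc
  have huI : uIcc a c = Icc a c := uIcc_of_le hac
  set f : ℝ → F := fun τ => P' τ • β' τ + P τ • b τ
  have hf1 : IntervalIntegrable (fun τ => P' τ • β' τ) volume a c :=
    ContinuousOn.intervalIntegrable (by rw [huI]; exact hP'.smul hβc)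
  have hf2 : IntervalIntegrable (fun τ => P τ • b τ) volume a c :=
    hb.continuousOn_smul (by rw [huI]; exact hPc)
  have hf : IntervalIntegrable f volume a c := hf1.add hf2
  have hfK : ∀ τ ∈ Icc a c, ‖f τ‖ ≤ L * N + M * K := by
    intro τ hτ
    refine norm_add_le_of_le ?_ ?_
    · rw [norm_smul]
      exact mul_le_mul (hL τ hτ) (hN τ hτ) (norm_nonneg _) ((norm_nonneg _).trans (hL τ hτ))
    · rw [norm_smul]
      exact mul_le_mul (hM τ hτ) (hK τ hτ) (norm_nonneg _) ((norm_nonneg _).trans (hM τ hτ))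
  have hgac : AbsolutelyContinuousOnInterval
      (fun τ => P τ • β' τ - ∫ r in a..τ, f r) a c :=
    (hPac.fun_smul hβac).sub (absolutelyContinuousOnInterval_primitive hac hf hfK)
  have hae : ∀ᵐ τ, τ ∈ uIcc a c →
      HasDerivAt (fun τ => P τ • β' τ - ∫ r in a..τ, f r) 0 τ := by
    have hne : ∀ᵐ τ : ℝ, τ ≠ a ∧ τ ≠ c := by
      have h1 : ∀ᵐ τ : ℝ, τ ≠ a := by simp [ae_iff]
      have h2 : ∀ᵐ τ : ℝ, τ ≠ c := by simp [ae_iff]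
      exact h1.and h2
    filter_upwards [hb.ae_hasDerivAt_integral, hf.ae_hasDerivAt_integral, hne]
      with τ h1 h2 h3 hτ
    have hτ' := hτ
    rw [huI] at hτ'
    have hnhds : Icc a c ∈ nhds τ :=
      Icc_mem_nhds (lt_of_le_of_ne hτ'.1 h3.1.symm) (lt_of_le_of_ne hτ'.2 h3.2)
    have d1 := (hP τ hτ').hasDerivAt hnhds
    have d2 := (h1 hτ a left_mem_uIcc).const_add (β a)
    have d3 := h2 hτ a left_mem_uIcc
    have d4 := (d1.smul d2).sub d3
    convert! d4 using 1
    simp only [f, β']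
    abel
  obtain ⟨C, hC⟩ := hgac.const_of_ae_hasDerivAt_zero hae
  have e1 := hC a left_mem_uIcc
  have e2 := hC c right_mem_uIcc
  have hβa : β' a = β a := by simp [β']
  have hβc' : β' c = β c := (hβ c (right_mem_Icc.2 hac)).symm
  simp only [intervalIntegral.integral_same, sub_zero, hβa] at e1
  rw [hβc'] at e2
  have e3 : ∫ τ in a..c, (P' τ • β τ + P τ • b τ) = ∫ τ in a..c, f τ := by
    refine intervalIntegral.integral_congr fun τ hτ => ?_
    rw [huI] at hτ
    simp only [f]
    rw [hβ τ hτ]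
  rw [e3, e1, ← e2]; abel

end AbsolutelyContinuous

/-! ### The profiles of the oscillatory field -/

lemma integrable_weight_of_sobolevNorm {F : Type*} [NormedAddCommGroup F] [NormedSpace ℝ F]
    {f : R3 → F} (hf : AEStronglyMeasurable f volume) {m : ℕ} (hm : 5 ≤ m) {c : ℝ} (hc : 0 ≤ c)
    (h : sobolevNorm m f ≤ ENNReal.ofReal c) :
    Integrable (fun ξ => jap (wave ξ) ^ 3 * ‖f ξ‖) ∧
      ∫ ξ, jap (wave ξ) ^ 3 * ‖f ξ‖ ≤ 2⁻¹ * ((∫ ξ : R3, jap (wave ξ) ^ (-4 : ℤ)) + c ^ 2) := by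
  have hjc : Continuous fun ξ : R3 => jap (wave ξ) := continuous_jap.comp contDiff_wave.continuous
  set g : R3 → F := fun ξ => jap (wave ξ) ^ m • f ξ
  have hg : MemLp g 2 volume :=
    ⟨(hjc.pow m).aestronglyMeasurable.smul hf, h.trans_lt ENNReal.ofReal_lt_top⟩
  have hgi : Integrable (fun ξ => ‖g ξ‖ ^ 2) := by
    simpa using hg.integrable_norm_pow (by norm_num)
  have hgb : ∫ ξ, ‖g ξ‖ ^ 2 ≤ c ^ 2 := by
    have h1 : eLpNorm g 2 volume ≤ ENNReal.ofReal c := h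
    rw [hg.eLpNorm_eq_integral_rpow_norm (by norm_num) (by norm_num),
      ENNReal.ofReal_le_ofReal_iff hc] at h1
    simp only [ENNReal.toReal_ofNat, Real.rpow_ofNat] at h1
    have h0 : 0 ≤ ∫ ξ, ‖g ξ‖ ^ 2 := integral_nonneg fun ξ => by positivity
    rw [← one_div, ← Real.sqrt_eq_rpow] at h1
    exact (Real.sqrt_le_left hc).1 h1
  have hpt : ∀ ξ, jap (wave ξ) ^ 3 * ‖f ξ‖ ≤
      2⁻¹ * (jap (wave ξ) ^ (-4 : ℤ) + ‖g ξ‖ ^ 2) := by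
    intro ξ
    have hj := jap_pos (wave ξ)
    have h1 : jap (wave ξ) ^ 5 * ‖f ξ‖ ≤ ‖g ξ‖ := by
      simp only [g]
      rw [norm_smul, Real.norm_of_nonneg (by positivity)]
      gcongr
      exact one_le_jap _
    have h2 : jap (wave ξ) ^ 3 * ‖f ξ‖ ≤ jap (wave ξ) ^ (-2 : ℤ) * ‖g ξ‖ := by
      calc jap (wave ξ) ^ 3 * ‖f ξ‖ = jap (wave ξ) ^ (-2 : ℤ) * (jap (wave ξ) ^ 5 * ‖f ξ‖) := by
            rw [zpow_neg]; field_simp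
        _ ≤ _ := by gcongr
    have h3 : jap (wave ξ) ^ (-4 : ℤ) = (jap (wave ξ) ^ (-2 : ℤ)) ^ 2 := by
      rw [← zpow_natCast, ← zpow_mul]; norm_num
    rw [h3]
    nlinarith [sq_nonneg (jap (wave ξ) ^ (-2 : ℤ) - ‖g ξ‖)]
  have hbi := (integrable_jap_wave_zpow.add hgi).const_mul 2⁻¹
  have hint : Integrable (fun ξ => jap (wave ξ) ^ 3 * ‖f ξ‖) := by
    refine hbi.mono' ((hjc.pow 3).aestronglyMeasurable.mul hf.norm)
      (Filter.Eventually.of_forall fun ξ => ?_)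
    have hj := jap_pos (wave ξ)
    rw [Real.norm_of_nonneg (by positivity)]
    exact hpt ξ
  refine ⟨hint, (integral_mono hint hbi hpt).trans ?_⟩
  simp only [Pi.add_apply]
  rw [integral_const_mul, integral_add integrable_jap_wave_zpow hgi]
  gcongr

/-- `β` is the profile `B̂(t,ξ)` of an oscillatory field on `[0,T]`, with time derivative `b`, and
the integrable function `G` dominates it. The source is not assumed to be continuous in time in
`L¹`, so `β` is only absolutely continuous in time. -/
structure IsProfile (T : ℝ) (β b : ℝ → R3 → C3) (G : R3 → ℝ) : Prop where
  eq_integral : ∀ τ ∈ Icc 0 T, ∀ ξ, β τ ξ = β 0 ξ + ∫ r in (0 : ℝ)..τ, b r ξ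
  norm_le : ∀ τ ∈ Icc 0 T, ∀ ξ, ‖β τ ξ‖ ≤ G ξ
  integrable_dom : Integrable fun ξ => jap (wave ξ) * G ξ
  stronglyMeasurable : StronglyMeasurable (Function.uncurry b)
  stronglyMeasurable_zero : StronglyMeasurable (β 0)
  bounded : ∀ ξ, ∃ K, ∀ r, ‖b r ξ‖ ≤ K
  integrable : Integrable (Function.uncurry b) ((volume.restrict (Icc 0 T)).prod volume)

namespace IsProfile

variable {T : ℝ} {β b : ℝ → R3 → C3} {G : R3 → ℝ}

lemma intervalIntegrable (h : IsProfile T β b G) (ξ : R3) (a c : ℝ) :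
    IntervalIntegrable (fun r => b r ξ) volume a c := by
  obtain ⟨K, hK⟩ := h.bounded ξ
  have hm : AEStronglyMeasurable (fun r => b r ξ) volume :=
    (h.stronglyMeasurable.comp_measurable measurable_prodMk_right).aestronglyMeasurable
  rw [intervalIntegrable_iff]
  exact Measure.integrableOn_of_bounded (M := K) (by simp [uIoc]) hm
    (Filter.Eventually.of_forall hK)

lemma continuousOn (h : IsProfile T β b G) (ξ : R3) :
    ContinuousOn (fun τ => β τ ξ) (Icc 0 T) := by
  have h1 : Continuous fun τ => β 0 ξ + ∫ r in (0 : ℝ)..τ, b r ξ :=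
    continuous_const.add (intervalIntegral.continuous_primitive (h.intervalIntegrable ξ) 0)
  exact h1.continuousOn.congr fun τ hτ => h.eq_integral τ hτ ξ

lemma stronglyMeasurable_primitive (h : IsProfile T β b G) :
    StronglyMeasurable (Function.uncurry fun (τ : ℝ) ξ => β 0 ξ + ∫ r in (0 : ℝ)..τ, b r ξ) := by
  refine stronglyMeasurable_uncurry_of_continuous_of_stronglyMeasurable (fun ξ =>
    continuous_const.add (intervalIntegral.continuous_primitive (h.intervalIntegrable ξ) 0))
    fun τ => ?_
  unfold intervalIntegral
  exact h.stronglyMeasurable_zero.add ((h.stronglyMeasurable.integral_prod_left).sub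
    h.stronglyMeasurable.integral_prod_left)

lemma stronglyMeasurable_apply (h : IsProfile T β b G) {τ : ℝ} (hτ : τ ∈ Icc 0 T) :
    StronglyMeasurable (β τ) := by
  have h1 := h.stronglyMeasurable_primitive.comp_measurable (measurable_prodMk_left (x := τ))
  convert! h1 using 1
  ext1 ξ
  exact h.eq_integral τ hτ ξ

lemma aestronglyMeasurable_uncurry (h : IsProfile T β b G) {s t : ℝ} (hs : 0 ≤ s) (ht : t ≤ T) :
    AEStronglyMeasurable (Function.uncurry β) ((volume.restrict (Icc s t)).prod volume) := by
  refine h.stronglyMeasurable_primitive.aestronglyMeasurable.congr ?_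
  have h1 : ∀ᵐ p : ℝ × R3 ∂((volume.restrict (Icc s t)).prod volume), p.1 ∈ Icc s t :=
    Measure.quasiMeasurePreserving_fst.ae (ae_restrict_mem measurableSet_Icc)
  filter_upwards [h1] with p hp
  exact (h.eq_integral p.1 ⟨hs.trans hp.1, hp.2.trans ht⟩ p.2).symm

/-- Fourier integrals of a profile against symbols of order one that depend continuously on time
are continuous in time. -/
lemma continuousOn_integral (h : IsProfile T β b G) {s t C : ℝ} (hs : 0 ≤ s) (ht : t ≤ T)
    {m : ℝ → R3 → ℂ} (hm : ∀ τ ∈ Icc s t, Continuous (m τ))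
    (hmc : ∀ ξ, ContinuousOn (fun τ => m τ ξ) (Icc s t))
    (hmb : ∀ τ ∈ Icc s t, ∀ ξ, ‖m τ ξ‖ ≤ C * jap (wave ξ)) :
    ContinuousOn (fun τ => ∫ ξ, m τ ξ • β τ ξ) (Icc s t) := by
  have hsub : Icc s t ⊆ Icc 0 T := Icc_subset_Icc hs ht
  refine MeasureTheory.continuousOn_of_dominated (bound := fun ξ => C * (jap (wave ξ) * G ξ))
    (fun τ hτ => ?_) (fun τ hτ => Filter.Eventually.of_forall fun ξ => ?_)
    (h.integrable_dom.const_mul C) (Filter.Eventually.of_forall fun ξ => ?_)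
  · exact (hm τ hτ).aestronglyMeasurable.smul
      (h.stronglyMeasurable_apply (hsub hτ)).aestronglyMeasurable
  · rw [norm_smul, ← mul_assoc]
    exact mul_le_mul (hmb τ hτ ξ) (h.norm_le τ (hsub hτ) ξ) (norm_nonneg _)
      ((norm_nonneg _).trans (hmb τ hτ ξ))
  · exact (hmc ξ).smul ((h.continuousOn ξ).mono hsub)

end IsProfile

/-! ### Transport along characteristics -/

lemma contDiff_hat : ContDiff ℝ ∞ hat :=
  (contDiff_jap.inv fun v => (jap_pos v).ne').smul contDiff_id

lemma hasFDerivAt_hat (v : R3) : HasFDerivAt hat (gradHat v) v :=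
  (contDiff_hat.differentiable (by simp) v).hasFDerivAt

lemma continuous_gradHat : Continuous gradHat := contDiff_hat.continuous_fderiv (by simp)

/-- The Fourier integrand of `E^{osc,j}_±(τ,x,v)` without the profile. -/
noncomputable def phase (σ : ℤˣ) (j : ℕ) (x v : R3) (τ : ℝ) (ξ : R3) : ℂ :=
  Complex.exp (Complex.I * ((⟪wave ξ, x⟫ : ℝ) : ℂ)) * (omegaSym σ v (wave ξ) ^ j)⁻¹ *
    Complex.exp (lam σ (wave ξ) * (τ : ℂ))

lemma norm_exp_lam (σ : ℤˣ) (k : R3) (τ : ℝ) : ‖Complex.exp (lam σ k * (τ : ℂ))‖ = 1 := by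
  have : lam σ k * (τ : ℂ) = (((σ : ℤ) * jap k * τ : ℝ) : ℂ) * Complex.I := by
    rw [lam]; push_cast; ring
  rw [this, Complex.norm_exp_ofReal_mul_I]

lemma norm_inv_omegaSym_pow_le (σ : ℤˣ) (j : ℕ) (v k : R3) :
    ‖(omegaSym σ v k ^ j)⁻¹‖ ≤ (2 * jap v ^ 2) ^ j := by
  have h := norm_omegaSym_ge σ v k
  have hv := jap_pos v
  rw [← inv_pow, norm_pow, norm_inv]
  gcongr
  rw [← inv_inv (2 * jap v ^ 2)]
  apply inv_anti₀ (by positivity)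
  refine le_trans ?_ h
  exact le_mul_of_one_le_right (by positivity) (one_le_jap k)

lemma norm_phase_le (σ : ℤˣ) (j : ℕ) (x v : R3) (τ : ℝ) (ξ : R3) :
    ‖phase σ j x v τ ξ‖ ≤ (2 * jap v ^ 2) ^ j := by
  rw [phase, norm_mul, norm_mul, norm_exp_lam, mul_one, mul_comm Complex.I,
    Complex.norm_exp_ofReal_mul_I, one_mul]
  exact norm_inv_omegaSym_pow_le σ j v _

lemma continuous_omegaSym (σ : ℤˣ) :
    Continuous fun p : R3 × R3 => omegaSym σ p.1 (wave p.2) := by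
  have h1 : Continuous hat := contDiff_hat.continuous
  have h2 : Continuous wave := contDiff_wave.continuous
  have h3 : Continuous (jap : R3 → ℝ) := continuous_jap
  unfold omegaSym lam
  fun_prop

lemma continuous_lam (σ : ℤˣ) : Continuous fun ξ : R3 => lam σ (wave ξ) :=
  continuous_const.mul (Complex.continuous_ofReal.comp
    (continuous_jap.comp contDiff_wave.continuous))

lemma continuousOn_phase (σ : ℤˣ) (j : ℕ) {x v : ℝ → R3} {s : Set ℝ} (hx : ContinuousOn x s)
    (hv : ContinuousOn v s) :
    ContinuousOn (fun p : ℝ × R3 => phase σ j (x p.1) (v p.1) p.1 p.2) (s ×ˢ univ) := by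
  have hx' : ContinuousOn (fun p : ℝ × R3 => x p.1) (s ×ˢ univ) :=
    hx.comp continuousOn_fst fun p hp => hp.1
  have hv' : ContinuousOn (fun p : ℝ × R3 => v p.1) (s ×ˢ univ) :=
    hv.comp continuousOn_fst fun p hp => hp.1
  have hq : ContinuousOn (fun p : ℝ × R3 => (v p.1, p.2)) (s ×ˢ univ) :=
    hv'.prodMk continuousOn_snd
  have ho := (continuous_omegaSym σ).comp_continuousOn hq
  simp only [Function.comp_def] at ho
  have hw : ContinuousOn (fun p : ℝ × R3 => wave p.2) (s ×ˢ univ) :=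
    contDiff_wave.continuous.comp_continuousOn continuousOn_snd
  have h1 : ContinuousOn (fun p : ℝ × R3 => ⟪wave p.2, x p.1⟫) (s ×ˢ univ) :=
    continuous_inner.comp_continuousOn (hw.prodMk hx')
  have h2 : ContinuousOn (fun p : ℝ × R3 => Complex.exp (Complex.I * ((⟪wave p.2, x p.1⟫ : ℝ) : ℂ)))
      (s ×ˢ univ) :=
    Complex.continuous_exp.comp_continuousOn (continuousOn_const.mul
      (Complex.continuous_ofReal.comp_continuousOn h1))
  have h3 : ContinuousOn (fun p : ℝ × R3 => (omegaSym σ (v p.1) (wave p.2) ^ j)⁻¹) (s ×ˢ univ) :=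
    (ho.pow j).inv₀ fun p _ => pow_ne_zero _ (omegaSym_ne_zero _ _ _)
  have h4 : Continuous (fun p : ℝ × R3 => Complex.exp (lam σ (wave p.2) * (p.1 : ℂ))) :=
    Complex.continuous_exp.comp (((continuous_lam σ).comp continuous_snd).mul
      (Complex.continuous_ofReal.comp continuous_fst))
  have h5 := h4.continuousOn (s := s ×ˢ univ)
  simp only [phase]
  exact (h2.mul h3).mul h5

lemma phase_mul_omegaSym (σ : ℤˣ) (j : ℕ) (x v : R3) (τ : ℝ) (ξ : R3) :
    phase σ (j + 1) x v τ ξ * omegaSym σ v (wave ξ) = phase σ j x v τ ξ := by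
  have h := omegaSym_ne_zero σ v (wave ξ)
  rw [phase, phase, pow_succ]
  field_simp

/-- Along a characteristic, the transport operator multiplies the phase by `ω = λ + i k · v̂`, up
to the term in which the force differentiates `ω^{-j}`. -/
lemma hasDerivWithinAt_phase (σ : ℤˣ) (j : ℕ) {x v : ℝ → R3} {e : R3} {S : Set ℝ} {τ : ℝ} (ξ : R3)
    (hx : HasDerivWithinAt x (hat (v τ)) S τ) (hv : HasDerivWithinAt v e S τ) :
    HasDerivWithinAt (fun r => phase σ (j + 1) (x r) (v r) r ξ)
      (phase σ j (x τ) (v τ) τ ξ - (j + 1 : ℂ) *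
        ((Complex.I * ((⟪wave ξ, gradHat (v τ) e⟫ : ℝ) : ℂ)) *
          phase σ (j + 2) (x τ) (v τ) τ ξ)) S τ := by
  have ho := omegaSym_ne_zero σ (v τ) (wave ξ)
  have hin : ∀ {y : ℝ → R3} {y' : R3}, HasDerivWithinAt y y' S τ →
      HasDerivWithinAt (fun r => Complex.I * ((⟪wave ξ, y r⟫ : ℝ) : ℂ))
        (Complex.I * ((⟪wave ξ, y'⟫ : ℝ) : ℂ)) S τ := by
    intro y y' hy
    have h1 : HasDerivWithinAt (fun r => ⟪wave ξ, y r⟫) ⟪wave ξ, y'⟫ S τ :=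
      (innerSL ℝ (wave ξ)).hasFDerivAt.comp_hasDerivWithinAt τ hy
    exact h1.ofReal_comp.const_mul _
  have hhat : HasDerivWithinAt (fun r => hat (v r)) (gradHat (v τ) e) S τ :=
    (hasFDerivAt_hat (v τ)).comp_hasDerivWithinAt τ hv
  have hom : HasDerivWithinAt (fun r => omegaSym σ (v r) (wave ξ))
      (Complex.I * ((⟪wave ξ, gradHat (v τ) e⟫ : ℝ) : ℂ)) S τ := (hin hhat).const_add _
  have h1 := (hin hx).cexp
  have h2 := (hom.fun_pow (j + 1)).fun_inv (pow_ne_zero _ ho)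
  have h3 : HasDerivWithinAt (fun r : ℝ => Complex.exp (lam σ (wave ξ) * (r : ℂ)))
      (Complex.exp (lam σ (wave ξ) * (τ : ℂ)) * (lam σ (wave ξ) * 1)) S τ :=
    ((hasDerivWithinAt_id τ S).ofReal_comp.const_mul _).cexp
  have h4 := (h1.fun_mul h2).fun_mul h3
  refine h4.congr_deriv ?_
  rw [← phase_mul_omegaSym σ j]
  have hlam : lam σ (wave ξ) = omegaSym σ (v τ) (wave ξ) -
      Complex.I * ((⟪wave ξ, hat (v τ)⟫ : ℝ) : ℂ) := by rw [omegaSym]; ring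
  simp only [phase]
  rw [pow_succ (omegaSym σ (v τ) (wave ξ)) (j + 1), pow_succ (omegaSym σ (v τ) (wave ξ)) j]
  generalize Complex.exp (lam σ (wave ξ) * (τ : ℂ)) = E3
  rw [hlam]
  simp only [Nat.add_sub_cancel]
  push_cast
  field_simp
  ring

/-- The integrated transport equation: the change of `E^{osc,j+1}_±` along a characteristic is the
time integral of `E^{osc,j}_±`, of the source term, and of the force term. -/
theorem integral_phase_sub_eq {T : ℝ} {β b : ℝ → R3 → C3} {G : R3 → ℝ} (h : IsProfile T β b G)
    {s t : ℝ} (hs : 0 ≤ s) (hst : s ≤ t) (ht : t ≤ T) {x v e : ℝ → R3}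
    (hx : ∀ τ ∈ Icc s t, HasDerivWithinAt x (hat (v τ)) (Icc s t) τ)
    (hv : ∀ τ ∈ Icc s t, HasDerivWithinAt v (e τ) (Icc s t) τ)
    (he : ContinuousOn e (Icc s t)) (σ : ℤˣ) (j : ℕ) :
    ContinuousOn (fun τ => ∫ ξ, phase σ j (x τ) (v τ) τ ξ • β τ ξ) (Icc s t) ∧
    ContinuousOn (fun τ => ∫ ξ, ((Complex.I * ((⟪wave ξ, gradHat (v τ) (e τ)⟫ : ℝ) : ℂ)) *
      phase σ (j + 2) (x τ) (v τ) τ ξ) • β τ ξ) (Icc s t) ∧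
    IntervalIntegrable (fun τ => ∫ ξ, phase σ (j + 1) (x τ) (v τ) τ ξ • b τ ξ) volume s t ∧
    (∫ ξ, phase σ (j + 1) (x t) (v t) t ξ • β t ξ) -
      (∫ ξ, phase σ (j + 1) (x s) (v s) s ξ • β s ξ) =
      ∫ τ in s..t, ((∫ ξ, phase σ j (x τ) (v τ) τ ξ • β τ ξ) - (j + 1 : ℂ) •
        (∫ ξ, ((Complex.I * ((⟪wave ξ, gradHat (v τ) (e τ)⟫ : ℝ) : ℂ)) *
          phase σ (j + 2) (x τ) (v τ) τ ξ) • β τ ξ)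
        + ∫ ξ, phase σ (j + 1) (x τ) (v τ) τ ξ • b τ ξ) := by
  have hsub : Icc s t ⊆ Icc 0 T := Icc_subset_Icc hs ht
  have hxc : ContinuousOn x (Icc s t) := fun τ hτ => (hx τ hτ).continuousWithinAt
  have hvc : ContinuousOn v (Icc s t) := fun τ hτ => (hv τ hτ).continuousWithinAt
  have hphc : ∀ i, ContinuousOn (fun p : ℝ × R3 => phase σ i (x p.1) (v p.1) p.1 p.2)
      (Icc s t ×ˢ univ) := fun i => continuousOn_phase σ i hxc hvc
  have hphξ : ∀ i, ∀ τ ∈ Icc s t, Continuous (fun ξ => phase σ i (x τ) (v τ) τ ξ) :=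
    fun i τ hτ => continuousOn_univ.1 ((hphc i).comp (f := fun ξ : R3 => (τ, ξ))
      (by fun_prop) fun ξ _ => ⟨hτ, trivial⟩)
  have hphτ : ∀ i ξ, ContinuousOn (fun τ => phase σ i (x τ) (v τ) τ ξ) (Icc s t) :=
    fun i ξ => (hphc i).comp (f := fun τ : ℝ => (τ, ξ)) (by fun_prop) fun τ hτ => ⟨hτ, trivial⟩
  -- a common bound for the phases and the force on the compact time interval
  have hbd : ∀ i, ∃ C, 0 ≤ C ∧ ∀ τ ∈ Icc s t, ∀ ξ, ‖phase σ i (x τ) (v τ) τ ξ‖ ≤ C := by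
    intro i
    have hc : ContinuousOn (fun τ => (2 * jap (v τ) ^ 2) ^ i) (Icc s t) :=
      ((continuousOn_const.mul ((continuous_jap.comp_continuousOn hvc).pow 2)).pow i)
    obtain ⟨C, hC⟩ := isCompact_Icc.exists_bound_of_continuousOn hc
    refine ⟨C, (norm_nonneg _).trans (hC s (left_mem_Icc.2 hst)), fun τ hτ ξ => ?_⟩
    exact (norm_phase_le σ i _ _ τ ξ).trans ((le_abs_self _).trans (hC τ hτ))
  set w : ℝ → R3 := fun τ => gradHat (v τ) (e τ)
  have hwc : ContinuousOn w (Icc s t) :=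
    (continuous_gradHat.comp_continuousOn hvc).clm_apply he
  obtain ⟨W, hW⟩ := isCompact_Icc.exists_bound_of_continuousOn hwc
  have hW0 : 0 ≤ W := (norm_nonneg _).trans (hW s (left_mem_Icc.2 hst))
  obtain ⟨C0, hC0, hC0'⟩ := hbd j
  obtain ⟨C1, hC1, hC1'⟩ := hbd (j + 1)
  obtain ⟨C2, hC2, hC2'⟩ := hbd (j + 2)
  set m2 : ℝ → R3 → ℂ := fun τ ξ => (Complex.I * ((⟪wave ξ, w τ⟫ : ℝ) : ℂ)) *
    phase σ (j + 2) (x τ) (v τ) τ ξ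
  have hinp : ContinuousOn (fun p : ℝ × R3 => Complex.I * ((⟪wave p.2, w p.1⟫ : ℝ) : ℂ))
      (Icc s t ×ˢ univ) := by
    have h1 : ContinuousOn (fun p : ℝ × R3 => w p.1) (Icc s t ×ˢ univ) :=
      hwc.comp continuousOn_fst fun p hp => hp.1
    have h2 : ContinuousOn (fun p : ℝ × R3 => wave p.2) (Icc s t ×ˢ univ) :=
      contDiff_wave.continuous.comp_continuousOn continuousOn_snd
    exact continuousOn_const.mul (Complex.continuous_ofReal.comp_continuousOn
      (continuous_inner.comp_continuousOn (h2.prodMk h1)))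
  have hm2p : ContinuousOn (fun p : ℝ × R3 => m2 p.1 p.2) (Icc s t ×ˢ univ) := hinp.mul (hphc _)
  have hm2ξ : ∀ τ ∈ Icc s t, Continuous (m2 τ) :=
    fun τ hτ => continuousOn_univ.1 (hm2p.comp (f := fun ξ : R3 => (τ, ξ))
      (by fun_prop) fun ξ _ => ⟨hτ, trivial⟩)
  have hm2τ : ∀ ξ, ContinuousOn (fun τ => m2 τ ξ) (Icc s t) :=
    fun ξ => hm2p.comp (f := fun τ : ℝ => (τ, ξ)) (by fun_prop) fun τ hτ => ⟨hτ, trivial⟩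
  have hm2b : ∀ τ ∈ Icc s t, ∀ ξ, ‖m2 τ ξ‖ ≤ (W * C2) * jap (wave ξ) := by
    intro τ hτ ξ
    simp only [m2]
    rw [norm_mul, norm_mul, Complex.norm_I, one_mul, Complex.norm_real, Real.norm_eq_abs]
    have h1 := abs_real_inner_le_norm (wave ξ) (w τ)
    have h2 : |⟪wave ξ, w τ⟫| ≤ jap (wave ξ) * W :=
      h1.trans (mul_le_mul (norm_le_jap _) (hW τ hτ) (norm_nonneg _) (jap_pos _).le)
    calc |⟪wave ξ, w τ⟫| * ‖phase σ (j + 2) (x τ) (v τ) τ ξ‖ ≤ (jap (wave ξ) * W) * C2 :=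
          mul_le_mul h2 (hC2' τ hτ ξ) (norm_nonneg _) (mul_nonneg (jap_pos _).le hW0)
      _ = _ := by ring
  have hm0b : ∀ τ ∈ Icc s t, ∀ ξ, ‖phase σ j (x τ) (v τ) τ ξ‖ ≤ C0 * jap (wave ξ) :=
    fun τ hτ ξ => (hC0' τ hτ ξ).trans (le_mul_of_one_le_right hC0 (one_le_jap _))
  have hm1b : ∀ τ ∈ Icc s t, ∀ ξ, ‖phase σ (j + 1) (x τ) (v τ) τ ξ‖ ≤ C1 * jap (wave ξ) :=
    fun τ hτ ξ => (hC1' τ hτ ξ).trans (le_mul_of_one_le_right hC1 (one_le_jap _))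
  have hA := h.continuousOn_integral hs ht (hphξ j) (hphτ j) hm0b
  have hB := h.continuousOn_integral hs ht hm2ξ hm2τ hm2b
  -- joint integrability in time and frequency
  set μ := (volume.restrict (Icc s t) : Measure ℝ)
  have hprod : ∀ {f : ℝ × R3 → ℂ}, ContinuousOn f (Icc s t ×ˢ univ) →
      AEStronglyMeasurable f (μ.prod volume) := by
    intro f hf
    have h1 : μ.prod (volume : Measure R3) =
        ((volume : Measure ℝ).prod volume).restrict (Icc s t ×ˢ univ) := by
      rw [← Measure.prod_restrict, Measure.restrict_univ]
    rw [h1]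
    exact hf.aestronglyMeasurable (measurableSet_Icc.prod MeasurableSet.univ)
  have hmem : ∀ᵐ p : ℝ × R3 ∂(μ.prod volume), p.1 ∈ Icc s t :=
    Measure.quasiMeasurePreserving_fst.ae (ae_restrict_mem measurableSet_Icc)
  have hβm := h.aestronglyMeasurable_uncurry hs ht
  have hGi : Integrable (fun p : ℝ × R3 => jap (wave p.2) * G p.2) (μ.prod volume) :=
    h.integrable_dom.comp_snd μ
  have hIβ : ∀ {m : ℝ → R3 → ℂ} {C : ℝ}, ContinuousOn (fun p : ℝ × R3 => m p.1 p.2)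
      (Icc s t ×ˢ univ) → (∀ τ ∈ Icc s t, ∀ ξ, ‖m τ ξ‖ ≤ C * jap (wave ξ)) →
      Integrable (fun p : ℝ × R3 => m p.1 p.2 • β p.1 p.2) (μ.prod volume) := by
    intro m C hm hmb
    refine (hGi.const_mul C).mono' ((hprod hm).smul hβm) ?_
    filter_upwards [hmem] with p hp
    rw [norm_smul, ← mul_assoc]
    exact mul_le_mul (hmb _ hp _) (h.norm_le _ (hsub hp) _) (norm_nonneg _)
      ((norm_nonneg _).trans (hmb _ hp _))
  have hI0 := hIβ (hphc j) hm0b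
  have hI2 := hIβ hm2p hm2b
  have hbi : Integrable (Function.uncurry b) (μ.prod volume) :=
    h.integrable.mono_measure (Measure.prod_mono (Measure.restrict_mono hsub le_rfl) le_rfl)
  have hI1 : Integrable (fun p : ℝ × R3 => phase σ (j + 1) (x p.1) (v p.1) p.1 p.2 • b p.1 p.2)
      (μ.prod volume) := by
    refine hbi.bdd_smul C1 (hprod (hphc (j + 1))) ?_
    filter_upwards [hmem] with p hp
    exact hC1' _ hp _
  have hset : ∀ f : ℝ → C3, ∫ τ in s..t, f τ = ∫ τ, f τ ∂μ := fun f => by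
    rw [intervalIntegral.integral_of_le hst, ← integral_Icc_eq_integral_Ioc]
  have hbint : IntervalIntegrable (fun τ => ∫ ξ, phase σ (j + 1) (x τ) (v τ) τ ξ • b τ ξ)
      volume s t := by
    rw [intervalIntegrable_iff_integrableOn_Icc_of_le hst]
    exact hI1.integral_prod_left
  refine ⟨hA, hB, hbint, ?_⟩
  set H : ℝ → R3 → C3 := fun τ ξ => (phase σ j (x τ) (v τ) τ ξ - (j + 1 : ℂ) * m2 τ ξ) • β τ ξ +
    phase σ (j + 1) (x τ) (v τ) τ ξ • b τ ξ
  have hHi : Integrable (Function.uncurry H) (μ.prod volume) := by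
    have := (hI0.sub (hI2.smul (j + 1 : ℂ))).add hI1
    refine this.congr (Filter.Eventually.of_forall fun p => ?_)
    simp only [Pi.add_apply, Pi.sub_apply, Pi.smul_apply, Function.uncurry, H, sub_smul, mul_smul]
  -- the product rule at each frequency
  have hpt : ∀ ξ, phase σ (j + 1) (x t) (v t) t ξ • β t ξ -
      phase σ (j + 1) (x s) (v s) s ξ • β s ξ = ∫ τ, H τ ξ ∂μ := by
    intro ξ
    obtain ⟨K, hK⟩ := h.bounded ξ
    rw [← hset]
    refine smul_sub_smul_eq_integral hst
      (P := fun τ => phase σ (j + 1) (x τ) (v τ) τ ξ) (β := fun τ => β τ ξ)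
      (b := fun τ => b τ ξ) (K := K)
      (fun τ hτ => hasDerivWithinAt_phase σ j ξ (hx τ hτ) (hv τ hτ))
      ((hphτ j ξ).sub (continuousOn_const.mul (hm2τ ξ))) (h.intervalIntegrable ξ s t)
      (fun τ _ => hK τ) fun τ hτ => ?_
    rw [h.eq_integral τ (hsub hτ), h.eq_integral s (hsub (left_mem_Icc.2 hst)), add_assoc,
      intervalIntegral.integral_add_adjacent_intervals (h.intervalIntegrable ξ 0 s)
        (h.intervalIntegrable ξ s τ)]
  have hfix : ∀ τ ∈ Icc s t, ∀ {m : R3 → ℂ} {C : ℝ}, Continuous m →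
      (∀ ξ, ‖m ξ‖ ≤ C * jap (wave ξ)) → Integrable fun ξ => m ξ • β τ ξ := by
    intro τ hτ m C hm hmb
    refine (h.integrable_dom.const_mul C).mono' (hm.aestronglyMeasurable.smul
      (h.stronglyMeasurable_apply (hsub hτ)).aestronglyMeasurable)
      (Filter.Eventually.of_forall fun ξ => ?_)
    rw [norm_smul, ← mul_assoc]
    exact mul_le_mul (hmb ξ) (h.norm_le τ (hsub hτ) ξ) (norm_nonneg _)
      ((norm_nonneg _).trans (hmb ξ))
  have htI := right_mem_Icc.2 hst
  have hsI := left_mem_Icc.2 hst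
  rw [← integral_sub (hfix t htI (hphξ _ t htI) (hm1b t htI))
    (hfix s hsI (hphξ _ s hsI) (hm1b s hsI)), hset]
  simp only [hpt]
  rw [← integral_integral_swap hHi]
  refine integral_congr_ae ?_
  filter_upwards [ae_restrict_mem measurableSet_Icc, hI1.prod_right_ae] with τ hτ h1
  have i0 := hfix τ hτ (hphξ j τ hτ) (hm0b τ hτ)
  have i2 := hfix τ hτ (hm2ξ τ hτ) (hm2b τ hτ)
  have i3 : Integrable (fun ξ => (j + 1 : ℂ) • m2 τ ξ • β τ ξ) := i2.smul (j + 1 : ℂ)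
  simp only [H, sub_smul, mul_smul (j + 1 : ℂ)]
  have i4 : Integrable (fun ξ => phase σ j (x τ) (v τ) τ ξ • β τ ξ -
      (j + 1 : ℂ) • m2 τ ξ • β τ ξ) := i0.sub i3
  rw [integral_add i4 h1, integral_sub i0 i3, integral_smul]

/-! ### Second-order expansions of `v ↦ v̂` and its inverse -/

lemma gradHat_apply (v h : R3) :
    gradHat v h = (jap v)⁻¹ • h - ((jap v)⁻¹ ^ 3 * ⟪v, h⟫) • v := by
  have hj := jap_pos v
  have h1 : HasFDerivAt (fun w : R3 => 1 + ‖w‖ ^ 2) (2 • (innerSL ℝ v)) v :=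
    (hasStrictFDerivAt_norm_sq v).hasFDerivAt.const_add 1
  have h2 : HasFDerivAt (jap : R3 → ℝ) _ v := h1.sqrt (by positivity)
  have h3 := (hasDerivAt_inv hj.ne').comp_hasFDerivAt v h2
  have h4 : HasFDerivAt hat _ v := h3.smul (hasFDerivAt_id v)
  rw [gradHat, h4.fderiv]
  have e : √(1 + ‖v‖ ^ 2) = jap v := rfl
  simp only [add_apply, smul_apply, ContinuousLinearMap.smulRight_apply, Function.comp, e,
    ContinuousLinearMap.id_apply, innerSL_apply_apply, smul_eq_mul, nsmul_eq_mul]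
  rw [sub_eq_add_neg, ← neg_smul]
  congr 2
  push_cast
  field_simp

lemma one_sub_norm_hat_sq (v : R3) : 1 - ‖hat v‖ ^ 2 = (jap v)⁻¹ ^ 2 := by
  have hj := jap_pos v
  have h2 := jap_sq v
  rw [norm_hat_eq, div_pow, inv_pow]
  field_simp
  linarith

lemma sqrt_one_sub_norm_hat_sq (v : R3) : √(1 - ‖hat v‖ ^ 2) = (jap v)⁻¹ := by
  rw [one_sub_norm_hat_sq, Real.sqrt_sq (inv_pos.2 (jap_pos v)).le]

lemma unhat_hat (v : R3) : unhat (hat v) = v := by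
  rw [unhat, sqrt_one_sub_norm_hat_sq, inv_inv, hat, smul_smul, mul_inv_cancel₀ (jap_pos v).ne',
    one_smul]

lemma gradUnhat_apply (v h : R3) :
    gradUnhat v h = jap v • h + (jap v ^ 3 * ⟪hat v, h⟫) • hat v := by
  have hj := jap_pos v
  have h1 : HasFDerivAt (fun w : R3 => 1 - ‖w‖ ^ 2) (-(2 • (innerSL ℝ (hat v)))) (hat v) :=
    (hasStrictFDerivAt_norm_sq (hat v)).hasFDerivAt.const_sub 1
  have hne : 1 - ‖hat v‖ ^ 2 ≠ 0 := by rw [one_sub_norm_hat_sq]; positivity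
  have h2 := h1.sqrt hne
  have hs := sqrt_one_sub_norm_hat_sq v
  have h3 := (hasDerivAt_inv (x := √(1 - ‖hat v‖ ^ 2))
    (by rw [hs]; positivity)).comp_hasFDerivAt (hat v) h2
  have h4 : HasFDerivAt unhat _ (hat v) := h3.smul (hasFDerivAt_id (hat v))
  rw [gradUnhat, h4.fderiv]
  simp only [add_apply, smul_apply, ContinuousLinearMap.smulRight_apply, Function.comp,
    ContinuousLinearMap.id_apply, innerSL_apply_apply, smul_eq_mul, nsmul_eq_mul, neg_apply, hs]
  rw [inv_inv]
  congr 2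
  push_cast
  field_simp

/-- The two Jacobians `∇_v v̂` and `∇_{v̂} v` are inverse to each other. -/
lemma gradUnhat_gradHat (v u : R3) : gradUnhat v (gradHat v u) = u := by
  have hj := jap_pos v
  have h2 := jap_sq v
  have hv : ‖v‖ ^ 2 = jap v ^ 2 - 1 := by linarith
  rw [gradUnhat_apply, gradHat_apply, hat]
  simp only [inner_smul_left, inner_sub_right, inner_smul_right, real_inner_self_eq_norm_sq, hv,
    RCLike.conj_to_real]
  rw [smul_sub, smul_smul, smul_smul, smul_smul, mul_inv_cancel₀ hj.ne', one_smul, sub_add,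
    ← sub_smul, sub_eq_self]
  convert zero_smul ℝ v
  field_simp
  ring

lemma norm_gradHat_le (v h : R3) : ‖gradHat v h‖ ≤ 2 * ‖h‖ := by
  have hj := jap_pos v
  have h1 : (jap v)⁻¹ ≤ 1 := inv_le_one_of_one_le₀ (one_le_jap v)
  have hv : ‖v‖ * (jap v)⁻¹ ≤ 1 := by
    rw [← div_eq_mul_inv, div_le_one hj]; exact norm_le_jap v
  rw [gradHat_apply]
  have a1 : ‖(jap v)⁻¹ • h‖ ≤ ‖h‖ := by
    rw [norm_smul, Real.norm_of_nonneg (by positivity)]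
    exact mul_le_of_le_one_left (norm_nonneg _) h1
  have a2 : ‖((jap v)⁻¹ ^ 3 * ⟪v, h⟫) • v‖ ≤ ‖h‖ := by
    rw [norm_smul, norm_mul, Real.norm_of_nonneg (by positivity), Real.norm_eq_abs]
    calc (jap v)⁻¹ ^ 3 * |⟪v, h⟫| * ‖v‖ ≤ (jap v)⁻¹ ^ 3 * (‖v‖ * ‖h‖) * ‖v‖ := by
          gcongr; exact abs_real_inner_le_norm v h
      _ = (jap v)⁻¹ * (‖v‖ * (jap v)⁻¹) ^ 2 * ‖h‖ := by ring
      _ ≤ 1 * 1 ^ 2 * ‖h‖ := by gcongr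
      _ = ‖h‖ := by ring
  linarith [norm_sub_le ((jap v)⁻¹ • h) (((jap v)⁻¹ ^ 3 * ⟪v, h⟫) • v)]

lemma norm_gradUnhat_le (v h : R3) : ‖gradUnhat v h‖ ≤ 2 * jap v ^ 3 * ‖h‖ := by
  have hj := jap_pos v
  rw [gradUnhat_apply]
  have h1 := (norm_hat_lt_one v).le
  have a1 : ‖jap v • h‖ ≤ jap v ^ 3 * ‖h‖ := by
    rw [norm_smul, Real.norm_of_nonneg hj.le]
    gcongr
    exact le_self_pow₀ (one_le_jap v) (by norm_num)
  have a2 : ‖(jap v ^ 3 * ⟪hat v, h⟫) • hat v‖ ≤ jap v ^ 3 * ‖h‖ := by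
    rw [norm_smul, norm_mul, Real.norm_of_nonneg (by positivity), Real.norm_eq_abs]
    calc jap v ^ 3 * |⟪hat v, h⟫| * ‖hat v‖ ≤ jap v ^ 3 * (‖hat v‖ * ‖h‖) * ‖hat v‖ := by
          gcongr; exact abs_real_inner_le_norm _ h
      _ ≤ jap v ^ 3 * (1 * ‖h‖) * 1 := by gcongr
      _ = _ := by ring
  linarith [norm_add_le (jap v • h) ((jap v ^ 3 * ⟪hat v, h⟫) • hat v)]

lemma abs_jap_sub_jap_le (v w : R3) : |jap w - jap v| ≤ ‖w - v‖ := by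
  have hv := jap_pos v
  have hw := jap_pos w
  have h1 : (jap w - jap v) * (jap w + jap v) = (‖w‖ - ‖v‖) * (‖w‖ + ‖v‖) := by
    have := jap_sq v; have := jap_sq w; linarith
  have h2 : |jap w - jap v| * (jap w + jap v) = |‖w‖ - ‖v‖| * (‖w‖ + ‖v‖) := by
    rw [← abs_of_pos (show 0 < jap w + jap v by positivity), ← abs_mul, h1, abs_mul,
      abs_of_nonneg (show 0 ≤ ‖w‖ + ‖v‖ by positivity)]
  have h3 := abs_norm_sub_norm_le w v
  have h4 : ‖w‖ + ‖v‖ ≤ jap w + jap v := add_le_add (norm_le_jap w) (norm_le_jap v)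
  have h5 : |jap w - jap v| * (jap w + jap v) ≤ ‖w - v‖ * (jap w + jap v) := by
    rw [h2]; gcongr
  exact le_of_mul_le_mul_right h5 (by positivity)

/-- The second-order remainder of `v ↦ v̂` is `O(⟨v⟩^{-2})`, uniformly in `v`. -/
lemma norm_hat_taylor_le (v w : R3) (hvw : ‖w - v‖ ≤ 1) :
    ‖hat w - hat v - gradHat v (w - v)‖ ≤ 9 * jap v ^ (-2 : ℝ) * ‖w - v‖ ^ 2 := by
  obtain ⟨h, rfl⟩ : ∃ h, w = v + h := ⟨w - v, by abel⟩
  rw [add_sub_cancel_left] at hvw ⊢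
  have hab := abs_jap_sub_jap_le v (v + h)
  rw [add_sub_cancel_left] at hab
  have ha := jap_pos v
  have hb := jap_pos (v + h)
  have ha1 := one_le_jap v
  have hb1 := one_le_jap (v + h)
  have hwb := norm_le_jap (v + h)
  have hva := norm_le_jap v
  have hsq : jap (v + h) ^ 2 - jap v ^ 2 = 2 * ⟪v, h⟫ + ‖h‖ ^ 2 := by
    rw [jap_sq, jap_sq, norm_add_sq_real]; ring
  have hin := abs_real_inner_le_norm v h
  rw [hat, hat, gradHat_apply]
  set a := jap v
  set b := jap (v + h)
  set i : ℝ := ⟪v, h⟫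
  have hba : a ≤ 2 * b := by
    have := (abs_le.1 hab).1; linarith
  -- expand with `b - a = (2 v · h + |h|²) / (a + b)`; each term is quadratic in `h`
  have e : b⁻¹ • (v + h) - a⁻¹ • v - (a⁻¹ • h - (a⁻¹ ^ 3 * i) • v) =
      -(‖h‖ ^ 2 / (a * b * (a + b))) • (v + h) - (2 * i / (a * b * (a + b))) • h +
        (i * ((b - a) * (b + 2 * a) / (a ^ 3 * b * (a + b)))) • v := by
    have e1 : b⁻¹ = a⁻¹ - (2 * i + ‖h‖ ^ 2) / (a * b * (a + b)) := by
      rw [← hsq]; field_simp; ring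
    have e2 : (b - a) * (b + 2 * a) / (a ^ 3 * b * (a + b)) =
        a⁻¹ ^ 3 - 2 / (a * b * (a + b)) := by field_simp; ring
    rw [e1, e2, add_div]
    module
  rw [e]
  have hr : a ^ (-2 : ℝ) = (a ^ 2)⁻¹ := by
    rw [Real.rpow_neg ha.le]; norm_cast
  rw [hr]
  have t1 : ‖-(‖h‖ ^ 2 / (a * b * (a + b))) • (v + h)‖ ≤ 1 * (a ^ 2)⁻¹ * ‖h‖ ^ 2 := by
    rw [norm_smul, norm_neg, Real.norm_of_nonneg (by positivity)]
    calc ‖h‖ ^ 2 / (a * b * (a + b)) * ‖v + h‖ ≤ ‖h‖ ^ 2 / (a * b * (a + b)) * b := by gcongr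
      _ = ‖h‖ ^ 2 / (a * (a + b)) := by field_simp
      _ ≤ ‖h‖ ^ 2 / (a * a) := by gcongr; linarith
      _ = _ := by ring
  have hkey : 1 / (a * b) ≤ 2 / (a * a) := by
    rw [div_le_div_iff₀ (by positivity) (by positivity)]
    nlinarith
  have t2 : ‖(2 * i / (a * b * (a + b))) • h‖ ≤ 4 * (a ^ 2)⁻¹ * ‖h‖ ^ 2 := by
    rw [norm_smul, norm_div, norm_mul, Real.norm_eq_abs i, Real.norm_ofNat,
      Real.norm_of_nonneg (show 0 ≤ a * b * (a + b) by positivity)]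
    calc 2 * |i| / (a * b * (a + b)) * ‖h‖ ≤ 2 * (a * ‖h‖) / (a * b * (a + b)) * ‖h‖ := by
          gcongr; exact hin.trans (by gcongr)
      _ = 2 * (a / (a + b)) * (1 / (a * b)) * ‖h‖ ^ 2 := by field_simp
      _ ≤ 2 * 1 * (2 / (a * a)) * ‖h‖ ^ 2 := by
          gcongr; rw [div_le_one (by positivity)]; linarith
      _ = _ := by ring
  have t3 : ‖(i * ((b - a) * (b + 2 * a) / (a ^ 3 * b * (a + b)))) • v‖ ≤
      4 * (a ^ 2)⁻¹ * ‖h‖ ^ 2 := by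
    rw [norm_smul, norm_mul, norm_div, norm_mul, Real.norm_eq_abs i, Real.norm_eq_abs (b - a),
      Real.norm_of_nonneg (show 0 ≤ b + 2 * a by positivity),
      Real.norm_of_nonneg (show 0 ≤ a ^ 3 * b * (a + b) by positivity)]
    calc |i| * (|b - a| * (b + 2 * a) / (a ^ 3 * b * (a + b))) * ‖v‖
        ≤ (a * ‖h‖) * (‖h‖ * (2 * (a + b)) / (a ^ 3 * b * (a + b))) * a := by
          gcongr
          · exact hin.trans (by gcongr)
          · linarith
      _ = 2 * (1 / (a * b)) * ‖h‖ ^ 2 := by field_simp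
      _ ≤ 2 * (2 / (a * a)) * ‖h‖ ^ 2 := by gcongr
      _ = _ := by ring
  refine (norm_add_le_of_le (norm_sub_le_of_le t1 t2) t3).trans (le_of_eq ?_)
  ring

/-- The second-order remainder of `v̂ ↦ v` on the part of the unit ball where the Lorentz factor is
comparable to `⟨v⟩`. -/
lemma norm_unhat_taylor_le (v p : R3) (hp : (3 * jap v ^ 2)⁻¹ ≤ 1 - ‖p‖ ^ 2) :
    ‖unhat p - v - gradUnhat v (p - hat v)‖ ≤ 21 * jap v ^ (5 : ℝ) * ‖p - hat v‖ ^ 2 := by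
  have ha := jap_pos v
  have ha1 := one_le_jap v
  have hq := (norm_hat_lt_one v).le
  have hqa := one_sub_norm_hat_sq v
  conv_lhs => rw [← unhat_hat v]
  rw [unhat_hat v, gradUnhat_apply]
  obtain ⟨h, rfl⟩ : ∃ h, p = hat v + h := ⟨p - hat v, by abel⟩
  rw [add_sub_cancel_left]
  have hv : v = jap v • hat v := by
    rw [hat, smul_smul, mul_inv_cancel₀ ha.ne', one_smul]
  have hr : jap v ^ (5 : ℝ) = jap v ^ 5 := by norm_cast
  rw [hr]
  have hpos : 0 < 1 - ‖hat v + h‖ ^ 2 := lt_of_lt_of_le (by positivity) hp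
  have hp1 : ‖hat v + h‖ ≤ 1 := by
    nlinarith [norm_nonneg (hat v + h)]
  rw [unhat]
  set c := (√(1 - ‖hat v + h‖ ^ 2))⁻¹
  have hsq0 := Real.sqrt_pos.2 hpos
  have hc : 0 < c := inv_pos.2 hsq0
  have hc2 : c⁻¹ ^ 2 = 1 - ‖hat v + h‖ ^ 2 := by
    simp only [c, inv_inv]; exact Real.sq_sqrt hpos.le
  have hin := abs_real_inner_le_norm (hat v) h
  have hd : (jap v)⁻¹ ^ 2 - c⁻¹ ^ 2 = 2 * ⟪hat v, h⟫ + ‖h‖ ^ 2 := by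
    rw [hc2, ← hqa, norm_add_sq_real]; ring
  have hdle : |2 * ⟪hat v, h⟫ + ‖h‖ ^ 2| ≤ 2 * ‖h‖ := by
    have e1 : 2 * ⟪hat v, h⟫ + ‖h‖ ^ 2 = (‖hat v + h‖ - ‖hat v‖) * (‖hat v + h‖ + ‖hat v‖) := by
      have := norm_add_sq_real (hat v) h
      linarith
    have e2 := abs_norm_sub_norm_le (hat v + h) (hat v)
    rw [add_sub_cancel_left] at e2
    rw [e1, abs_mul, abs_of_nonneg (show 0 ≤ ‖hat v + h‖ + ‖hat v‖ by positivity)]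
    nlinarith [norm_nonneg h, abs_nonneg (‖hat v + h‖ - ‖hat v‖), norm_nonneg (hat v),
      norm_nonneg (hat v + h)]
  have hca : c ^ 2 ≤ 3 * jap v ^ 2 := by
    rw [← hc2, inv_pow] at hp
    exact (inv_le_inv₀ (by positivity) (by positivity)).1 hp
  have hin' : |⟪hat v, h⟫| ≤ ‖h‖ :=
    hin.trans (mul_le_of_le_one_left (norm_nonneg _) hq)
  rw [show c • (hat v + h) - v = c • (hat v + h) - jap v • hat v by rw [← hv]]
  set a := jap v
  set i : ℝ := ⟪hat v, h⟫
  -- `c` is the Lorentz factor at `v̂ + h` and `a` the one at `v̂`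
  have e1 : c - a = a ^ 2 * c ^ 2 * (2 * i + ‖h‖ ^ 2) / (a + c) := by
    rw [← hd]; field_simp; ring
  have e : c • (hat v + h) - a • hat v - (a • h + (a ^ 3 * i) • hat v) =
      (a ^ 2 * c ^ 2 / (a + c) * ‖h‖ ^ 2) • (hat v + h) + (2 * (a ^ 2 * c ^ 2 / (a + c)) * i) • h +
        (i * (a ^ 2 * (c - a) * (2 * c + a) / (a + c))) • hat v := by
    have e2 : a ^ 2 * (c - a) * (2 * c + a) / (a + c) = 2 * (a ^ 2 * c ^ 2 / (a + c)) - a ^ 3 := by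
      field_simp; ring
    have e3 : c = a + a ^ 2 * c ^ 2 / (a + c) * (2 * i + ‖h‖ ^ 2) := by
      rw [← sub_eq_iff_eq_add', e1]; ring
    rw [e2]
    generalize a ^ 2 * c ^ 2 / (a + c) = k at e3 ⊢
    rw [e3]
    module
  rw [e]
  have hA : a ^ 2 * c ^ 2 / (a + c) ≤ 3 * a ^ 3 := by
    rw [div_le_iff₀ (by positivity)]
    nlinarith [mul_le_mul_of_nonneg_left hca (sq_nonneg a), pow_pos ha 3, mul_pos (pow_pos ha 3) hc]
  have h35 : a ^ 3 ≤ a ^ 5 := pow_le_pow_right₀ ha1 (by norm_num)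
  have hcd : |c - a| ≤ 3 * a ^ 3 * (2 * ‖h‖) := by
    have : c - a = a ^ 2 * c ^ 2 / (a + c) * (2 * i + ‖h‖ ^ 2) := by rw [e1]; ring
    rw [this, abs_mul, abs_of_nonneg (show 0 ≤ a ^ 2 * c ^ 2 / (a + c) by positivity)]
    gcongr
  have t1 : ‖(a ^ 2 * c ^ 2 / (a + c) * ‖h‖ ^ 2) • (hat v + h)‖ ≤ 3 * a ^ 5 * ‖h‖ ^ 2 := by
    rw [norm_smul, Real.norm_of_nonneg (by positivity)]
    calc a ^ 2 * c ^ 2 / (a + c) * ‖h‖ ^ 2 * ‖hat v + h‖ ≤ 3 * a ^ 3 * ‖h‖ ^ 2 * 1 := by gcongr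
      _ ≤ 3 * a ^ 5 * ‖h‖ ^ 2 := by rw [mul_one]; gcongr
  have t2 : ‖(2 * (a ^ 2 * c ^ 2 / (a + c)) * i) • h‖ ≤ 6 * a ^ 5 * ‖h‖ ^ 2 := by
    rw [norm_smul, norm_mul, Real.norm_of_nonneg (by positivity), Real.norm_eq_abs]
    calc 2 * (a ^ 2 * c ^ 2 / (a + c)) * |i| * ‖h‖ ≤ 2 * (3 * a ^ 5) * ‖h‖ * ‖h‖ := by
          gcongr; exact hA.trans (by gcongr)
      _ = _ := by ring
  have t3 : ‖(i * (a ^ 2 * (c - a) * (2 * c + a) / (a + c))) • hat v‖ ≤ 12 * a ^ 5 * ‖h‖ ^ 2 := by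
    rw [norm_smul, norm_mul, norm_div, norm_mul, norm_mul, Real.norm_eq_abs i,
      Real.norm_eq_abs (c - a), Real.norm_of_nonneg (show 0 ≤ a ^ 2 by positivity),
      Real.norm_of_nonneg (show 0 ≤ 2 * c + a by positivity),
      Real.norm_of_nonneg (show 0 ≤ a + c by positivity)]
    calc |i| * (a ^ 2 * |c - a| * (2 * c + a) / (a + c)) * ‖hat v‖
        ≤ ‖h‖ * (a ^ 2 * (3 * a ^ 3 * (2 * ‖h‖)) * (2 * (a + c)) / (a + c)) * 1 := by
          gcongr; linarith
      _ = _ := by field_simp; ring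
  refine (norm_add_le_of_le (norm_add_le_of_le t1 t2) t3).trans (le_of_eq ?_)
  ring

/-- If `|w - v| ≤ 1`, the Lorentz factors at `w` and `v` are comparable. -/
lemma le_one_sub_norm_hat_sq {v w : R3} (h : ‖w - v‖ ≤ 1) :
    (3 * jap v ^ 2)⁻¹ ≤ 1 - ‖hat w‖ ^ 2 := by
  have hv := jap_pos v
  have hw := jap_pos w
  rw [one_sub_norm_hat_sq, inv_pow]
  apply inv_anti₀ (by positivity)
  have h1 : ‖w‖ ≤ ‖v‖ + 1 := by
    have := norm_sub_norm_le w v; linarith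
  rw [jap_sq, jap_sq]
  nlinarith [norm_nonneg w, norm_nonneg v, sq_nonneg (‖v‖ - 1 / 2)]

/-! ### The profile of the oscillatory field under the bootstrap assumptions -/

lemma norm_cvec (w : R3) : ‖cvec w‖ = ‖w‖ := by
  simp [EuclideanSpace.norm_eq, cvec]

lemma continuous_cvec_wave : Continuous fun ξ : R3 => Complex.I • cvec (wave ξ) := by
  unfold cvec wave
  fun_prop

lemma norm_amp_le_one (σ : ℤˣ) (k : R3) : ‖amp σ k‖ ≤ 1 := by
  have h := norm_inv_omegaSym_pow_le σ 1 0 k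
  rw [pow_one, pow_one, jap_zero] at h
  rw [amp_eq, norm_mul]
  have : ‖(2⁻¹ : ℂ)‖ = 2⁻¹ := by norm_num
  rw [this]
  linarith

lemma continuous_amp_wave (σ : ℤˣ) : Continuous fun ξ : R3 => amp σ (wave ξ) := by
  have h := (continuous_omegaSym σ).comp (f := fun ξ : R3 => ((0 : R3), ξ)) (by fun_prop)
  simp only [amp_eq]
  exact continuous_const.mul (h.inv₀ fun ξ => omegaSym_ne_zero _ _ _)

lemma norm_Fhat_le (D : FieldData) (σ : ℤˣ) (t : ℝ) (ξ : R3) :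
    ‖D.Fhat σ t ξ‖ ≤ jap (wave ξ) * ‖𝓕 (D.S σ t) ξ‖ := by
  rw [FieldData.Fhat, norm_smul, norm_smul, Complex.norm_I, one_mul, norm_cvec, mul_comm]
  gcongr
  exact norm_le_jap _

/-- The time derivative of the profile `B̂_±`, extended by zero outside `[0,T]`. -/
noncomputable def profileSource (D : FieldData) (T : ℝ) (σ : ℤˣ) (r : ℝ) (ξ : R3) : C3 :=
  (Icc 0 T).indicator (fun r : ℝ =>
    (Complex.exp (-(lam σ (wave ξ)) * (r : ℂ)) * amp σ (wave ξ)) • D.Fhat σ r ξ) r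

lemma norm_profileSource_le (D : FieldData) (T : ℝ) (σ : ℤˣ) (r : ℝ) (ξ : R3) :
    ‖profileSource D T σ r ξ‖ ≤
      (Icc 0 T).indicator (fun r => jap (wave ξ) * ‖𝓕 (D.S σ r) ξ‖) r := by
  by_cases hr : r ∈ Icc 0 T
  · rw [profileSource, indicator_of_mem hr, indicator_of_mem hr, norm_smul, norm_mul]
    have h1 : ‖Complex.exp (-(lam σ (wave ξ)) * (r : ℂ))‖ = 1 := by
      have := norm_exp_lam σ (wave ξ) (-r)
      rw [← this]; congr 2; push_cast; ring
    rw [h1, one_mul]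
    exact (mul_le_of_le_one_left (norm_nonneg _) (norm_amp_le_one _ _)).trans
      (norm_Fhat_le D σ r ξ)
  · rw [profileSource, indicator_of_notMem hr, indicator_of_notMem hr, norm_zero]

/-- The dominating function of the profile `B̂_±` on `[0,T]`. -/
noncomputable def profileBound (D : FieldData) (T : ℝ) (σ : ℤˣ) (ξ : R3) : ℝ :=
  ‖amp σ (wave ξ) • D.F0hat σ ξ‖ + ∫ r in Icc 0 T, ‖profileSource D T σ r ξ‖

namespace Bootstrap

variable {α₀ : ℕ} {ε T : ℝ} {D : FieldData}

lemma continuous_S (h : Bootstrap α₀ ε T D) (σ : ℤˣ) {t : ℝ} (ht : t ∈ Icc 0 T) :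
    Continuous (D.S σ t) :=
  continuousOn_univ.1 ((h.S_cont σ).comp (f := fun x : R3 => (t, x)) (by fun_prop)
    fun _ _ => ⟨ht, trivial⟩)

lemma integrable_S (h : Bootstrap α₀ ε T D) (hε : 0 ≤ ε) (σ : ℤˣ) {t : ℝ} (ht : t ∈ Icc 0 T) :
    Integrable (D.S σ t) ∧ ∫ x, ‖D.S σ t x‖ ≤ ε := by
  have h1 := (h.S_decay σ t ht 1 le_rfl 0 zero_le_one).memLp_zero
  have h2 : Integrable (D.S σ t) :=
    memLp_one_iff_integrable.1 ⟨h1.1, h1.2.trans_lt ENNReal.ofReal_lt_top⟩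
  refine ⟨h2, ?_⟩
  have h3 := h1.2
  rw [eLpNorm_one_eq_lintegral_enorm] at h3
  simp only [inv_one, ENNReal.toReal_one, sub_self, mul_zero, Real.rpow_zero, mul_one] at h3
  rw [integral_norm_eq_lintegral_enorm h1.1]
  exact ENNReal.toReal_le_of_le_ofReal hε h3

lemma norm_fourier_S_le (h : Bootstrap α₀ ε T D) (hε : 0 ≤ ε) (σ : ℤˣ) {t : ℝ} (ht : t ∈ Icc 0 T)
    (ξ : R3) : ‖𝓕 (D.S σ t) ξ‖ ≤ ε :=
  (VectorFourier.norm_fourierIntegral_le_integral_norm _ _ _ _ _).trans (h.integrable_S hε σ ht).2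

lemma continuous_fourier_S (h : Bootstrap α₀ ε T D) (hε : 0 ≤ ε) (σ : ℤˣ) {t : ℝ}
    (ht : t ∈ Icc 0 T) : Continuous (𝓕 (D.S σ t)) :=
  VectorFourier.fourierIntegral_continuous Real.continuous_fourierChar continuous_inner
    (h.integrable_S hε σ ht).1

lemma delta_nonneg (hα : 8 ≤ α₀) : 0 ≤ delta α₀ 1 := by
  have : (8 : ℝ) ≤ α₀ := by exact_mod_cast hα
  exact div_nonneg (by norm_num) (by linarith)

lemma exists_integral_weight_S_le (h : Bootstrap α₀ ε T D) (hα : 8 ≤ α₀) (hε : 0 ≤ ε) (σ : ℤˣ) :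
    ∃ c, ∀ t ∈ Icc 0 T, Integrable (fun ξ => jap (wave ξ) ^ 3 * ‖𝓕 (D.S σ t) ξ‖) ∧
      ∫ ξ, jap (wave ξ) ^ 3 * ‖𝓕 (D.S σ t) ξ‖ ≤ c := by
  refine ⟨_, fun t ht => integrable_weight_of_sobolevNorm
    (h.continuous_fourier_S hε σ ht).aestronglyMeasurable (m := α₀) (by omega)
    (c := ε * jap T ^ delta α₀ 1) (mul_nonneg hε (Real.rpow_nonneg (jap_pos T).le _)) ?_⟩
  refine (h.S_sobolev σ t ht).trans (ENNReal.ofReal_le_ofReal ?_)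
  have hj := jap_pos t
  have hle : jap t ≤ jap T := jap_mono (by
    rw [Real.norm_of_nonneg ht.1, Real.norm_of_nonneg (ht.1.trans ht.2)]; exact ht.2)
  gcongr
  exact delta_nonneg hα

lemma stronglyMeasurable_profileSource (h : Bootstrap α₀ ε T D) (σ : ℤˣ) :
    StronglyMeasurable (Function.uncurry (profileSource D T σ)) := by
  set S' : ℝ × R3 → ℂ := (Icc 0 T ×ˢ univ).indicator fun q => D.S σ q.1 q.2
  have hS : StronglyMeasurable S' := by
    have := (h.S_cont σ).measurable_piecewise (g := fun _ => (0 : ℂ)) continuousOn_const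
      (measurableSet_Icc.prod MeasurableSet.univ)
    have h0 : (Icc 0 T ×ˢ univ).piecewise (fun q : ℝ × R3 => D.S σ q.1 q.2) (fun _ => (0 : ℂ)) =
        S' := piecewise_eq_indicator
    rw [h0] at this
    exact this.stronglyMeasurable
  have hF : StronglyMeasurable fun p : ℝ × R3 =>
      ∫ x, Real.fourierChar (-⟪x, p.2⟫) • S' (p.1, x) := by
    refine StronglyMeasurable.integral_prod_right' (f := fun q : (ℝ × R3) × R3 =>
      Real.fourierChar (-⟪q.2, q.1.2⟫) • S' (q.1.1, q.2)) ?_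
    have h1 : Continuous fun q : (ℝ × R3) × R3 => (Real.fourierChar (-⟪q.2, q.1.2⟫) : Circle) :=
      Real.continuous_fourierChar.comp (by fun_prop)
    exact h1.stronglyMeasurable.smul (hS.comp_measurable (by fun_prop))
  have hc : Continuous fun p : ℝ × R3 =>
      Complex.exp (-(lam σ (wave p.2)) * (p.1 : ℂ)) * amp σ (wave p.2) :=
    (Complex.continuous_exp.comp ((((continuous_lam σ).comp continuous_snd).neg).mul
      (Complex.continuous_ofReal.comp continuous_fst))).mul
        ((continuous_amp_wave σ).comp continuous_snd)
  have hv : Continuous fun p : ℝ × R3 => Complex.I • cvec (wave p.2) :=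
    continuous_cvec_wave.comp continuous_snd
  have hall := hc.stronglyMeasurable.smul (hF.smul hv.stronglyMeasurable)
  convert! hall using 1
  ext1 p
  by_cases hp : p.1 ∈ Icc 0 T
  · have e : ∀ x, S' (p.1, x) = D.S σ p.1 x := fun x =>
      indicator_of_mem (show ((p.1, x) : ℝ × R3) ∈ Icc 0 T ×ˢ univ from ⟨hp, trivial⟩) _
    simp only [Function.uncurry, profileSource, indicator_of_mem hp, FieldData.Fhat, e,
      Real.fourier_eq, Pi.smul_apply']
  · have e : ∀ x, S' (p.1, x) = 0 := fun x => indicator_of_notMem (fun hx => hp hx.1) _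
    simp [Function.uncurry, profileSource, indicator_of_notMem hp, e]

lemma integrable_weight_profileSource (h : Bootstrap α₀ ε T D) (hα : 8 ≤ α₀) (hε : 0 ≤ ε)
    (σ : ℤˣ) : Integrable (fun p : ℝ × R3 => jap (wave p.2) • profileSource D T σ p.1 p.2)
      ((volume.restrict (Icc 0 T)).prod volume) := by
  obtain ⟨c, hc⟩ := h.exists_integral_weight_S_le hα hε σ
  have hjc : Continuous fun ξ : R3 => jap (wave ξ) := continuous_jap.comp contDiff_wave.continuous
  have hm : StronglyMeasurable fun p : ℝ × R3 => jap (wave p.2) • profileSource D T σ p.1 p.2 :=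
    (hjc.comp continuous_snd).stronglyMeasurable.smul (h.stronglyMeasurable_profileSource σ)
  have hpt : ∀ r ∈ Icc 0 T, ∀ ξ, ‖jap (wave ξ) • profileSource D T σ r ξ‖ ≤
      jap (wave ξ) ^ 3 * ‖𝓕 (D.S σ r) ξ‖ := by
    intro r hr ξ
    have h1 := norm_profileSource_le D T σ r ξ
    rw [indicator_of_mem hr] at h1
    have hj := jap_pos (wave ξ)
    rw [norm_smul, Real.norm_of_nonneg hj.le]
    calc jap (wave ξ) * ‖profileSource D T σ r ξ‖
        ≤ jap (wave ξ) * (jap (wave ξ) * ‖𝓕 (D.S σ r) ξ‖) := by gcongr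
      _ = jap (wave ξ) ^ 2 * ‖𝓕 (D.S σ r) ξ‖ := by ring
      _ ≤ _ := by
        gcongr
        · exact one_le_jap _
        · norm_num
  have hfib : ∀ r ∈ Icc 0 T, Integrable fun ξ => jap (wave ξ) • profileSource D T σ r ξ :=
    fun r hr => (hc r hr).1.mono' (hm.comp_measurable measurable_prodMk_left).aestronglyMeasurable
      (Filter.Eventually.of_forall (hpt r hr))
  rw [integrable_prod_iff hm.aestronglyMeasurable]
  have hae := ae_restrict_mem (μ := (volume : Measure ℝ))
    (measurableSet_Icc (a := (0 : ℝ)) (b := T))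
  refine ⟨by filter_upwards [hae] with r hr using hfib r hr, ?_⟩
  refine Measure.integrableOn_of_bounded (M := c) (by simp)
    (hm.norm.integral_prod_right').aestronglyMeasurable ?_
  filter_upwards [hae] with r hr
  rw [Real.norm_of_nonneg (integral_nonneg fun ξ => norm_nonneg _)]
  exact (integral_mono (hfib r hr).norm (hc r hr).1 (hpt r hr)).trans (hc r hr).2

lemma Bhat_zero (D : FieldData) (σ : ℤˣ) (ξ : R3) :
    D.Bhat σ 0 ξ = amp σ (wave ξ) • D.F0hat σ ξ := by
  rw [FieldData.Bhat, intervalIntegral.integral_same, add_zero]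

lemma stronglyMeasurable_Bhat_zero (D : FieldData) (σ : ℤˣ) : StronglyMeasurable (D.Bhat σ 0) := by
  have h1 : StronglyMeasurable (fun ξ => (𝓕 (D.S0 σ) : Lp ℂ 2 (volume : Measure R3)) ξ) :=
    Lp.stronglyMeasurable _
  have h2 := (continuous_amp_wave σ).stronglyMeasurable.smul
    (h1.smul continuous_cvec_wave.stronglyMeasurable)
  convert! h2 using 1
  ext1 ξ
  rw [Bhat_zero, FieldData.F0hat]
  rfl

/-- Under the bootstrap assumptions, `B̂_±` is a profile on `[0,T]`. -/
theorem isProfile (h : Bootstrap α₀ ε T D) (hα : 8 ≤ α₀) (hε : 0 ≤ ε) (hT : 0 ≤ T) (σ : ℤˣ) :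
    IsProfile T (D.Bhat σ) (profileSource D T σ) (profileBound D T σ) := by
  have hjc : Continuous fun ξ : R3 => jap (wave ξ) := continuous_jap.comp contDiff_wave.continuous
  have hm := h.stronglyMeasurable_profileSource σ
  have hw := h.integrable_weight_profileSource hα hε σ
  have hbd : ∀ ξ r, ‖profileSource D T σ r ξ‖ ≤ jap (wave ξ) * ε := by
    intro ξ r
    refine (norm_profileSource_le D T σ r ξ).trans ?_
    have hj := jap_pos (wave ξ)
    by_cases hr : r ∈ Icc 0 T
    · rw [indicator_of_mem hr]
      have := h.norm_fourier_S_le hε σ hr ξ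
      gcongr
    · rw [indicator_of_notMem hr]
      positivity
  have hmξ : ∀ ξ, AEStronglyMeasurable (fun r => profileSource D T σ r ξ) volume := fun ξ =>
    (hm.comp_measurable measurable_prodMk_right).aestronglyMeasurable
  have hiξ : ∀ ξ, IntegrableOn (fun r => profileSource D T σ r ξ) (Icc 0 T) := fun ξ =>
    Measure.integrableOn_of_bounded (M := jap (wave ξ) * ε) (by simp) (hmξ ξ)
      (Filter.Eventually.of_forall (hbd ξ))
  have heq : ∀ τ ∈ Icc 0 T, ∀ ξ,
      D.Bhat σ τ ξ = D.Bhat σ 0 ξ + ∫ r in (0 : ℝ)..τ, profileSource D T σ r ξ := by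
    intro τ hτ ξ
    rw [Bhat_zero, FieldData.Bhat]
    congr 1
    refine intervalIntegral.integral_congr fun r hr => ?_
    rw [uIcc_of_le hτ.1] at hr
    beta_reduce
    have hr' : r ∈ Icc 0 T := ⟨hr.1, hr.2.trans hτ.2⟩
    rw [profileSource, indicator_of_mem hr']
  refine ⟨heq, fun τ hτ ξ => ?_, ?_, hm, stronglyMeasurable_Bhat_zero D σ,
    fun ξ => ⟨_, hbd ξ⟩, ?_⟩
  · rw [heq τ hτ ξ, Bhat_zero, profileBound]
    refine (norm_add_le _ _).trans (add_le_add_right ?_ _)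
    rw [intervalIntegral.integral_of_le hτ.1]
    refine (norm_integral_le_integral_norm _).trans ?_
    exact setIntegral_mono_set (hiξ ξ).norm (Filter.Eventually.of_forall fun r => norm_nonneg _)
      (Filter.Eventually.of_forall (Ioc_subset_Icc_self.trans (Icc_subset_Icc le_rfl hτ.2)))
  · have h0 : Integrable fun ξ => jap (wave ξ) * ‖amp σ (wave ξ) • D.F0hat σ ξ‖ := by
      have e : D.EoscHat σ 0 = D.Bhat σ 0 := by
        ext1 ξ; simp [FieldData.EoscHat]
      have h1 := h.Eosc_sobolev σ 0 ⟨le_rfl, hT⟩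
      rw [e] at h1
      have h2 := (integrable_weight_of_sobolevNorm
        (stronglyMeasurable_Bhat_zero D σ).aestronglyMeasurable (by omega) hε h1).1
      refine h2.mono' ?_ (Filter.Eventually.of_forall fun ξ => ?_)
      · simp only [← Bhat_zero]
        exact hjc.aestronglyMeasurable.mul
          (stronglyMeasurable_Bhat_zero D σ).aestronglyMeasurable.norm
      · have hj := jap_pos (wave ξ)
        rw [Real.norm_of_nonneg (by positivity), ← Bhat_zero]
        gcongr
        exact le_self_pow₀ (one_le_jap _) (by norm_num)
    have h1 := hw.integral_norm_prod_right
    have e : ∀ ξ, jap (wave ξ) * profileBound D T σ ξ =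
        jap (wave ξ) * ‖amp σ (wave ξ) • D.F0hat σ ξ‖ +
          ∫ r in Icc 0 T, ‖jap (wave ξ) • profileSource D T σ r ξ‖ := by
      intro ξ
      simp only [norm_smul, Real.norm_of_nonneg (jap_pos (wave ξ)).le]
      rw [integral_const_mul, profileBound, mul_add, norm_smul]
    simp only [e]
    exact h0.add h1
  · refine hw.norm.mono' hm.aestronglyMeasurable (Filter.Eventually.of_forall fun p => ?_)
    rw [norm_smul, Real.norm_of_nonneg (jap_pos _).le]
    exact le_mul_of_one_le_left (norm_nonneg _) (one_le_jap _)

end Bootstrap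

/-! ### Fourier representations and decay along the characteristics -/

/-- The real part of a complex vector as a continuous real-linear map. -/
noncomputable def reVecCLM : C3 →L[ℝ] R3 :=
  LinearMap.toContinuousLinearMap
    { toFun := reVec
      map_add' := fun z w => by ext i; simp [reVec]
      map_smul' := fun c z => by ext i; simp [reVec] }

lemma reVecCLM_apply (z : C3) : reVecCLM z = reVec z := rfl

lemma norm_reVec_le (z : C3) : ‖reVec z‖ ≤ ‖z‖ := by
  rw [EuclideanSpace.norm_eq, EuclideanSpace.norm_eq]
  gcongr with i
  exact Complex.abs_re_le_norm (z i)

lemma norm_reVec_sum_le {f : ℤˣ → C3} {b : ℝ} (hf : ∀ σ, ‖f σ‖ ≤ b) :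
    ‖reVec (∑ σ : ℤˣ, f σ)‖ ≤ 2 * b := by
  refine (norm_reVec_le _).trans ((norm_sum_le_of_le _ fun σ _ => hf σ).trans (le_of_eq ?_))
  rw [Finset.sum_const, Finset.card_univ, Fintype.card_units_int, nsmul_eq_mul]
  norm_num

lemma fourierInv_eq_wave (g : R3 → C3) (x : R3) :
    𝓕⁻ g x = ∫ ξ, Complex.exp (Complex.I * ((⟪wave ξ, x⟫ : ℝ) : ℂ)) • g ξ := by
  rw [Real.fourierInv_eq']
  congr 1; ext1 ξ
  congr 2
  rw [wave, inner_smul_left]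
  simp; ring

lemma EoscJ_eq (D : FieldData) (σ : ℤˣ) (j : ℕ) (τ : ℝ) (x v : R3) :
    D.EoscJ σ j τ x v = ∫ ξ, phase σ j x v τ ξ • D.Bhat σ τ ξ := by
  rw [FieldData.EoscJ, fourierInv_eq_wave]
  simp only [FieldData.EoscHat, smul_smul, phase, mul_assoc]

lemma Eosc_eq (D : FieldData) (σ : ℤˣ) (τ : ℝ) (x v : R3) :
    D.Eosc σ τ x = D.EoscJ σ 0 τ x v := by
  simp [FieldData.Eosc, FieldData.EoscJ]

lemma aPhiF_eq (D : FieldData) {T : ℝ} (σ : ℤˣ) (j : ℕ) {τ : ℝ} (hτ : τ ∈ Icc 0 T) (x v : R3) :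
    D.aPhiF σ j τ x v = ∫ ξ, phase σ j x v τ ξ • profileSource D T σ τ ξ := by
  rw [FieldData.aPhiF, fourierInv_eq_wave]
  congr 1; ext1 ξ
  have h : Complex.exp (lam σ (wave ξ) * (τ : ℂ)) * Complex.exp (-(lam σ (wave ξ)) * (τ : ℂ)) =
      1 := by
    rw [← Complex.exp_add, neg_mul, add_neg_cancel, Complex.exp_zero]
  rw [profileSource, indicator_of_mem hτ, smul_smul, smul_smul, phase]
  congr 1
  calc _ = Complex.exp (Complex.I * ((⟪wave ξ, x⟫ : ℝ) : ℂ)) *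
      (amp σ (wave ξ) * (omegaSym σ v (wave ξ) ^ j)⁻¹) * 1 := by rw [mul_one]
    _ = _ := by rw [← h]; ring

namespace Bootstrap

variable {α₀ : ℕ} {ε T : ℝ} {D : FieldData}

lemma norm_EoscHat (D : FieldData) (σ : ℤˣ) (t : ℝ) (ξ : R3) :
    ‖D.EoscHat σ t ξ‖ = ‖D.Bhat σ t ξ‖ := by
  rw [FieldData.EoscHat, norm_smul, norm_exp_lam, one_mul]

lemma integrable_weight_EoscHat (h : Bootstrap α₀ ε T D) (hα : 8 ≤ α₀) (hε : 0 ≤ ε) (σ : ℤˣ)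
    {t : ℝ} (ht : t ∈ Icc 0 T) : Integrable fun ξ => jap (wave ξ) • D.EoscHat σ t ξ := by
  have hp := h.isProfile hα hε (ht.1.trans ht.2) σ
  have hjc : Continuous fun ξ : R3 => jap (wave ξ) := continuous_jap.comp contDiff_wave.continuous
  have hec : Continuous fun ξ : R3 => Complex.exp (lam σ (wave ξ) * (t : ℂ)) :=
    Complex.continuous_exp.comp ((continuous_lam σ).mul continuous_const)
  refine hp.integrable_dom.mono' (hjc.aestronglyMeasurable.smul (hec.aestronglyMeasurable.smul
    (hp.stronglyMeasurable_apply ht).aestronglyMeasurable))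
    (Filter.Eventually.of_forall fun ξ => ?_)
  have hj := jap_pos (wave ξ)
  rw [norm_smul, Real.norm_of_nonneg hj.le, norm_EoscHat]
  have := hp.norm_le t ht ξ
  gcongr

lemma integrable_of_weight {F : Type*} [NormedAddCommGroup F] [NormedSpace ℝ F] {g : R3 → F}
    (hg : Integrable fun ξ => jap (wave ξ) • g ξ) : Integrable g := by
  have hjc : Continuous fun ξ : R3 => jap (wave ξ) := continuous_jap.comp contDiff_wave.continuous
  have hi : Continuous fun ξ : R3 => (jap (wave ξ))⁻¹ := hjc.inv₀ fun ξ => (jap_pos _).ne'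
  have h1 : Integrable fun ξ => (jap (wave ξ))⁻¹ • jap (wave ξ) • g ξ := by
    refine hg.bdd_smul 1 hi.aestronglyMeasurable (Filter.Eventually.of_forall fun ξ => ?_)
    rw [norm_inv, Real.norm_of_nonneg (jap_pos _).le]
    exact inv_le_one_of_one_le₀ (one_le_jap _)
  refine h1.congr (Filter.Eventually.of_forall fun ξ => ?_)
  simp only [smul_smul, inv_mul_cancel₀ (jap_pos (wave ξ)).ne', one_smul]

lemma advect_eq_fourierInv (h : Bootstrap α₀ ε T D) (hα : 8 ≤ α₀) (hε : 0 ≤ ε) (σ : ℤˣ) (j : ℕ)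
    {t : ℝ} (ht : t ∈ Icc 0 T) (x v : R3) :
    D.advect σ j t x v = 𝓕⁻ (fun ξ => (Complex.I *
      ((⟪wave ξ, gradHat v (D.E t x)⟫ : ℝ) : ℂ)) •
        ((omegaSym σ v (wave ξ) ^ j)⁻¹ • D.EoscHat σ t ξ)) x := by
  have h1 := h.integrable_weight_EoscHat hα hε σ ht
  have hoc : Continuous fun ξ : R3 => (omegaSym σ v (wave ξ) ^ j)⁻¹ :=
    (((continuous_omegaSym σ).comp (f := fun ξ : R3 => (v, ξ)) (by fun_prop)).pow j).inv₀
      fun ξ => pow_ne_zero _ (omegaSym_ne_zero _ _ _)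
  have hs : ∀ {g : R3 → C3}, Integrable g →
      Integrable fun ξ => (omegaSym σ v (wave ξ) ^ j)⁻¹ • g ξ := fun hg =>
    integrable_smul_of_bound hoc (fun ξ => norm_inv_omegaSym_pow_le σ j v _) hg
  have h2 : Integrable fun ξ => jap (wave ξ) • ((omegaSym σ v (wave ξ) ^ j)⁻¹ • D.EoscHat σ t ξ) :=
    (hs h1).congr (Filter.Eventually.of_forall fun ξ => smul_comm _ _ _)
  obtain ⟨L, hL, hLw⟩ := hasFDerivAt_fourierInv (hs (integrable_of_weight h1)) h2 x
  rw [FieldData.advect, ← hLw]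
  unfold FieldData.EoscJ
  rw [hL.fderiv]

lemma advect_eq (h : Bootstrap α₀ ε T D) (hα : 8 ≤ α₀) (hε : 0 ≤ ε) (σ : ℤˣ) (j : ℕ)
    {t : ℝ} (ht : t ∈ Icc 0 T) (x v : R3) :
    D.advect σ j t x v = ∫ ξ, ((Complex.I * ((⟪wave ξ, gradHat v (D.E t x)⟫ : ℝ) : ℂ)) *
      phase σ j x v t ξ) • D.Bhat σ t ξ := by
  rw [h.advect_eq_fourierInv hα hε σ j ht, fourierInv_eq_wave]
  congr 1; ext1 ξ
  rw [FieldData.EoscHat, smul_smul, smul_smul, smul_smul, phase]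
  congr 1
  ring

lemma hatBound_EoscHat (h : Bootstrap α₀ ε T D) (hα : 8 ≤ α₀) (hε : 0 ≤ ε) (σ : ℤˣ)
    {t : ℝ} (ht : t ∈ Icc 0 T) : HatBound (D.EoscHat σ t) (ε * jap t ^ (-(3 / 2) : ℝ)) := by
  have hi := integrable_of_weight (h.integrable_weight_EoscHat hα hε σ ht)
  refine ⟨hi, norm_le_of_eLpNorm_top_le (continuous_fourierInv hi)
    (mul_nonneg hε (Real.rpow_nonneg (jap_pos t).le _)) ?_⟩
  have h1 := h.Eosc_decay σ t ht ∞ le_top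
  have e : (-3 * (1 / 2 - (∞ : ℝ≥0∞)⁻¹.toReal) : ℝ) = -(3 / 2) := by norm_num
  rw [e] at h1
  exact h1

lemma hatBound_Fhat (h : Bootstrap α₀ ε T D) (hα : 8 ≤ α₀) (hε : 0 ≤ ε) (σ : ℤˣ)
    {t : ℝ} (ht : t ∈ Icc 0 T) : HatBound (D.Fhat σ t) (2 * (ε * jap t ^ (-3 : ℝ))) := by
  obtain ⟨c, hc⟩ := h.exists_integral_weight_S_le hα hε σ
  have hw := (hc t ht).1
  have hjc : Continuous fun ξ : R3 => jap (wave ξ) := continuous_jap.comp contDiff_wave.continuous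
  have hSc := h.continuous_fourier_S hε σ ht
  have h1 : Integrable fun ξ => jap (wave ξ) • 𝓕 (D.S σ t) ξ := by
    refine hw.mono' (hjc.aestronglyMeasurable.smul hSc.aestronglyMeasurable)
      (Filter.Eventually.of_forall fun ξ => ?_)
    rw [norm_smul, Real.norm_of_nonneg (jap_pos _).le]
    gcongr
    exact le_self_pow₀ (one_le_jap _) (by norm_num)
  have hF : Integrable (D.Fhat σ t) := by
    refine h1.norm.mono' (hSc.smul continuous_cvec_wave).aestronglyMeasurable
      (Filter.Eventually.of_forall fun ξ => ?_)
    rw [norm_smul, Real.norm_of_nonneg (jap_pos _).le]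
    exact norm_Fhat_le D σ t ξ
  have hb : 0 ≤ ε * jap t ^ (-3 : ℝ) := mul_nonneg hε (Real.rpow_nonneg (jap_pos t).le _)
  refine ⟨hF, fun x => ?_⟩
  have hd : DerivBound 1 ∞ (D.S σ t) (ε * jap t ^ (-3 : ℝ)) := by
    have h2 := h.S_decay σ t ht ∞ le_top 1 le_rfl
    have e : (-3 * (1 - (∞ : ℝ≥0∞)⁻¹.toReal) : ℝ) = -3 := by norm_num
    rwa [e] at h2
  have hcomp : ∀ i, ‖(𝓕⁻ (D.Fhat σ t) x) i‖ ≤ ε * jap t ^ (-3 : ℝ) := by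
    intro i
    have h3 := norm_fourierInv_deriv_le (h.continuous_S σ ht) (h.integrable_S hε σ ht).1
      (integrable_of_weight h1) h1 hb hd i x
    convert! h3 using 2
    rw [Real.fourierInv_eq, Real.fourierInv_eq]
    have h4 : ∫ ξ, (Real.fourierChar ⟪ξ, x⟫ • D.Fhat σ t ξ) i =
        (∫ ξ, Real.fourierChar ⟪ξ, x⟫ • D.Fhat σ t ξ) i :=
      (EuclideanSpace.proj (𝕜 := ℂ) i : C3 →L[ℂ] ℂ).integral_comp_comm
        (integrable_fourierChar_smul hF x)
    rw [← h4]
    congr 1; ext1 ξ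
    rw [FieldData.Fhat, Circle.smul_def, Circle.smul_def, PiLp.smul_apply]
    congr 1
    rw [PiLp.smul_apply, PiLp.smul_apply, smul_eq_mul, smul_eq_mul, smul_eq_mul, cvec]
    have h5 : ⟪wave ξ, EuclideanSpace.single i (1 : ℝ)⟫ = wave ξ i := by
      rw [EuclideanSpace.inner_single_right, one_mul, RCLike.conj_to_real]
    rw [h5]
    ring
  refine abs_le_of_sq_le_sq' ?_ (by positivity) |>.2
  rw [EuclideanSpace.norm_sq_eq]
  calc ∑ i, ‖(𝓕⁻ (D.Fhat σ t) x) i‖ ^ 2 ≤ ∑ _i : Fin 3, (ε * jap t ^ (-3 : ℝ)) ^ 2 := by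
        gcongr with i; exact hcomp i
    _ = 3 * (ε * jap t ^ (-3 : ℝ)) ^ 2 := by simp
    _ ≤ _ := by nlinarith [sq_nonneg (ε * jap t ^ (-3 : ℝ))]

lemma norm_Er_le (h : Bootstrap α₀ ε T D) (hε : 0 ≤ ε) {t : ℝ} (ht : t ∈ Icc 0 T) (x : R3) :
    ‖D.Er t x‖ ≤ ε * jap t ^ (-3 : ℝ) := by
  have hc : Continuous (D.Er t) :=
    continuousOn_univ.1 (h.Er_cont.comp (f := fun x : R3 => (t, x)) (by fun_prop)
      fun _ _ => ⟨ht, trivial⟩)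
  refine norm_le_of_eLpNorm_top_le hc (mul_nonneg hε (Real.rpow_nonneg (jap_pos t).le _)) ?_ x
  have h2 := h.Er_decay t ht ∞ le_top
  have e : (-3 * (1 - (∞ : ℝ≥0∞)⁻¹.toReal) : ℝ) = -3 := by norm_num
  rwa [e] at h2

lemma norm_E_le (h : Bootstrap α₀ ε T D) (hα : 8 ≤ α₀) (hε : 0 ≤ ε) {t : ℝ} (ht : t ∈ Icc 0 T)
    (x : R3) : ‖D.E t x‖ ≤ 3 * (ε * jap t ^ (-(3 / 2) : ℝ)) := by
  have h1 := norm_reVec_sum_le (f := fun σ => D.Eosc σ t x)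
    fun σ => (h.hatBound_EoscHat hα hε σ ht).bound x
  have h2 := h.norm_Er_le hε ht x
  have h3 : ε * jap t ^ (-3 : ℝ) ≤ ε * jap t ^ (-(3 / 2) : ℝ) := by
    gcongr
    · exact one_le_jap t
    · norm_num
  refine (norm_add_le _ _).trans ?_
  linarith

/-- Pointwise decay of `E^{osc,1}`, `E^{osc,2}`, `Q^tr` and `Q^{tr,1}`, uniformly for bounded
velocities. -/
theorem exists_decay_bounds (R : ℝ) : ∃ M, 0 ≤ M ∧ ∀ (α₀ : ℕ) (ε T : ℝ) (D : FieldData), 8 ≤ α₀ →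
    0 ≤ ε → ε ≤ 1 → Bootstrap α₀ ε T D → ∀ t ∈ Icc 0 T, ∀ x v : R3, ‖v‖ ≤ R →
      (∀ σ j, 1 ≤ j → j ≤ 2 → ‖D.EoscJ σ j t x v‖ ≤ M * ε * jap t ^ (-(3 / 2) : ℝ)) ∧
      ‖D.Qtr t x v‖ ≤ M * ε * jap t ^ (-3 : ℝ) ∧ ‖D.Qtr1 t x v‖ ≤ M * ε * jap t ^ (-3 : ℝ) := by
  obtain ⟨M, hM, hMb⟩ := exists_hatBound_multipliers R
  refine ⟨28 * M + 1, by positivity, fun α₀ ε T D hα hε hε1 h t ht x v hv => ?_⟩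
  have hj := jap_pos t
  set w := jap t ^ (-(3 / 2) : ℝ)
  have hw : 0 ≤ w := Real.rpow_nonneg hj.le _
  have hww : jap t ^ (-3 : ℝ) = w * w := by
    simp only [w]; rw [← Real.rpow_add hj]; norm_num
  have hJ : ∀ σ j, 1 ≤ j → j ≤ 2 → ‖D.EoscJ σ j t x v‖ ≤ M * (ε * w) := fun σ j h1 h2 =>
    ((hMb σ v hv _ _ (h.hatBound_EoscHat hα hε σ ht) j h1 h2).1).bound x
  have hA : ∀ σ j, 1 ≤ j → j ≤ 2 → ‖D.aPhiF σ j t x v‖ ≤ M * (2 * (ε * (w * w))) := by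
    intro σ j h1 h2
    have h3 := h.hatBound_Fhat hα hε σ ht
    rw [hww] at h3
    exact ((hMb σ v hv _ _ h3 j h1 h2).2.1).bound x
  have hD : ∀ σ j, 1 ≤ j → j ≤ 2 → ‖D.advect σ (j + 1) t x v‖ ≤ M * (6 * (ε * (w * w))) := by
    intro σ j h1 h2
    rw [h.advect_eq_fourierInv hα hε σ (j + 1) ht]
    have h3 := ((hMb σ v hv _ _ (h.hatBound_EoscHat hα hε σ ht) j h1 h2).2.2
      (gradHat v (D.E t x))).bound x
    have h4 : ‖gradHat v (D.E t x)‖ ≤ 6 * (ε * w) := by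
      have := norm_gradHat_le v (D.E t x)
      have := h.norm_E_le hα hε ht x
      linarith
    refine h3.trans ?_
    calc M * ‖gradHat v (D.E t x)‖ * (ε * w) ≤ M * (6 * (ε * w)) * (ε * w) := by gcongr
      _ = M * (6 * (ε * ε * (w * w))) := by ring
      _ ≤ M * (6 * (ε * 1 * (w * w))) := by gcongr
      _ = _ := by rw [mul_one]
  have hEr := h.norm_Er_le hε ht x
  rw [hww] at hEr
  rw [hww]
  have hp : 0 ≤ ε * (w * w) := by positivity
  have hMp : 0 ≤ M * (ε * (w * w)) := by positivity
  refine ⟨fun σ j h1 h2 => (hJ σ j h1 h2).trans ?_, ?_, ?_⟩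
  · have hq : 0 ≤ ε * w := by positivity
    have hMq : 0 ≤ M * (ε * w) := by positivity
    linarith
  · have hs := norm_reVec_sum_le (f := fun σ => - D.aPhiF σ 1 t x v + D.advect σ 2 t x v)
      (b := M * (8 * (ε * (w * w)))) fun σ => by
        refine (norm_add_le _ _).trans ?_
        rw [norm_neg]
        linarith [hA σ 1 le_rfl (by norm_num), hD σ 1 le_rfl (by norm_num)]
    refine (norm_add_le _ _).trans ?_
    linarith
  · refine (norm_reVec_sum_le (f := fun σ => D.aPhiF σ 2 t x v - (2 : ℝ) • D.advect σ 3 t x v)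
      (b := M * (14 * (ε * (w * w)))) fun σ => ?_).trans ?_
    · refine (norm_sub_le _ _).trans ?_
      rw [norm_smul, Real.norm_ofNat]
      linarith [hA σ 2 (by norm_num) le_rfl, hD σ 2 (by norm_num) le_rfl]
    · linarith

end Bootstrap

/-! ### Integrated transport along the characteristics -/

/-- A pair of curves solving the characteristic equations of the field `E` on `[s,t]`. -/
structure IsCharCurve (E : ℝ → R3 → R3) (s t : ℝ) (y w : ℝ → R3) : Prop where
  pos_deriv : ∀ τ ∈ Icc s t, HasDerivWithinAt y (hat (w τ)) (Icc s t) τ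
  vel_deriv : ∀ τ ∈ Icc s t, HasDerivWithinAt w (E τ (y τ)) (Icc s t) τ

namespace IsCharCurve

variable {E : ℝ → R3 → R3} {s t : ℝ} {y w : ℝ → R3}

lemma continuousOn_pos (hc : IsCharCurve E s t y w) : ContinuousOn y (Icc s t) :=
  fun τ hτ => (hc.pos_deriv τ hτ).continuousWithinAt

lemma continuousOn_vel (hc : IsCharCurve E s t y w) : ContinuousOn w (Icc s t) :=
  fun τ hτ => (hc.vel_deriv τ hτ).continuousWithinAt

lemma mono (hc : IsCharCurve E s t y w) {r : ℝ} (hr : s ≤ r) : IsCharCurve E r t y w :=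
  ⟨fun τ hτ => (hc.pos_deriv τ ⟨hr.trans hτ.1, hτ.2⟩).mono (Icc_subset_Icc_left hr),
    fun τ hτ => (hc.vel_deriv τ ⟨hr.trans hτ.1, hτ.2⟩).mono (Icc_subset_Icc_left hr)⟩

end IsCharCurve

/-- The fundamental theorem of calculus with one-sided derivatives at the end points. -/
lemma integral_eq_sub_of_hasDerivWithinAt {F : Type*} [NormedAddCommGroup F] [NormedSpace ℝ F]
    [CompleteSpace F] {f f' : ℝ → F} {s t : ℝ} (hst : s ≤ t)
    (hf : ∀ τ ∈ Icc s t, HasDerivWithinAt f (f' τ) (Icc s t) τ) (hf' : ContinuousOn f' (Icc s t)) :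
    ∫ τ in s..t, f' τ = f t - f s := by
  refine intervalIntegral.integral_eq_sub_of_hasDeriv_right (f := f) ?_ (fun τ hτ => ?_) ?_
  · rw [uIcc_of_le hst]; exact fun τ hτ => (hf τ hτ).continuousWithinAt
  · rw [min_eq_left hst, max_eq_right hst] at hτ
    exact ((hf τ (Ioo_subset_Icc_self hτ)).hasDerivAt
      (Icc_mem_nhds hτ.1 hτ.2)).hasDerivWithinAt
  · exact ContinuousOn.intervalIntegrable (by rwa [uIcc_of_le hst])

namespace Bootstrap

variable {α₀ : ℕ} {ε T : ℝ} {D : FieldData}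

lemma continuousOn_E (h : Bootstrap α₀ ε T D) (hα : 8 ≤ α₀) (hε : 0 ≤ ε) {s t : ℝ} (hs : 0 ≤ s)
    (hst : s ≤ t) (ht : t ≤ T) {y : ℝ → R3} (hy : ContinuousOn y (Icc s t)) :
    ContinuousOn (fun τ => D.E τ (y τ)) (Icc s t) := by
  have hsub : Icc s t ⊆ Icc 0 T := Icc_subset_Icc hs ht
  have hph := fun σ => continuousOn_phase σ 0 hy (continuousOn_const (c := (0 : R3)))
  have h1 : ∀ σ, ContinuousOn (fun τ => D.Eosc σ τ (y τ)) (Icc s t) := by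
    intro σ
    simp only [fun τ => Eosc_eq D σ τ (y τ) 0, EoscJ_eq]
    refine (h.isProfile hα hε (hs.trans (hst.trans ht)) σ).continuousOn_integral hs ht (C := 1)
      (fun τ hτ => ?_) (fun ξ => ?_) (fun τ _ ξ => ?_)
    · exact continuousOn_univ.1 ((hph σ).comp (f := fun ξ : R3 => (τ, ξ)) (by fun_prop)
        fun ξ _ => ⟨hτ, trivial⟩)
    · exact (hph σ).comp (f := fun τ : ℝ => (τ, ξ)) (by fun_prop) fun τ hτ => ⟨hτ, trivial⟩
    · have := norm_phase_le σ 0 (y τ) 0 τ ξ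
      rw [pow_zero] at this
      rw [one_mul]
      exact this.trans (one_le_jap _)
  have h2 : ContinuousOn (fun τ => D.Er τ (y τ)) (Icc s t) :=
    h.Er_cont.comp (f := fun τ => (τ, y τ)) (continuousOn_id.prodMk hy) fun τ hτ =>
      ⟨hsub hτ, trivial⟩
  have h3 : ContinuousOn (fun τ => ∑ σ : ℤˣ, D.Eosc σ τ (y τ)) (Icc s t) :=
    continuousOn_finsetSum _ fun σ _ => h1 σ
  exact (reVecCLM.continuous.comp_continuousOn h3).add h2

/-- The transport identity for `E^{osc,j+1}_±` along a characteristic. -/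
lemma EoscJ_sub_eq_integral (h : Bootstrap α₀ ε T D) (hα : 8 ≤ α₀) (hε : 0 ≤ ε) {s t : ℝ}
    (hs : 0 ≤ s) (hst : s ≤ t) (ht : t ≤ T) {y w : ℝ → R3} (hc : IsCharCurve D.E s t y w)
    (σ : ℤˣ) (j : ℕ) :
    ContinuousOn (fun τ => D.EoscJ σ j τ (y τ) (w τ)) (Icc s t) ∧
    ContinuousOn (fun τ => D.advect σ (j + 2) τ (y τ) (w τ)) (Icc s t) ∧
    IntervalIntegrable (fun τ => D.aPhiF σ (j + 1) τ (y τ) (w τ)) volume s t ∧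
    D.EoscJ σ (j + 1) t (y t) (w t) - D.EoscJ σ (j + 1) s (y s) (w s) =
      ∫ τ in s..t, (D.EoscJ σ j τ (y τ) (w τ) - (j + 1 : ℂ) • D.advect σ (j + 2) τ (y τ) (w τ) +
        D.aPhiF σ (j + 1) τ (y τ) (w τ)) := by
  have hsub : Icc s t ⊆ Icc 0 T := Icc_subset_Icc hs ht
  obtain ⟨h1, h2, h3, h4⟩ := integral_phase_sub_eq
    (h.isProfile hα hε (hs.trans (hst.trans ht)) σ) hs hst ht hc.pos_deriv hc.vel_deriv
    (h.continuousOn_E hα hε hs hst ht hc.continuousOn_pos) σ j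
  have eadv : ∀ τ ∈ Icc s t, D.advect σ (j + 2) τ (y τ) (w τ) =
      ∫ ξ, ((Complex.I * ((⟪wave ξ, gradHat (w τ) (D.E τ (y τ))⟫ : ℝ) : ℂ)) *
        phase σ (j + 2) (y τ) (w τ) τ ξ) • D.Bhat σ τ ξ := fun τ hτ =>
    h.advect_eq hα hε σ (j + 2) (hsub hτ) _ _
  have eF : ∀ τ ∈ Icc s t, D.aPhiF σ (j + 1) τ (y τ) (w τ) =
      ∫ ξ, phase σ (j + 1) (y τ) (w τ) τ ξ • profileSource D T σ τ ξ := fun τ hτ =>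
    aPhiF_eq D σ (j + 1) (hsub hτ) _ _
  have hI : uIcc s t = Icc s t := uIcc_of_le hst
  simp only [EoscJ_eq]
  refine ⟨h1, h2.congr eadv, h3.congr fun τ hτ => ?_, h4.trans ?_⟩
  · exact (eF τ (hI ▸ uIoc_subset_uIcc hτ)).symm
  · refine intervalIntegral.integral_congr fun τ hτ => ?_
    rw [hI] at hτ
    beta_reduce
    rw [eadv τ hτ, eF τ hτ]

lemma intervalIntegrable_reVec_sum {f : ℤˣ → ℝ → C3} {s t : ℝ}
    (hf : ∀ σ, IntervalIntegrable (f σ) volume s t) :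
    IntervalIntegrable (fun τ => reVec (∑ σ : ℤˣ, f σ τ)) volume s t ∧
      ∫ τ in s..t, reVec (∑ σ : ℤˣ, f σ τ) = reVec (∑ σ : ℤˣ, ∫ τ in s..t, f σ τ) := by
  have h1 : IntervalIntegrable (fun τ => ∑ σ : ℤˣ, f σ τ) volume s t :=
    ⟨integrable_finsetSum _ fun σ _ => (hf σ).1, integrable_finsetSum _ fun σ _ => (hf σ).2⟩
  refine ⟨⟨reVecCLM.integrable_comp h1.1, reVecCLM.integrable_comp h1.2⟩, ?_⟩
  have h2 := reVecCLM.intervalIntegral_comp_comm h1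
  simp only [reVecCLM_apply] at h2
  rw [h2, intervalIntegral.integral_finsetSum fun σ _ => hf σ]

/-- Along a characteristic, the velocity is `V^osc` up to the time integral of `Q^tr`. -/
lemma vel_sub_eq (h : Bootstrap α₀ ε T D) (hα : 8 ≤ α₀) (hε : 0 ≤ ε) {s t : ℝ}
    (hs : 0 ≤ s) (hst : s ≤ t) (ht : t ≤ T) {y w : ℝ → R3} (hc : IsCharCurve D.E s t y w) :
    ContinuousOn (fun τ => reVec (∑ σ : ℤˣ, D.EoscJ σ 1 τ (y τ) (w τ))) (Icc s t) ∧
    IntervalIntegrable (fun τ => D.Qtr τ (y τ) (w τ)) volume s t ∧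
    w t - w s = reVec (∑ σ : ℤˣ, D.EoscJ σ 1 t (y t) (w t)) -
      reVec (∑ σ : ℤˣ, D.EoscJ σ 1 s (y s) (w s)) + ∫ τ in s..t, D.Qtr τ (y τ) (w τ) := by
  have hsub : Icc s t ⊆ Icc 0 T := Icc_subset_Icc hs ht
  have hI : uIcc s t = Icc s t := uIcc_of_le hst
  have key := fun σ => h.EoscJ_sub_eq_integral hα hε hs hst ht hc σ 0
  have key1 := fun σ => h.EoscJ_sub_eq_integral hα hε hs hst ht hc σ 1
  have hEc := h.continuousOn_E hα hε hs hst ht hc.continuousOn_pos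
  have hErc : ContinuousOn (fun τ => D.Er τ (y τ)) (Icc s t) :=
    h.Er_cont.comp (f := fun τ => (τ, y τ)) (continuousOn_id.prodMk hc.continuousOn_pos)
      fun τ hτ => ⟨hsub hτ, trivial⟩
  have hci : ∀ {F : Type} [NormedAddCommGroup F] {f : ℝ → F}, ContinuousOn f (Icc s t) →
      IntervalIntegrable f volume s t := fun hf =>
    ContinuousOn.intervalIntegrable (by rwa [hI])
  have hi0 := fun σ => hci (key σ).1
  have hi2 := fun σ => hci (key σ).2.1
  have hi1 := fun σ => (key σ).2.2.1
  have hq : ∀ σ, IntervalIntegrable (fun τ => - D.aPhiF σ 1 τ (y τ) (w τ) +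
      D.advect σ 2 τ (y τ) (w τ)) volume s t := fun σ => (hi1 σ).neg.add (hi2 σ)
  have hQ : IntervalIntegrable (fun τ => D.Qtr τ (y τ) (w τ)) volume s t :=
    (intervalIntegrable_reVec_sum hq).1.add (hci hErc)
  refine ⟨reVecCLM.continuous.comp_continuousOn
    (continuousOn_finsetSum _ fun σ _ => (key1 σ).1), hQ, ?_⟩
  have hG : ∀ σ, IntervalIntegrable (fun τ => D.EoscJ σ 0 τ (y τ) (w τ) -
      ((0 : ℕ) + 1 : ℂ) • D.advect σ (0 + 2) τ (y τ) (w τ) +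
        D.aPhiF σ (0 + 1) τ (y τ) (w τ)) volume s t := fun σ =>
    ((hi0 σ).sub ((hi2 σ).smul (r := ((0 : ℕ) + 1 : ℂ)))).add (hi1 σ)
  have e1 : ∀ τ, D.E τ (y τ) = reVec (∑ σ : ℤˣ, (D.EoscJ σ 0 τ (y τ) (w τ) -
      ((0 : ℕ) + 1 : ℂ) • D.advect σ (0 + 2) τ (y τ) (w τ) +
        D.aPhiF σ (0 + 1) τ (y τ) (w τ))) + D.Qtr τ (y τ) (w τ) := by
    intro τ
    rw [FieldData.E, FieldData.Qtr, ← add_assoc]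
    congr 1
    simp only [← reVecCLM_apply]
    rw [← map_add, ← Finset.sum_add_distrib]
    congr 2; ext1 σ
    rw [Eosc_eq D σ τ (y τ) (w τ)]
    push_cast
    rw [zero_add, one_smul]
    abel
  have e2 := integral_eq_sub_of_hasDerivWithinAt hst hc.vel_deriv hEc
  have hR := intervalIntegrable_reVec_sum hG
  rw [← e2]
  simp only [e1]
  rw [intervalIntegral.integral_add hR.1 hQ, hR.2]
  congr 1
  simp only [← (key _).2.2.2, ← reVecCLM_apply]
  rw [Finset.sum_sub_distrib, map_sub]

/-- The time integral of `V^osc` along a characteristic. -/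
lemma integral_Vosc_eq (h : Bootstrap α₀ ε T D) (hα : 8 ≤ α₀) (hε : 0 ≤ ε) {s t : ℝ}
    (hs : 0 ≤ s) (hst : s ≤ t) (ht : t ≤ T) {y w : ℝ → R3} (hc : IsCharCurve D.E s t y w) :
    IntervalIntegrable (fun τ => D.Qtr1 τ (y τ) (w τ)) volume s t ∧
    ∫ τ in s..t, reVec (∑ σ : ℤˣ, D.EoscJ σ 1 τ (y τ) (w τ)) =
      reVec (∑ σ : ℤˣ, (D.EoscJ σ 2 t (y t) (w t) - D.EoscJ σ 2 s (y s) (w s))) -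
        ∫ τ in s..t, D.Qtr1 τ (y τ) (w τ) := by
  have hI : uIcc s t = Icc s t := uIcc_of_le hst
  have key := fun σ => h.EoscJ_sub_eq_integral hα hε hs hst ht hc σ 1
  have hci : ∀ {f : ℝ → C3}, ContinuousOn f (Icc s t) →
      IntervalIntegrable f volume s t := fun hf =>
    ContinuousOn.intervalIntegrable (by rwa [hI])
  have hi0 := fun σ => hci (key σ).1
  have hi2 := fun σ => hci (key σ).2.1
  have hi1 := fun σ => (key σ).2.2.1
  have hq : ∀ σ, IntervalIntegrable (fun τ => D.aPhiF σ 2 τ (y τ) (w τ) -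
      (2 : ℝ) • D.advect σ 3 τ (y τ) (w τ)) volume s t := fun σ =>
    (hi1 σ).sub ((hi2 σ).smul (r := (2 : ℝ)))
  have hQ : IntervalIntegrable (fun τ => D.Qtr1 τ (y τ) (w τ)) volume s t :=
    (intervalIntegrable_reVec_sum hq).1
  refine ⟨hQ, ?_⟩
  have hG : ∀ σ, IntervalIntegrable (fun τ => D.EoscJ σ 1 τ (y τ) (w τ) -
      ((1 : ℕ) + 1 : ℂ) • D.advect σ (1 + 2) τ (y τ) (w τ) +
        D.aPhiF σ (1 + 1) τ (y τ) (w τ)) volume s t := fun σ =>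
    ((hi0 σ).sub ((hi2 σ).smul (r := ((1 : ℕ) + 1 : ℂ)))).add (hi1 σ)
  have e1 : ∀ τ, reVec (∑ σ : ℤˣ, D.EoscJ σ 1 τ (y τ) (w τ)) =
      reVec (∑ σ : ℤˣ, (D.EoscJ σ 1 τ (y τ) (w τ) -
      ((1 : ℕ) + 1 : ℂ) • D.advect σ (1 + 2) τ (y τ) (w τ) +
        D.aPhiF σ (1 + 1) τ (y τ) (w τ))) - D.Qtr1 τ (y τ) (w τ) := by
    intro τ
    rw [FieldData.Qtr1]
    simp only [← reVecCLM_apply]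
    rw [← map_sub, ← Finset.sum_sub_distrib]
    congr 2; ext1 σ
    have h2 : ((1 : ℕ) + 1 : ℂ) • D.advect σ (1 + 2) τ (y τ) (w τ) =
        (2 : ℝ) • D.advect σ 3 τ (y τ) (w τ) := by
      rw [← Complex.coe_smul]; congr 1; push_cast; norm_num
    rw [h2]
    abel
  have hR := intervalIntegrable_reVec_sum hG
  simp only [e1]
  rw [intervalIntegral.integral_sub hR.1 hQ, hR.2]
  congr 2
  simp only [← (key _).2.2.2]

end Bootstrap

/-- Fubini on the triangle `s ≤ τ ≤ r ≤ t`. -/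
lemma integral_integral_tail {Q : ℝ → R3} {s t K : ℝ} (hst : s ≤ t)
    (hQ : IntervalIntegrable Q volume s t) (hK : ∀ τ ∈ Icc s t, ‖Q τ‖ ≤ K) :
    ContinuousOn (fun τ => ∫ r in τ..t, Q r) (Icc s t) ∧
    ∫ τ in s..t, ∫ r in τ..t, Q r = ∫ τ in s..t, (τ - s) • Q τ := by
  have hI : uIcc s t = Icc s t := uIcc_of_le hst
  have hprim : ContinuousOn (fun τ => ∫ r in s..τ, Q r) (Icc s t) := by
    have := (absolutelyContinuousOnInterval_primitive hst hQ hK).continuousOn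
    rwa [hI] at this
  have e : ∀ τ ∈ Icc s t, ∫ r in τ..t, Q r = (∫ r in s..t, Q r) - ∫ r in s..τ, Q r := by
    intro τ hτ
    have h1 : IntervalIntegrable Q volume s τ := hQ.mono_set (by
      rw [hI, uIcc_of_le hτ.1]; exact Icc_subset_Icc_right hτ.2)
    have h2 : IntervalIntegrable Q volume τ t := hQ.mono_set (by
      rw [hI, uIcc_of_le hτ.2]; exact Icc_subset_Icc_left hτ.1)
    rw [← intervalIntegral.integral_add_adjacent_intervals h1 h2, add_sub_cancel_left]
  have hpi : IntervalIntegrable (fun τ => ∫ r in s..τ, Q r) volume s t :=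
    ContinuousOn.intervalIntegrable (by rwa [hI])
  have hQi : IntervalIntegrable (fun τ => (τ - s) • Q τ) volume s t :=
    hQ.continuousOn_smul (by fun_prop)
  refine ⟨(continuousOn_const.sub hprim).congr e, ?_⟩
  have h3 := smul_sub_smul_eq_integral (𝕜 := ℝ) (P := fun τ => τ - s) (P' := fun _ => 1)
    (β := fun τ => ∫ r in s..τ, Q r) (b := Q) hst
    (fun τ _ => (hasDerivWithinAt_id τ _).sub_const s) continuousOn_const hQ hK
    (fun τ _ => by simp)
  simp only [one_smul, sub_self, zero_smul, sub_zero] at h3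
  rw [intervalIntegral.integral_add hpi hQi] at h3
  rw [intervalIntegral.integral_congr (g := fun τ => (∫ r in s..t, Q r) - ∫ r in s..τ, Q r)
    fun τ hτ => e τ (hI ▸ hτ), intervalIntegral.integral_sub intervalIntegrable_const hpi,
    intervalIntegral.integral_const, h3, add_sub_cancel_left]

/-! ### Time integrals of the decay rates -/

/-- The weight `(1 + τ)^{-1/2}`; its powers have explicit primitives. -/
noncomputable def timeWeight (τ : ℝ) : ℝ := (√(1 + τ))⁻¹

/-- The weight `⟨τ⟩^{-1/2}`, which turns the decay rates into natural powers. -/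
noncomputable def japWeight (τ : ℝ) : ℝ := (√(jap τ))⁻¹

lemma japWeight_pos (τ : ℝ) : 0 < japWeight τ := inv_pos.2 (Real.sqrt_pos.2 (jap_pos τ))

lemma japWeight_le_one (τ : ℝ) : japWeight τ ≤ 1 :=
  inv_le_one_of_one_le₀ (Real.one_le_sqrt.2 (one_le_jap τ))

lemma japWeight_sq (τ : ℝ) : japWeight τ ^ 2 = (jap τ)⁻¹ := by
  rw [japWeight, inv_pow, Real.sq_sqrt (jap_pos τ).le]

lemma jap_rpow_neg_half_mul (τ : ℝ) (n : ℕ) : jap τ ^ (-(n / 2) : ℝ) = japWeight τ ^ n := by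
  have hj := jap_pos τ
  rw [japWeight, Real.sqrt_eq_rpow, ← Real.rpow_neg hj.le, ← Real.rpow_natCast,
    ← Real.rpow_mul hj.le]
  congr 1; ring

lemma jap_rpow_neg_three_halves (τ : ℝ) : jap τ ^ (-(3 / 2) : ℝ) = japWeight τ ^ 3 := by
  rw [← jap_rpow_neg_half_mul]; norm_num

lemma jap_rpow_neg_three (τ : ℝ) : jap τ ^ (-3 : ℝ) = japWeight τ ^ 6 := by
  rw [← jap_rpow_neg_half_mul]; norm_num

lemma jap_rpow_neg_two (τ : ℝ) : jap τ ^ (-2 : ℝ) = japWeight τ ^ 4 := by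
  rw [← jap_rpow_neg_half_mul]; norm_num

lemma japWeight_anti {s t : ℝ} (hs : 0 ≤ s) (hst : s ≤ t) : japWeight t ≤ japWeight s := by
  refine inv_anti₀ (Real.sqrt_pos.2 (jap_pos s)) (Real.sqrt_le_sqrt (jap_mono ?_))
  rw [Real.norm_of_nonneg hs, Real.norm_of_nonneg (hs.trans hst)]
  exact hst

lemma timeWeight_pos {τ : ℝ} (hτ : 0 ≤ τ) : 0 < timeWeight τ :=
  inv_pos.2 (Real.sqrt_pos.2 (by linarith))

lemma timeWeight_sq {τ : ℝ} (hτ : 0 ≤ τ) : timeWeight τ ^ 2 = (1 + τ)⁻¹ := by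
  rw [timeWeight, inv_pow, Real.sq_sqrt (by linarith)]

lemma timeWeight_le_japWeight (τ : ℝ) (hτ : 0 ≤ τ) : timeWeight τ ≤ japWeight τ := by
  refine inv_anti₀ (Real.sqrt_pos.2 (jap_pos τ)) (Real.sqrt_le_sqrt ?_)
  have := jap_le_one_add τ
  rwa [Real.norm_of_nonneg hτ] at this

lemma timeWeight_anti {s t : ℝ} (hs : 0 ≤ s) (hst : s ≤ t) : timeWeight t ≤ timeWeight s :=
  inv_anti₀ (Real.sqrt_pos.2 (by linarith)) (Real.sqrt_le_sqrt (by linarith))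

lemma japWeight_sq_le {τ : ℝ} (hτ : 0 ≤ τ) : japWeight τ ^ 2 ≤ 2 * timeWeight τ ^ 2 := by
  have hj := jap_pos τ
  have := one_add_le_two_mul_jap τ
  rw [Real.norm_of_nonneg hτ] at this
  rw [japWeight_sq, timeWeight_sq hτ, inv_eq_one_div, ← div_eq_mul_inv,
    div_le_div_iff₀ hj (by linarith)]
  linarith

lemma japWeight_pow_three_le {τ : ℝ} (hτ : 0 ≤ τ) : japWeight τ ^ 3 ≤ 4 * timeWeight τ ^ 3 := by
  have h1 := japWeight_sq_le hτ
  have hp := japWeight_pos τ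
  have hu := timeWeight_pos hτ
  have h2 : japWeight τ ≤ 2 * timeWeight τ := by
    refine le_of_sq_le_sq ?_ (by positivity)
    nlinarith
  calc japWeight τ ^ 3 = japWeight τ ^ 2 * japWeight τ := by ring
    _ ≤ (2 * timeWeight τ ^ 2) * (2 * timeWeight τ) := by gcongr
    _ = _ := by ring

lemma japWeight_pow_six_le {τ : ℝ} (hτ : 0 ≤ τ) : japWeight τ ^ 6 ≤ 8 * timeWeight τ ^ 6 := by
  have h1 := japWeight_sq_le hτ
  calc japWeight τ ^ 6 = (japWeight τ ^ 2) ^ 3 := by ring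
    _ ≤ (2 * timeWeight τ ^ 2) ^ 3 := by gcongr
    _ = _ := by ring

lemma hasDerivAt_timeWeight {τ : ℝ} (hτ : 0 ≤ τ) :
    HasDerivAt timeWeight (-(2⁻¹ * timeWeight τ ^ 3)) τ := by
  have h0 : 0 < √(1 + τ) := Real.sqrt_pos.2 (by linarith)
  have h1 := (((hasDerivAt_id τ).const_add 1).sqrt (by simp; linarith)).fun_inv h0.ne'
  refine h1.congr_deriv ?_
  simp only [timeWeight, id]
  field_simp

lemma continuousOn_timeWeight {s t : ℝ} (hs : 0 ≤ s) : ContinuousOn timeWeight (Icc s t) :=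
  fun _ hτ => (hasDerivAt_timeWeight (hs.trans hτ.1)).continuousAt.continuousWithinAt

lemma intervalIntegrable_timeWeight_pow {s t : ℝ} (hs : 0 ≤ s) (hst : s ≤ t) (n : ℕ) :
    IntervalIntegrable (fun τ => timeWeight τ ^ n) volume s t :=
  ContinuousOn.intervalIntegrable (by
    rw [uIcc_of_le hst]; exact (continuousOn_timeWeight hs).pow n)

lemma integral_timeWeight_pow_three {s t : ℝ} (hs : 0 ≤ s) (hst : s ≤ t) :
    ∫ τ in s..t, timeWeight τ ^ 3 = 2 * (timeWeight s - timeWeight t) := by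
  rw [integral_eq_sub_of_hasDerivWithinAt (f := fun τ => -2 * timeWeight τ)
    (f' := fun τ => timeWeight τ ^ 3) hst (fun τ hτ => ?_)
    ((continuousOn_timeWeight hs).pow 3)]
  · ring
  · refine ((hasDerivAt_timeWeight (hs.trans hτ.1)).const_mul (-2)).hasDerivWithinAt.congr_deriv ?_
    ring

lemma timeWeight_sq_sub {s t : ℝ} (hs : 0 ≤ s) (hst : s ≤ t) :
    timeWeight s ^ 2 - timeWeight t ^ 2 = (t - s) * (timeWeight s ^ 2 * timeWeight t ^ 2) := by
  have h1 : 0 < 1 + s := by linarith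
  have h2 : 0 < 1 + t := by linarith
  rw [timeWeight_sq hs, timeWeight_sq (hs.trans hst)]
  field_simp
  ring

lemma integral_timeWeight_pow_four {s t : ℝ} (hs : 0 ≤ s) (hst : s ≤ t) :
    ∫ τ in s..t, timeWeight τ ^ 4 = (t - s) * (timeWeight s ^ 2 * timeWeight t ^ 2) := by
  rw [integral_eq_sub_of_hasDerivWithinAt (f := fun τ => -timeWeight τ ^ 2)
    (f' := fun τ => timeWeight τ ^ 4) hst (fun τ hτ => ?_)
    ((continuousOn_timeWeight hs).pow 4), ← timeWeight_sq_sub hs hst]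
  · ring
  · have h := ((hasDerivAt_timeWeight (hs.trans hτ.1)).fun_pow 2).fun_neg
    refine h.hasDerivWithinAt.congr_deriv ?_
    push_cast
    ring

lemma integral_timeWeight_pow_three_le {s t : ℝ} (hs : 0 ≤ s) (hst : s ≤ t) :
    ∫ τ in s..t, timeWeight τ ^ 3 ≤ (t - s) * (2 * (timeWeight s ^ 2 * timeWeight t)) := by
  have h1 := timeWeight_sq_sub hs hst
  have ha := timeWeight_pos hs
  have hb := timeWeight_pos (hs.trans hst)
  have hab := timeWeight_anti hs hst
  have hd : 0 ≤ t - s := by linarith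
  rw [integral_timeWeight_pow_three hs hst]
  have h2 : (timeWeight s - timeWeight t) * timeWeight s ≤
      ((t - s) * (timeWeight s ^ 2 * timeWeight t)) * timeWeight s := by
    calc (timeWeight s - timeWeight t) * timeWeight s
        ≤ timeWeight s ^ 2 - timeWeight t ^ 2 := by nlinarith
      _ = (t - s) * (timeWeight s ^ 2 * timeWeight t * timeWeight t) := by rw [h1]; ring
      _ ≤ (t - s) * (timeWeight s ^ 2 * timeWeight t * timeWeight s) := by gcongr
      _ = _ := by ring
  have := le_of_mul_le_mul_right h2 ha
  linarith

lemma integral_timeWeight_pow_six_le {s t : ℝ} (hs : 0 ≤ s) (hst : s ≤ t) :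
    ∫ τ in s..t, timeWeight τ ^ 6 ≤ (t - s) * (timeWeight s ^ 4 * timeWeight t ^ 2) := by
  have h1 : ∫ τ in s..t, timeWeight τ ^ 6 ≤ ∫ τ in s..t, timeWeight s ^ 2 * timeWeight τ ^ 4 := by
    refine intervalIntegral.integral_mono_on hst (intervalIntegrable_timeWeight_pow hs hst 6)
      ((intervalIntegrable_timeWeight_pow hs hst 4).const_mul _) fun τ hτ => ?_
    have := timeWeight_anti hs hτ.1
    have := timeWeight_pos (hs.trans hτ.1)
    calc timeWeight τ ^ 6 = timeWeight τ ^ 2 * timeWeight τ ^ 4 := by ring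
      _ ≤ _ := by gcongr
  rw [intervalIntegral.integral_const_mul, integral_timeWeight_pow_four hs hst] at h1
  linarith

lemma integral_timeWeight_pow_six_le' {s t : ℝ} (hs : 0 ≤ s) (hst : s ≤ t) :
    ∫ τ in s..t, timeWeight τ ^ 6 ≤ timeWeight s ^ 4 := by
  refine (integral_timeWeight_pow_six_le hs hst).trans ?_
  have ht := hs.trans hst
  rw [timeWeight_sq ht]
  have h0 := timeWeight_pos hs
  have h1 : (t - s) * (1 + t)⁻¹ ≤ 1 := by
    rw [← div_eq_mul_inv, div_le_one (by linarith)]; linarith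
  calc (t - s) * (timeWeight s ^ 4 * (1 + t)⁻¹)
      = timeWeight s ^ 4 * ((t - s) * (1 + t)⁻¹) := by ring
    _ ≤ timeWeight s ^ 4 * 1 := by gcongr
    _ = _ := mul_one _

lemma norm_integral_le_of_timeWeight {f : ℝ → R3} {s t C : ℝ} (hs : 0 ≤ s) (hst : s ≤ t) (n : ℕ)
    (hf : ∀ τ ∈ Icc s t, ‖f τ‖ ≤ C * timeWeight τ ^ n) :
    ‖∫ τ in s..t, f τ‖ ≤ C * ∫ τ in s..t, timeWeight τ ^ n := by
  rw [← intervalIntegral.integral_const_mul]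
  exact intervalIntegral.norm_integral_le_of_norm_le hst
    (Filter.Eventually.of_forall fun τ hτ => hf τ (Ioc_subset_Icc_self hτ))
    ((intervalIntegrable_timeWeight_pow hs hst n).const_mul C)

/-! ### The averaged velocity and its decomposition -/

lemma IsCharacteristic.isCharCurve {T : ℝ} {E : ℝ → R3 → R3} {X V : ℝ → ℝ → R3 → R3 → R3}
    (hX : IsCharacteristic T E X V) {s t : ℝ} (hs : 0 ≤ s) (ht : t ∈ Icc 0 T) (x v : R3) :
    IsCharCurve E s t (fun τ => X τ t x v) (fun τ => V τ t x v) :=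
  IsCharCurve.mono (s := 0) ⟨fun τ hτ => hX.X_deriv t ht τ hτ x v,
    fun τ hτ => hX.V_deriv t ht τ hτ x v⟩ hs

lemma sub_eq_smul_PsiHat {T : ℝ} {E : ℝ → R3 → R3} {X V : ℝ → ℝ → R3 → R3 → R3}
    (hX : IsCharacteristic T E X V) {s t : ℝ} (hs : 0 ≤ s) (hst : s < t) (ht : t ≤ T) (x v : R3) :
    X s t x v = x - (t - s) • PsiHat V s t x v := by
  have htI : t ∈ Icc 0 T := ⟨hs.trans hst.le, ht⟩
  have hc := hX.isCharCurve hs htI x v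
  have h1 := integral_eq_sub_of_hasDerivWithinAt hst.le hc.pos_deriv
    (contDiff_hat.continuous.comp_continuousOn hc.continuousOn_vel)
  rw [PsiHat, smul_smul, mul_inv_cancel₀ (sub_pos.2 hst).ne', one_smul, h1, hX.X_end t htI,
    sub_sub_cancel]

/-- As long as the velocity stays within distance one of `v`, the averaged velocity stays away
from the unit sphere, quantitatively in `v`. -/
lemma norm_PsiHat_sq_le {V : ℝ → ℝ → R3 → R3 → R3} {s t : ℝ} (hst : s < t) {x v : R3}
    (hV : ∀ τ ∈ Icc s t, ‖V τ t x v - v‖ ≤ 1) :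
    (3 * jap v ^ 2)⁻¹ ≤ 1 - ‖PsiHat V s t x v‖ ^ 2 := by
  set κ := (3 * jap v ^ 2)⁻¹
  have hκ : 0 ≤ 1 - κ := by
    have h1 := le_one_sub_norm_hat_sq (hV s (left_mem_Icc.2 hst.le))
    have := sq_nonneg ‖hat (V s t x v)‖
    linarith
  have hb : ∀ τ ∈ Icc s t, ‖hat (V τ t x v)‖ ≤ √(1 - κ) := fun τ hτ =>
    Real.le_sqrt_of_sq_le (by linarith [le_one_sub_norm_hat_sq (hV τ hτ)])
  have hd : 0 < t - s := sub_pos.2 hst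
  have h1 : ‖∫ τ in s..t, hat (V τ t x v)‖ ≤ √(1 - κ) * (t - s) := by
    rw [← abs_of_pos hd]
    refine intervalIntegral.norm_integral_le_of_norm_le_const fun τ hτ => hb τ ?_
    rw [uIoc_of_le hst.le] at hτ
    exact Ioc_subset_Icc_self hτ
  have h2 : ‖PsiHat V s t x v‖ ≤ √(1 - κ) := by
    rw [PsiHat, norm_smul, norm_inv, Real.norm_of_nonneg hd.le, inv_mul_le_iff₀ hd]
    linarith
  have h3 := pow_le_pow_left₀ (norm_nonneg _) h2 2
  rw [Real.sq_sqrt hκ] at h3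
  linarith

namespace Bootstrap

variable {α₀ : ℕ} {ε T : ℝ} {D : FieldData} {X V : ℝ → ℝ → R3 → R3 → R3}

/-- Since `|E| ≲ ε ⟨τ⟩^{-3/2}` is integrable in time, velocities change by at most one. -/
lemma norm_vel_sub_le_one (h : Bootstrap α₀ ε T D) (hα : 8 ≤ α₀) (hε : 0 ≤ ε) (hε1 : ε ≤ 1 / 24)
    {s t : ℝ} (hs : 0 ≤ s) (ht : t ≤ T) {y w : ℝ → R3}
    (hc : IsCharCurve D.E s t y w) : ∀ τ ∈ Icc s t, ‖w τ - w t‖ ≤ 1 := by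
  intro τ hτ
  have hτ0 := hs.trans hτ.1
  have hc' := hc.mono hτ.1
  have h1 := integral_eq_sub_of_hasDerivWithinAt hτ.2 hc'.vel_deriv
    (h.continuousOn_E hα hε hτ0 hτ.2 ht hc'.continuousOn_pos)
  have h2 : ‖∫ r in τ..t, D.E r (y r)‖ ≤ 12 * ε * ∫ r in τ..t, timeWeight r ^ 3 := by
    refine norm_integral_le_of_timeWeight hτ0 hτ.2 3 fun r hr => ?_
    have hr0 := hτ0.trans hr.1
    have h3 := h.norm_E_le hα hε ⟨hr0, hr.2.trans ht⟩ (y r)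
    rw [jap_rpow_neg_three_halves] at h3
    have h4 := mul_le_mul_of_nonneg_left (japWeight_pow_three_le hr0) hε
    linarith
  rw [norm_sub_rev, ← h1]
  refine h2.trans ?_
  rw [integral_timeWeight_pow_three hτ0 hτ.2]
  have h5 : timeWeight τ ≤ 1 :=
    (timeWeight_le_japWeight τ hτ0).trans (japWeight_le_one τ)
  have h6 := timeWeight_pos (hτ0.trans hτ.2)
  nlinarith

/-- The averaged change of velocity is `Ψ^osc - V^osc_{t,t} + Ψ^tr`: the average of `V^osc` is
`Ψ^osc` up to `Q^{tr,1}`, and the double time integral of `Q^tr` is its first moment. -/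
lemma average_vel_sub_eq (h : Bootstrap α₀ ε T D) (hα : 8 ≤ α₀) (hε : 0 ≤ ε) (hε1 : ε ≤ 1 / 24)
    (hX : IsCharacteristic T D.E X V) {s t : ℝ} (hs : 0 ≤ s) (hst : s < t) (ht : t ≤ T)
    (x v : R3) :
    IntervalIntegrable (trIntegrand D X V s t x v) volume s t ∧
    (t - s)⁻¹ • ∫ τ in s..t, (V τ t x v - v) =
      PsiOsc D X V s t x v - Vosc D X V t t x v + PsiTr D X V s t x v := by
  have htI : t ∈ Icc 0 T := ⟨hs.trans hst.le, ht⟩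
  have hI : uIcc s t = Icc s t := uIcc_of_le hst.le
  have hc := hX.isCharCurve hs htI x v
  have hXt := hX.X_end t htI x v
  have hVt := hX.V_end t htI x v
  have hV1 := h.norm_vel_sub_le_one hα hε hε1 hs ht hc
  rw [hVt] at hV1
  obtain ⟨M, hM, hMb⟩ := exists_decay_bounds (‖v‖ + 1)
  have hQb : ∀ τ ∈ Icc s t, ‖D.Qtr τ (X τ t x v) (V τ t x v)‖ ≤ M * ε := by
    intro τ hτ
    have hτI : τ ∈ Icc 0 T := ⟨hs.trans hτ.1, hτ.2.trans ht⟩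
    have hv : ‖V τ t x v‖ ≤ ‖v‖ + 1 := by
      have := norm_sub_norm_le (V τ t x v) v
      linarith [hV1 τ hτ]
    have h1 := (hMb α₀ ε T D hα hε (by linarith) h τ hτI (X τ t x v) (V τ t x v) hv).2.1
    rw [jap_rpow_neg_three] at h1
    refine h1.trans (mul_le_of_le_one_right (by positivity) ?_)
    exact pow_le_one₀ (japWeight_pos τ).le (japWeight_le_one τ)
  obtain ⟨hVc, hQ, -⟩ := h.vel_sub_eq hα hε hs hst.le ht hc
  obtain ⟨hQ1, hVosc⟩ := h.integral_Vosc_eq hα hε hs hst.le ht hc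
  obtain ⟨hTc, hT⟩ := integral_integral_tail hst.le hQ hQb
  have hQm : IntervalIntegrable (fun τ => (τ - s) • D.Qtr τ (X τ t x v) (V τ t x v)) volume s t :=
    hQ.continuousOn_smul (by fun_prop)
  refine ⟨hQm.add hQ1, ?_⟩
  have hpt : ∀ τ ∈ Icc s t, V τ t x v - v =
      reVec (∑ σ : ℤˣ, D.EoscJ σ 1 τ (X τ t x v) (V τ t x v)) - Vosc D X V t t x v -
        ∫ r in τ..t, D.Qtr r (X r t x v) (V r t x v) := by
    intro τ hτ
    have h1 := (h.vel_sub_eq hα hε (hs.trans hτ.1) hτ.2 ht (hc.mono hτ.1)).2.2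
    rw [hVt] at h1
    rw [Vosc, hVt, ← neg_sub v, h1]
    abel
  have hVi : IntervalIntegrable (fun τ => reVec (∑ σ : ℤˣ,
      D.EoscJ σ 1 τ (X τ t x v) (V τ t x v))) volume s t :=
    ContinuousOn.intervalIntegrable (by rwa [hI])
  have hTi : IntervalIntegrable (fun τ => ∫ r in τ..t, D.Qtr r (X r t x v) (V r t x v))
      volume s t := ContinuousOn.intervalIntegrable (by rwa [hI])
  have e1 : ∫ τ in s..t, (V τ t x v - v) =
      reVec (∑ σ : ℤˣ, (D.EoscJ σ 2 t x v - D.EoscJ σ 2 s (X s t x v) (V s t x v))) -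
        (t - s) • Vosc D X V t t x v - ∫ τ in s..t, trIntegrand D X V s t x v τ := by
    rw [intervalIntegral.integral_congr fun τ hτ => hpt τ (hI ▸ hτ),
      intervalIntegral.integral_sub (hVi.sub intervalIntegrable_const) hTi,
      intervalIntegral.integral_sub hVi intervalIntegrable_const, hVosc, hT,
      intervalIntegral.integral_const, hXt, hVt]
    simp only [trIntegrand]
    rw [intervalIntegral.integral_add hQm hQ1]
    abel
  rw [e1, smul_sub, smul_sub, smul_smul, inv_mul_cancel₀ (sub_pos.2 hst).ne', one_smul, PsiOsc,
    PsiTr]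
  abel

lemma continuousOn_VQ (hX : IsCharacteristic T D.E X V) {s t : ℝ} (hs : 0 ≤ s)
    (ht : t ∈ Icc 0 T) (x v : R3) : ContinuousOn (fun τ => VQ V τ t x v) (Icc s t) := by
  have hc := (hX.isCharCurve hs ht x v).continuousOn_vel
  exact ((contDiff_hat.continuous.comp_continuousOn hc).sub continuousOn_const).sub
    ((gradHat v).continuous.comp_continuousOn (hc.sub continuousOn_const))

/-- Linearizing `V ↦ V̂` at `v` transfers the decomposition to the averaged velocity. -/
lemma PsiHat_eq (h : Bootstrap α₀ ε T D) (hα : 8 ≤ α₀) (hε : 0 ≤ ε) (hε1 : ε ≤ 1 / 24)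
    (hX : IsCharacteristic T D.E X V) {s t : ℝ} (hs : 0 ≤ s) (hst : s < t) (ht : t ≤ T)
    (x v : R3) :
    PsiHat V s t x v =
      hat v - gradHat v (Vosc D X V t t x v) + gradHat v (PsiOsc D X V s t x v)
        + gradHat v (PsiTr D X V s t x v) + PsiQ V s t x v := by
  have htI : t ∈ Icc 0 T := ⟨hs.trans hst.le, ht⟩
  have hI : uIcc s t = Icc s t := uIcc_of_le hst.le
  have hc := (hX.isCharCurve hs htI x v).continuousOn_vel
  have hVi : IntervalIntegrable (fun τ => V τ t x v - v) volume s t :=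
    ContinuousOn.intervalIntegrable (by rw [hI]; exact hc.sub continuousOn_const)
  have hGi : IntervalIntegrable (fun τ => gradHat v (V τ t x v - v)) volume s t :=
    ContinuousOn.intervalIntegrable (by
      rw [hI]; exact (gradHat v).continuous.comp_continuousOn (hc.sub continuousOn_const))
  have hQi : IntervalIntegrable (fun τ => VQ V τ t x v) volume s t :=
    ContinuousOn.intervalIntegrable (by rw [hI]; exact continuousOn_VQ hX hs htI x v)
  have e1 : ∀ τ, hat (V τ t x v) = hat v + gradHat v (V τ t x v - v) + VQ V τ t x v := by
    intro τ; rw [VQ]; abel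
  have e2 := congrArg (gradHat v) (h.average_vel_sub_eq hα hε hε1 hX hs hst ht x v).2
  rw [map_smul, ← (gradHat v).intervalIntegral_comp_comm hVi] at e2
  rw [PsiHat]
  simp only [e1]
  rw [intervalIntegral.integral_add (intervalIntegrable_const.add hGi) hQi,
    intervalIntegral.integral_add intervalIntegrable_const hGi, intervalIntegral.integral_const,
    smul_add, smul_add, smul_smul, inv_mul_cancel₀ (sub_pos.2 hst).ne', one_smul, e2, map_add,
    map_sub, PsiQ]
  abel

/-! ### Decay of the averaged velocity -/

/-- The decay estimates, for velocities in a ball. -/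
theorem exists_decay_PsiHat (R : ℝ) : ∃ C, ∀ (α₀ : ℕ) (ε T : ℝ) (D : FieldData)
    (X V : ℝ → ℝ → R3 → R3 → R3), 8 ≤ α₀ → 0 ≤ ε → ε ≤ 1 / 24 → Bootstrap α₀ ε T D →
    IsCharacteristic T D.E X V → ∀ s t : ℝ, 0 ≤ s → s < t → t ≤ T → ∀ x v : R3, ‖v‖ ≤ R →
      ‖PsiOsc D X V s t x v‖ ≤ C * ε * japWeight s ^ 3 * (t - s)⁻¹ ∧
      ‖PsiTr D X V s t x v‖ ≤ C * ε * japWeight s ^ 2 * japWeight t ^ 2 ∧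
      ‖PsiQ V s t x v‖ ≤ C * ε ^ 2 * japWeight s ^ 4 * japWeight t ^ 2 ∧
      ‖PsiHat V s t x v - hat v‖ ^ 2 ≤ C * ε ^ 2 * japWeight s ^ 4 * japWeight t ^ 2 := by
  obtain ⟨M, hM, hMb⟩ := exists_decay_bounds (R + 1)
  refine ⟨4 * M + 8 * M + 18432 * M ^ 2 + (1408 * M) ^ 2,
    fun α₀ ε T D X V hα hε hε1 h hX s t hs hst ht x v hv => ?_⟩
  have ht0 : 0 ≤ t := hs.trans hst.le
  have htI : t ∈ Icc 0 T := ⟨ht0, ht⟩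
  have hd : 0 < t - s := sub_pos.2 hst
  have hc := hX.isCharCurve hs htI x v
  have hXt := hX.X_end t htI x v
  have hVt := hX.V_end t htI x v
  have hV1 := h.norm_vel_sub_le_one hα hε hε1 hs ht hc
  rw [hVt] at hV1
  have hp := japWeight_pos s
  have hq := japWeight_pos t
  have hu := timeWeight_pos hs
  have hw := timeWeight_pos ht0
  have hup := timeWeight_le_japWeight s hs
  have hwq := timeWeight_le_japWeight t ht0
  have hbound : ∀ τ ∈ Icc s t,
      (∀ σ j, 1 ≤ j → j ≤ 2 →
        ‖D.EoscJ σ j τ (X τ t x v) (V τ t x v)‖ ≤ M * ε * japWeight τ ^ 3) ∧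
      ‖D.Qtr τ (X τ t x v) (V τ t x v)‖ ≤ M * ε * japWeight τ ^ 6 ∧
      ‖D.Qtr1 τ (X τ t x v) (V τ t x v)‖ ≤ M * ε * japWeight τ ^ 6 := by
    intro τ hτ
    have hτI : τ ∈ Icc 0 T := ⟨hs.trans hτ.1, hτ.2.trans ht⟩
    have hvR : ‖V τ t x v‖ ≤ R + 1 := by
      have := norm_sub_norm_le (V τ t x v) v
      linarith [hV1 τ hτ]
    have h1 := hMb α₀ ε T D hα hε (by linarith) h τ hτI (X τ t x v) (V τ t x v) hvR
    rwa [jap_rpow_neg_three, jap_rpow_neg_three_halves] at h1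
  have hMε : 0 ≤ M * ε := by positivity
  -- the velocity moves by `O(ε ⟨τ⟩^{-3/2})`
  have hvel : ∀ τ ∈ Icc s t, ‖V τ t x v - v‖ ≤ 16 * (M * ε) * japWeight τ ^ 3 := by
    intro τ hτ
    have hτ0 := hs.trans hτ.1
    have h1 := (h.vel_sub_eq hα hε hτ0 hτ.2 ht (hc.mono hτ.1)).2.2
    have hpτ := japWeight_pos τ
    have huτ := timeWeight_pos hτ0
    have hb1 := norm_reVec_sum_le (f := fun σ => D.EoscJ σ 1 t (X t t x v) (V t t x v))
      fun σ => (hbound t (right_mem_Icc.2 hst.le)).1 σ 1 le_rfl (by norm_num)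
    have hb2 := norm_reVec_sum_le (f := fun σ => D.EoscJ σ 1 τ (X τ t x v) (V τ t x v))
      fun σ => (hbound τ hτ).1 σ 1 le_rfl (by norm_num)
    have hb3 : ‖∫ r in τ..t, D.Qtr r (X r t x v) (V r t x v)‖ ≤
        8 * (M * ε) * ∫ r in τ..t, timeWeight r ^ 6 := by
      refine norm_integral_le_of_timeWeight hτ0 hτ.2 6 fun r hr => ?_
      refine (hbound r ⟨hτ.1.trans hr.1, hr.2⟩).2.1.trans ?_
      have := mul_le_mul_of_nonneg_left (japWeight_pow_six_le (hτ0.trans hr.1)) hMε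
      linarith
    have hb4 : ∫ r in τ..t, timeWeight r ^ 6 ≤ japWeight τ ^ 3 := by
      refine (integral_timeWeight_pow_six_le' hτ0 hτ.2).trans ?_
      calc timeWeight τ ^ 4 ≤ japWeight τ ^ 4 := by
            gcongr; exact timeWeight_le_japWeight τ hτ0
        _ ≤ japWeight τ ^ 3 := pow_le_pow_of_le_one hpτ.le (japWeight_le_one τ) (by norm_num)
    have hb5 : japWeight t ^ 3 ≤ japWeight τ ^ 3 := by
      gcongr; exact japWeight_anti hτ0 hτ.2
    have hb6 := mul_le_mul_of_nonneg_left hb4 hMε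
    have hb7 := mul_le_mul_of_nonneg_left hb5 hMε
    have hb8 : 0 ≤ M * ε * japWeight τ ^ 3 := by positivity
    simp only [hVt] at h1 hb1
    rw [norm_sub_rev, h1]
    refine (norm_add_le_of_le (norm_sub_le_of_le hb1 hb2) hb3).trans ?_
    linarith
  have hVQ : ∀ τ ∈ Icc s t, ‖VQ V τ t x v‖ ≤ 18432 * (M * ε) ^ 2 * timeWeight τ ^ 6 := by
    intro τ hτ
    have h1 := norm_hat_taylor_le v (V τ t x v) (hV1 τ hτ)
    have h2 : jap v ^ (-2 : ℝ) ≤ 1 :=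
      Real.rpow_le_one_of_one_le_of_nonpos (one_le_jap v) (by norm_num)
    have h3 := japWeight_pow_six_le (hs.trans hτ.1)
    rw [VQ]
    refine h1.trans ?_
    calc 9 * jap v ^ (-2 : ℝ) * ‖V τ t x v - v‖ ^ 2
        ≤ 9 * 1 * (16 * (M * ε) * japWeight τ ^ 3) ^ 2 := by
          gcongr
          exact hvel τ hτ
      _ = 2304 * (M * ε) ^ 2 * japWeight τ ^ 6 := by ring
      _ ≤ 2304 * (M * ε) ^ 2 * (8 * timeWeight τ ^ 6) := by gcongr
      _ = _ := by ring
  have hhat : ∀ τ ∈ Icc s t, ‖hat (V τ t x v) - hat v‖ ≤ 704 * (M * ε) * timeWeight τ ^ 3 := by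
    intro τ hτ
    have h1 := norm_hat_taylor_le v (V τ t x v) (hV1 τ hτ)
    have h2 : jap v ^ (-2 : ℝ) ≤ 1 :=
      Real.rpow_le_one_of_one_le_of_nonpos (one_le_jap v) (by norm_num)
    have h3 := japWeight_pow_three_le (hs.trans hτ.1)
    have h4 := norm_gradHat_le v (V τ t x v - v)
    have h5 := hV1 τ hτ
    have h6 : 9 * jap v ^ (-2 : ℝ) * ‖V τ t x v - v‖ ^ 2 ≤ 9 * 1 * (1 * ‖V τ t x v - v‖) := by
      rw [sq]; gcongr
    have h7 : ‖hat (V τ t x v) - hat v‖ ≤ 11 * ‖V τ t x v - v‖ := by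
      have := norm_add_le (hat (V τ t x v) - hat v - gradHat v (V τ t x v - v))
        (gradHat v (V τ t x v - v))
      rw [sub_add_cancel] at this
      linarith
    have h8 := hvel τ hτ
    have h9 := mul_le_mul_of_nonneg_left h3 hMε
    linarith
  have hsI := left_mem_Icc.2 hst.le
  have htI' := right_mem_Icc.2 hst.le
  have havg : ∀ {z : R3} {c : ℝ}, ‖z‖ ≤ (t - s) * c → ‖(t - s)⁻¹ • z‖ ≤ c := by
    intro z c hz
    rwa [norm_smul, norm_inv, Real.norm_of_nonneg hd.le, inv_mul_le_iff₀ hd]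
  have hs4 : timeWeight s ^ 4 * timeWeight t ^ 2 ≤ japWeight s ^ 4 * japWeight t ^ 2 := by gcongr
  have hM2 : 0 ≤ M ^ 2 := sq_nonneg M
  refine ⟨?_, ?_, ?_, ?_⟩
  · have hb := norm_reVec_sum_le
      (f := fun σ => D.EoscJ σ 2 t x v - D.EoscJ σ 2 s (X s t x v) (V s t x v))
      (b := 2 * (M * ε * japWeight s ^ 3)) fun σ => by
        have h1 := (hbound t htI').1 σ 2 (by norm_num) le_rfl
        have h2 := (hbound s hsI).1 σ 2 (by norm_num) le_rfl
        rw [hXt, hVt] at h1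
        have h3 : japWeight t ^ 3 ≤ japWeight s ^ 3 := by
          gcongr; exact japWeight_anti hs hst.le
        have h4 := mul_le_mul_of_nonneg_left h3 hMε
        exact (norm_sub_le_of_le h1 h2).trans (by linarith)
    rw [PsiOsc, norm_smul, norm_inv, Real.norm_of_nonneg hd.le, mul_comm]
    refine mul_le_mul_of_nonneg_right (hb.trans ?_) (inv_nonneg.2 hd.le)
    have h5 : 0 ≤ ε * japWeight s ^ 3 := by positivity
    have h6 : 0 ≤ (8 * M + 18432 * M ^ 2 + (1408 * M) ^ 2) * (ε * japWeight s ^ 3) := by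
      positivity
    linarith
  · have hb : ∀ τ ∈ Icc s t, ‖trIntegrand D X V s t x v τ‖ ≤ 8 * (M * ε) * timeWeight τ ^ 4 := by
      intro τ hτ
      have hτ0 := hs.trans hτ.1
      have h1 := (hbound τ hτ).2.1
      have h2 := (hbound τ hτ).2.2
      have h3 := mul_le_mul_of_nonneg_left (japWeight_pow_six_le hτ0) hMε
      have h4 : (1 + τ) * timeWeight τ ^ 2 = 1 := by
        rw [timeWeight_sq hτ0, mul_inv_cancel₀ (by linarith)]
      have h5 : 0 ≤ τ - s := sub_nonneg.2 hτ.1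
      have huτ := timeWeight_pos hτ0
      -- the weight `τ - s` of `Q^tr` costs one power of `1 + τ`
      calc ‖trIntegrand D X V s t x v τ‖
          ≤ (τ - s) * (M * ε * japWeight τ ^ 6) + M * ε * japWeight τ ^ 6 := by
            refine norm_add_le_of_le ?_ h2
            rw [norm_smul, Real.norm_of_nonneg h5]
            gcongr
        _ = (1 + τ - s) * (M * ε * japWeight τ ^ 6) := by ring
        _ ≤ (1 + τ) * (M * ε * (8 * timeWeight τ ^ 6)) := by
            gcongr
            linarith
        _ = 8 * (M * ε) * timeWeight τ ^ 4 * ((1 + τ) * timeWeight τ ^ 2) := by ring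
        _ = _ := by rw [h4, mul_one]
    have h1 := norm_integral_le_of_timeWeight hs hst.le 4 hb
    rw [integral_timeWeight_pow_four hs hst.le] at h1
    rw [PsiTr, norm_neg]
    have h2 := havg (h1.trans_eq (mul_left_comm _ _ _))
    refine h2.trans ?_
    have h3 : timeWeight s ^ 2 * timeWeight t ^ 2 ≤ japWeight s ^ 2 * japWeight t ^ 2 := by gcongr
    have h4 := mul_le_mul_of_nonneg_left h3 hMε
    have h6 : 0 ≤ (4 * M + 18432 * M ^ 2 + (1408 * M) ^ 2) *
        (ε * (japWeight s ^ 2 * japWeight t ^ 2)) := by positivity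
    linarith
  · have h1 := norm_integral_le_of_timeWeight hs hst.le 6 hVQ
    have h2 : ‖∫ τ in s..t, VQ V τ t x v‖ ≤
        (t - s) * (18432 * (M * ε) ^ 2 * (timeWeight s ^ 4 * timeWeight t ^ 2)) := by
      refine h1.trans ?_
      have := mul_le_mul_of_nonneg_left (integral_timeWeight_pow_six_le hs hst.le)
        (show 0 ≤ 18432 * (M * ε) ^ 2 by positivity)
      linarith
    rw [PsiQ]
    refine (havg h2).trans ?_
    have h4 := mul_le_mul_of_nonneg_left hs4 (show 0 ≤ 18432 * (M * ε) ^ 2 by positivity)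
    have h6 : 0 ≤ (4 * M + 8 * M + (1408 * M) ^ 2) *
        (ε ^ 2 * (japWeight s ^ 4 * japWeight t ^ 2)) := by positivity
    linarith
  · have e : PsiHat V s t x v - hat v = (t - s)⁻¹ • ∫ τ in s..t, (hat (V τ t x v) - hat v) := by
      have hi : IntervalIntegrable (fun τ => hat (V τ t x v)) volume s t :=
        ContinuousOn.intervalIntegrable (by
          rw [uIcc_of_le hst.le]
          exact contDiff_hat.continuous.comp_continuousOn hc.continuousOn_vel)
      rw [intervalIntegral.integral_sub hi intervalIntegrable_const,
        intervalIntegral.integral_const, smul_sub, smul_smul, inv_mul_cancel₀ hd.ne', one_smul,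
        PsiHat]
    have h1 := norm_integral_le_of_timeWeight hs hst.le 3 hhat
    have h2 : ‖∫ τ in s..t, (hat (V τ t x v) - hat v)‖ ≤
        (t - s) * (1408 * (M * ε) * (timeWeight s ^ 2 * timeWeight t)) := by
      refine h1.trans ?_
      have := mul_le_mul_of_nonneg_left (integral_timeWeight_pow_three_le hs hst.le)
        (show 0 ≤ 704 * (M * ε) by positivity)
      linarith
    rw [e]
    refine (pow_le_pow_left₀ (norm_nonneg _) (havg h2) 2).trans ?_
    have h4 := mul_le_mul_of_nonneg_left hs4 (show 0 ≤ (1408 * (M * ε)) ^ 2 by positivity)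
    have h6 : 0 ≤ (4 * M + 8 * M + 18432 * M ^ 2) *
        (ε ^ 2 * (japWeight s ^ 4 * japWeight t ^ 2)) := by positivity
    linarith

end Bootstrap

end VKG

open VKG in
theorem proposition3p4 (α₀ : ℕ) (hα₀ : 8 ≤ α₀) :
    ∃ ε₀ : ℝ, 0 < ε₀ ∧ ∃ C₀ : ℝ, ∃ C : Set R3 → ℝ,
      ∀ (ε T : ℝ) (D : FieldData) (X V : ℝ → ℝ → R3 → R3 → R3),
        0 < ε → ε ≤ ε₀ → Bootstrap α₀ ε T D → IsCharacteristic T D.E X V →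
        ∀ s t : ℝ, 0 ≤ s → s < t → t ≤ T → ∀ x v : R3,
          -- the averaged velocity
          X s t x v = x - (t - s) • PsiHat V s t x v ∧
          ‖PsiHat V s t x v‖ < 1 ∧
          IntervalIntegrable (trIntegrand D X V s t x v) volume s t ∧
          IntervalIntegrable (fun τ => VQ V τ t x v) volume s t ∧
          -- the decomposition of `Ψ̂`
          PsiHat V s t x v =
            hat v - gradHat v (Vosc D X V t t x v) + gradHat v (PsiOsc D X V s t x v)
              + gradHat v (PsiTr D X V s t x v) + PsiQ V s t x v ∧
          ‖VQ V s t x v‖ ≤ C₀ * jap v ^ (-2 : ℝ) * ‖V s t x v - v‖ ^ 2 ∧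
          -- the decomposition of `Ψ`, with remainder `Ψ^R`
          ∃ PsiR : R3,
            Psi V s t x v =
              v - Vosc D X V t t x v + PsiOsc D X V s t x v + PsiTr D X V s t x v + PsiR ∧
            ‖PsiR - gradUnhat v (PsiQ V s t x v)‖ ≤
              C₀ * jap v ^ (5 : ℝ) * ‖PsiHat V s t x v - hat v‖ ^ 2 ∧
            -- the decay bounds, uniform for `v` in compact sets
            ∀ K : Set R3, IsCompact K → v ∈ K →
              ‖PsiOsc D X V s t x v‖ ≤ C K * ε * jap s ^ (-(3 / 2) : ℝ) * (t - s)⁻¹ ∧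
              ‖PsiTr D X V s t x v‖ ≤ C K * ε * (jap s)⁻¹ * (jap t)⁻¹ ∧
              ‖PsiQ V s t x v‖ ≤ C K * ε ^ 2 * jap s ^ (-2 : ℝ) * (jap t)⁻¹ ∧
              jap v ^ (-3 : ℝ) * ‖PsiR‖ ≤ C K * ε ^ 2 * jap s ^ (-2 : ℝ) * (jap t)⁻¹ ∧
              ‖PsiHat V s t x v - hat v + gradHat v (Vosc D X V t t x v)‖ ≤
                C K * ε * (jap s)⁻¹ * (t - s)⁻¹ ∧
              ‖X s t x v - x + (t - s) • (hat v - gradHat v (Vosc D X V t t x v))‖ ≤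
                C K * ε * (jap s)⁻¹ := by
  have hK : ∀ K : Set R3, ∃ R : ℝ, IsCompact K → ∀ v ∈ K, ‖v‖ ≤ R := by
    intro K
    by_cases hK : IsCompact K
    · obtain ⟨R, hR⟩ := hK.isBounded.exists_norm_le
      exact ⟨R, fun _ => hR⟩
    · exact ⟨0, fun h => absurd h hK⟩
  choose R hR using hK
  choose c hc using fun K => Bootstrap.exists_decay_PsiHat (R K)
  refine ⟨1 / 24, by norm_num, 21,
    fun K => 5 * |c K| + 21 * (1 + |R K|) ^ 2 * |c K|, ?_⟩
  intro ε T D X V hε hε1 hB hX s t hs hst ht x v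
  have hd : 0 < t - s := sub_pos.2 hst
  have htI : t ∈ Icc 0 T := ⟨hs.trans hst.le, ht⟩
  have hcc := hX.isCharCurve hs htI x v
  have hV1 := hB.norm_vel_sub_le_one hα₀ hε.le hε1 hs ht hcc
  rw [hX.V_end t htI x v] at hV1
  have hV1s := hV1 s (left_mem_Icc.2 hst.le)
  have hXe := sub_eq_smul_PsiHat hX hs hst ht x v
  have hPe := hB.PsiHat_eq hα₀ hε.le hε1 hX hs hst ht x v
  have hgap := norm_PsiHat_sq_le hst hV1
  have hJ := jap_pos v
  have hr5 : 0 ≤ jap v ^ (5 : ℝ) := Real.rpow_nonneg hJ.le _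
  have htay := norm_unhat_taylor_le v (PsiHat V s t x v) hgap
  have hlt : ‖PsiHat V s t x v‖ < 1 := by
    have h1 : 0 < (3 * jap v ^ 2)⁻¹ := by positivity
    nlinarith [norm_nonneg (PsiHat V s t x v)]
  -- `Ψ^R` is `∇_{v̂} v Ψ^Q` plus the Taylor remainder of `v̂ ↦ v`
  have hRem : Psi V s t x v - (v - Vosc D X V t t x v + PsiOsc D X V s t x v +
      PsiTr D X V s t x v) - gradUnhat v (PsiQ V s t x v) =
      unhat (PsiHat V s t x v) - v - gradUnhat v (PsiHat V s t x v - hat v) := by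
    have e : PsiHat V s t x v - hat v = gradHat v (-Vosc D X V t t x v + PsiOsc D X V s t x v +
        PsiTr D X V s t x v) + PsiQ V s t x v := by
      rw [map_add, map_add, map_neg]
      nth_rewrite 1 [hPe]
      abel
    rw [e, map_add, gradUnhat_gradHat, Psi]
    abel
  refine ⟨hXe, hlt, (hB.average_vel_sub_eq hα₀ hε.le hε1 hX hs hst ht x v).1,
    ContinuousOn.intervalIntegrable (by
      rw [uIcc_of_le hst.le]; exact Bootstrap.continuousOn_VQ hX hs htI x v), hPe, ?_,
    Psi V s t x v - (v - Vosc D X V t t x v + PsiOsc D X V s t x v + PsiTr D X V s t x v),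
    by abel, hRem ▸ htay, fun K hKc hvK => ?_⟩
  · refine (norm_hat_taylor_le v _ hV1s).trans ?_
    gcongr
    norm_num
  have hvR := hR K hKc v hvK
  obtain ⟨b1, b2, b3, b4⟩ := hc K α₀ ε T D X V hα₀ hε.le hε1 hB hX s t hs hst ht x v hvR
  have hcle := le_abs_self (c K)
  have hc0 := abs_nonneg (c K)
  have hp := japWeight_pos s
  have hq := japWeight_pos t
  have hC : |c K| ≤ 5 * |c K| + 21 * (1 + |R K|) ^ 2 * |c K| := by
    have : 0 ≤ 21 * (1 + |R K|) ^ 2 * |c K| := by positivity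
    linarith
  have hC5 : 5 * |c K| ≤ 5 * |c K| + 21 * (1 + |R K|) ^ 2 * |c K| := by
    have : 0 ≤ 21 * (1 + |R K|) ^ 2 * |c K| := by positivity
    linarith
  rw [jap_rpow_neg_three_halves, jap_rpow_neg_two, ← japWeight_sq, ← japWeight_sq]
  have hback : ‖PsiHat V s t x v - hat v + gradHat v (Vosc D X V t t x v)‖ ≤
      (5 * |c K| + 21 * (1 + |R K|) ^ 2 * |c K|) * ε * japWeight s ^ 2 * (t - s)⁻¹ := by
    have e : PsiHat V s t x v - hat v + gradHat v (Vosc D X V t t x v) =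
        gradHat v (PsiOsc D X V s t x v) + gradHat v (PsiTr D X V s t x v) +
          PsiQ V s t x v := by
      nth_rewrite 1 [hPe]
      abel
    have hti : japWeight t ^ 2 ≤ (t - s)⁻¹ := by
      rw [japWeight_sq]
      refine inv_anti₀ hd ?_
      have := norm_lt_jap t
      rw [Real.norm_of_nonneg htI.1] at this
      linarith
    have g1 := norm_gradHat_le v (PsiOsc D X V s t x v)
    have g2 := norm_gradHat_le v (PsiTr D X V s t x v)
    have hi := inv_pos.2 hd
    have p1 := japWeight_le_one s
    have k1 : ‖PsiOsc D X V s t x v‖ ≤ |c K| * ε * japWeight s ^ 2 * (t - s)⁻¹ := by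
      refine b1.trans ?_
      have : japWeight s ^ 3 ≤ japWeight s ^ 2 := pow_le_pow_of_le_one hp.le p1 (by norm_num)
      gcongr
    have k2 : ‖PsiTr D X V s t x v‖ ≤ |c K| * ε * japWeight s ^ 2 * (t - s)⁻¹ := by
      refine b2.trans ?_
      gcongr
    have k3 : ‖PsiQ V s t x v‖ ≤ |c K| * ε * japWeight s ^ 2 * (t - s)⁻¹ := by
      refine b3.trans ?_
      have h1 : japWeight s ^ 4 ≤ japWeight s ^ 2 := pow_le_pow_of_le_one hp.le p1 (by norm_num)
      have h2 : ε ^ 2 ≤ ε := by nlinarith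
      gcongr
    rw [e]
    refine (norm_add_le_of_le (norm_add_le_of_le g1 g2) k3).trans ?_
    have : 5 * |c K| * (ε * japWeight s ^ 2 * (t - s)⁻¹) ≤
        (5 * |c K| + 21 * (1 + |R K|) ^ 2 * |c K|) * (ε * japWeight s ^ 2 * (t - s)⁻¹) :=
      mul_le_mul_of_nonneg_right hC5 (by positivity)
    linarith
  refine ⟨b1.trans ?_, b2.trans ?_, b3.trans ?_, ?_, hback, ?_⟩
  · have := inv_pos.2 hd
    gcongr
    exact hcle.trans hC
  · gcongr
    exact hcle.trans hC
  · gcongr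
    exact hcle.trans hC
  · set PR := Psi V s t x v - (v - Vosc D X V t t x v + PsiOsc D X V s t x v +
      PsiTr D X V s t x v)
    have hr3 : jap v ^ (-3 : ℝ) = (jap v ^ 3)⁻¹ := by
      rw [Real.rpow_neg hJ.le]; norm_cast
    have hr5' : jap v ^ (5 : ℝ) = jap v ^ 5 := by norm_cast
    have h1 : ‖PR‖ ≤ 2 * jap v ^ 3 * ‖PsiQ V s t x v‖ +
        21 * jap v ^ 5 * ‖PsiHat V s t x v - hat v‖ ^ 2 := by
      have h2 : ‖PR - gradUnhat v (PsiQ V s t x v)‖ ≤ _ := hRem ▸ htay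
      have h3 := norm_gradUnhat_le v (PsiQ V s t x v)
      have h4 := norm_add_le (PR - gradUnhat v (PsiQ V s t x v)) (gradUnhat v (PsiQ V s t x v))
      rw [sub_add_cancel] at h4
      rw [hr5'] at h2
      linarith
    have hjR : jap v ≤ 1 + |R K| := by
      have := jap_le_one_add v
      linarith [le_abs_self (R K)]
    have hY : 0 ≤ ε ^ 2 * japWeight s ^ 4 * japWeight t ^ 2 := by positivity
    have b3' : ‖PsiQ V s t x v‖ ≤ |c K| * (ε ^ 2 * japWeight s ^ 4 * japWeight t ^ 2) := by
      have := mul_le_mul_of_nonneg_right hcle hY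
      linarith
    have b4' : ‖PsiHat V s t x v - hat v‖ ^ 2 ≤
        |c K| * (ε ^ 2 * japWeight s ^ 4 * japWeight t ^ 2) := by
      have := mul_le_mul_of_nonneg_right hcle hY
      linarith
    rw [hr3, inv_mul_le_iff₀ (by positivity)]
    calc ‖PR‖ ≤ 2 * jap v ^ 3 * ‖PsiQ V s t x v‖ +
          21 * jap v ^ 5 * ‖PsiHat V s t x v - hat v‖ ^ 2 := h1
      _ = jap v ^ 3 * (2 * ‖PsiQ V s t x v‖ +
          21 * jap v ^ 2 * ‖PsiHat V s t x v - hat v‖ ^ 2) := by ring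
      _ ≤ jap v ^ 3 * (5 * (|c K| * (ε ^ 2 * japWeight s ^ 4 * japWeight t ^ 2)) +
          21 * (1 + |R K|) ^ 2 * (|c K| * (ε ^ 2 * japWeight s ^ 4 * japWeight t ^ 2))) := by
        gcongr
        norm_num
      _ = _ := by ring
  · have e : X s t x v - x + (t - s) • (hat v - gradHat v (Vosc D X V t t x v)) =
        -((t - s) • (PsiHat V s t x v - hat v + gradHat v (Vosc D X V t t x v))) := by
      rw [hXe]; module
    rw [e, norm_neg, norm_smul, Real.norm_of_nonneg hd.le]
    calc (t - s) * _ ≤ (t - s) * ((5 * |c K| + 21 * (1 + |R K|) ^ 2 * |c K|) * ε *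
          japWeight s ^ 2 * (t - s)⁻¹) := by gcongr
      _ = _ := by field_simp
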